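/- Let $\mathbb{D}=\{z\in\mathbb{C}:|z|<1\}$. For a set $\Omega\subset\mathbb{C}$, the opening angle of $\Omega$ at $\infty$ is the measure of the set of all $t\in(-\pi,\pi]$ such that $re^{it}\in\Omega$ for all sufficiently large $r>0$. For $\alpha\in(1,2]$ let $CO(\alpha)$ be the family of functions $f$ that are analytic and univalent in $\mathbb{D}$ and satisfy $f(0)=0$, $f'(0)=1$, $f(1)=\infty$ (that is, $|f(z)|\to\infty$ as $z\to1$, $z\in\mathbb{D}$), and are such that $\mathbb{C}\setminus f(\mathbb{D})$ is convex and the opening angle of $f(\mathbb{D})$ at $\infty$ is at most $\pi\alpha$. Let $A_n(\alpha)$ be the Taylor coefficients $$\left(\frac{1+z}{1-z}\right)^{\alpha}=1+\sum_{n=1}^{\infty}A_n(\alpha)z^n\qquad(z\in\mathbb{D},\ \text{principal branch}),$$ which are real. Let $\alpha\in(1,2]$. If $f(z)=z+\sum_{n=2}^{\infty}a_nz^n$ belongs to $CO(\alpha)$, then $$|a_n|\le\frac{1}{2\alpha}A_n(\alpha)\qquad\text{for all } n\ge2,$$ and this is sharp: there is a function in $CO(\alpha)$ for which equality holds for every $n\ge2$.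 Moreover, if $f(z)=z+\sum_{n=2}^{\infty}a_nz^n$ belongs to $CO(2)$, then $$\left|a_n-\frac{n+1}{2}\right|\le\frac{n-1}{2}\qquad\text{for all } n\ge2,$$ and this is sharp: there is a function in $CO(2)$ for which equality holds for every $n\ge2$. -/

import Mathlib

open Filter Topology MeasureTheory

namespace ConcaveUnivalent

/-- The opening angle at infinity of a plane set `Ω`: the total angle of all directions `e^{it}`,
`-π < t ≤ π`, in which `Ω` reaches infinity, that is, for which `r e^{it}` lies in `Ω` for all
sufficiently large `r`. For a sector of opening `θ`, and for every translate of it, this is `θ`. -/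
noncomputable def openingAngleAtInfinity (Ω : Set ℂ) : ENNReal :=
  volume {t : ℝ | t ∈ Set.Ioc (-Real.pi) Real.pi ∧
    ∀ᶠ r : ℝ in atTop, (r : ℂ) * Complex.exp ((t : ℂ) * Complex.I) ∈ Ω}

/-- `CO α`: the concave univalent functions on the open unit disk whose image has opening angle at
most `π α` at infinity. Functions are total on `ℂ`; only their values on the disk matter. -/
structure IsCO (α : ℝ) (f : ℂ → ℂ) : Prop where
  /-- `f` is analytic in the unit disk -/
  analytic : DifferentiableOn ℂ f (Metric.ball 0 1)
  /-- `f` is univalent in the unit disk -/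
  univalent : Set.InjOn f (Metric.ball 0 1)
  /-- `ℂ \ f(𝔻)` is convex -/
  convex_compl : Convex ℝ (f '' Metric.ball 0 1)ᶜ
  /-- `f(0) = 0` -/
  map_zero : f 0 = 0
  /-- `f'(0) = 1` -/
  deriv_zero : deriv f 0 = 1
  /-- `f(1) = ∞` -/
  map_one : Tendsto f (𝓝[Metric.ball 0 1] 1) (Bornology.cobounded ℂ)
  /-- the opening angle of `f(𝔻)` at infinity is at most `π α` -/
  angle_le : openingAngleAtInfinity (f '' Metric.ball 0 1) ≤ ENNReal.ofReal (Real.pi * α)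

/-- `f(z) = z + ∑_{n ≥ 2} a n * z ^ n` in the unit disk (`a 0` and `a 1` play no role). -/
def HasExpansion (f : ℂ → ℂ) (a : ℕ → ℂ) : Prop :=
  ∀ z ∈ Metric.ball (0 : ℂ) 1, HasSum (fun n : ℕ => a (n + 2) * z ^ (n + 2)) (f z - z)

/-- The `n`-th Taylor coefficient `A_n(α)` at `0` of `((1 + z) / (1 - z)) ^ α`, with the principal
branch of the power (`(1 + z) / (1 - z)` has positive real part in the disk). This coefficient is
real, and it is recorded as a real number. -/
noncomputable def A (α : ℝ) (n : ℕ) : ℝ :=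
  (iteratedDeriv n (fun z : ℂ => ((1 + z) / (1 - z)) ^ (α : ℂ)) 0 / (n.factorial : ℂ)).re

end ConcaveUnivalent

/-!
The whole proof rests on the following inequality for a concave function `f` with `f(1) = ∞` and
a point `k` omitted by `f`:
`Re ((f - k) / ((1 - z)² f')) ≥ 0` in the disk.
Since the omitted set `K` is convex, `φ_λ = f⁻¹ (k + λ (f - k))` maps the disk to itself when
`λ > 1`, and it has no fixed point. By Wolff's lemma the horodisks at some boundary point `σ_λ` are
invariant under `φ_λ`; letting `λ → 1` differentiates this invariance and gives the inequality with
a limit `σ` of the `σ_λ` in place of `1`. Were `σ ≠ 1`, then `|f - k|` would increase along the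
hyperbolic geodesic from `1` to `σ`, and so stay bounded at its end `1`, against `f(1) = ∞`.

Letting `k` tend to infinity along a ray of `K` in the direction `d`, one gets
`Re (-conj d * (1 - z)² f') ≥ 0`. The directions `d` that `K` recedes in fill an angle of at least
`π (2 - α)`, by the bound on the opening angle. With `u = (1 + z) / (1 - z)`, this makes
`W = (1 - z)² f' u ^ (2 - α)` a function with values in a half-plane bounded by a line through `0`,
and `W 0 = 1`, so the coefficients of `W` are at most `2` in modulus (Carathéodory). Now
`f' = (1 - z)⁻² u ^ (α - 2) W`, where the first two factors have a product with nonnegative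
coefficients, and replacing `W` by `u = 1 + 2 z + 2 z² + ⋯` gives the bound `A_n(α) / (2α)`.

For `α = 2`, put `F u = f z` on the right half-plane. On the line `Re u = h` the point `u + i s - h`
is on the boundary, so the inequality above says there that `F' u / (F u - F (u + i s - h))` has
nonnegative real part, and the minimum principle extends this to `Re u > h`. For `h → 0` it follows
that the image of a vertical line stays on one side of its tangents, whence `Re (F'' / F') ≥ 0`.
Together with the Schwarz–Pick bound `|F'' / F'| ≤ 1 / Re u`, which comes from a direction of
recession, and with Julia's lemma at infinity, this improves to `Re q ≥ Re u |q|²` for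
`q = F'' / F'`. It implies `Re (z D' / D) < 1 / 2` for `D = (1 - z)³ f'` in the disk, and Jack's
lemma yields `|D - 1| < 1`, that is,
`(1 - z)³ f' = 1 - z ψ` with `|ψ| ≤ 1`. The coefficient of `ψ (1 - z)⁻³` is a sum of Fejér type,
bounded by the value that it takes for `ψ = 1`, and this is the stated disk for `a_n`.

Equality holds throughout for the conformal map `(u ^ α - 1) / (2α)` onto a sector, which for
`α = 2` is the Koebe function.
-/

namespace ConcaveUnivalent

open Metric Set Complex ComplexConjugate

/-! ### Complex analysis in the disk and the half-plane -/

/-- Minimum principle for the real part of a holomorphic function on an open set `U`, in the form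
that does not mention boundary values: the real part exceeds `-ε` off a compact subset of `U`. -/
theorem re_nonneg_of_forall_exists_isCompact {U : Set ℂ} (hU : IsOpen U) {φ : ℂ → ℂ}
    (hφ : DifferentiableOn ℂ φ U)
    (h : ∀ ε > 0, ∃ C ⊆ U, IsCompact C ∧ ∀ z ∈ U \ C, -ε ≤ (φ z).re) :
    ∀ z ∈ U, 0 ≤ (φ z).re := by
  intro z hz
  by_contra! hneg
  obtain ⟨C, hCU, hC, hoff⟩ := h (-(φ z).re / 2) (by linarith)
  have hzC : z ∈ C := by
    by_contra hzC
    have := hoff z ⟨hz, hzC⟩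
    linarith
  have hcont : ContinuousOn (fun w => (φ w).re) U := continuous_re.comp_continuousOn hφ.continuousOn
  obtain ⟨c, hcC, hc⟩ := hC.exists_isMinOn ⟨z, hzC⟩ (hcont.mono hCU)
  have hcz : (φ c).re ≤ (φ z).re := hc hzC
  have hmin : ∀ w ∈ U, (φ c).re ≤ (φ w).re := by
    intro w hw
    by_cases hwC : w ∈ C
    · exact hc hwC
    · have := hoff w ⟨hw, hwC⟩
      linarith
  set M : Set ℂ := C ∩ (fun w => (φ w).re) ⁻¹' {(φ c).re}
  have hMC : IsClosed M := (hcont.mono hCU).preimage_isClosed_of_isClosed hC.isClosed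
    isClosed_singleton
  have hMo : IsOpen M := by
    refine isOpen_iff_mem_nhds.2 fun w hw => ?_
    have hwU := hCU hw.1
    have hwc : (φ w).re = (φ c).re := hw.2
    have hd : ∀ᶠ y in 𝓝 w, DifferentiableAt ℂ (fun y => exp (-φ y)) y := by
      filter_upwards [hU.mem_nhds hwU] with y hy
      exact ((hφ.differentiableAt (hU.mem_nhds hy)).neg).cexp
    have hloc : IsLocalMax (norm ∘ fun y => exp (-φ y)) w := by
      filter_upwards [hU.mem_nhds hwU] with y hy
      simp only [Function.comp, norm_exp, neg_re, Real.exp_le_exp, neg_le_neg_iff]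
      rw [hwc]
      exact hmin y hy
    filter_upwards [norm_eventually_eq_of_isLocalMax hd hloc, hU.mem_nhds hwU] with y hy hyU
    simp only [norm_exp, neg_re, Real.exp_eq_exp, neg_inj] at hy
    have hyc : (φ y).re = (φ c).re := by rw [hy, hwc]
    refine ⟨?_, hyc⟩
    by_contra hyC
    have := hoff y ⟨hyU, hyC⟩
    linarith
  have hMuniv : M = univ := IsClopen.eq_univ ⟨hMC, hMo⟩ ⟨c, hcC, rfl⟩
  have : IsCompact (univ : Set ℂ) := hMuniv ▸ hC.of_isClosed_subset hMC inter_subset_left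
  exact noncompact_univ ℂ this

theorem sq_norm_one_sub_conj_mul (a b : ℂ) :
    ‖1 - conj b * a‖ ^ 2 - ‖a - b‖ ^ 2 = (1 - ‖a‖ ^ 2) * (1 - ‖b‖ ^ 2) := by
  simp only [Complex.sq_norm, Complex.normSq_apply, sub_re, sub_im, mul_re, mul_im, conj_re,
    conj_im, one_re, one_im]
  ring

theorem sq_norm_add_conj (a b : ℂ) :
    ‖a + conj b‖ ^ 2 - ‖a - b‖ ^ 2 = 4 * a.re * b.re := by
  simp only [Complex.sq_norm, Complex.normSq_apply, sub_re, sub_im, add_re, add_im, conj_re,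
    conj_im]
  ring

theorem add_conj_ne_zero {a b : ℂ} (ha : 0 < a.re) (hb : 0 < b.re) : a + conj b ≠ 0 := by
  intro h
  have := congrArg re h
  simp at this
  linarith

theorem norm_sub_lt_norm_add_conj {a b : ℂ} (ha : 0 < a.re) (hb : 0 < b.re) :
    ‖a - b‖ < ‖a + conj b‖ := by
  refine lt_of_pow_lt_pow_left₀ 2 (norm_nonneg _) ?_
  have := sq_norm_add_conj a b
  have : 0 < a.re * b.re := by positivity
  linarith

theorem one_sub_conj_mul_ne_zero {a b : ℂ} (ha : ‖a‖ < 1) (hb : ‖b‖ < 1) :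
    1 - conj b * a ≠ 0 := by
  intro h
  have h1 : conj b * a = 1 := by linear_combination -h
  have h2 := congrArg norm h1
  rw [norm_mul, RCLike.norm_conj, norm_one] at h2
  nlinarith [norm_nonneg a, norm_nonneg b]

theorem norm_sub_lt_norm_one_sub_conj_mul {a b : ℂ} (ha : ‖a‖ < 1) (hb : ‖b‖ < 1) :
    ‖a - b‖ < ‖1 - conj b * a‖ := by
  refine lt_of_pow_lt_pow_left₀ 2 (norm_nonneg _) ?_
  have := sq_norm_one_sub_conj_mul a b
  have h1 : 0 < 1 - ‖a‖ ^ 2 := by nlinarith [norm_nonneg a]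
  have h2 : 0 < 1 - ‖b‖ ^ 2 := by nlinarith [norm_nonneg b]
  have : 0 < (1 - ‖a‖ ^ 2) * (1 - ‖b‖ ^ 2) := by positivity
  linarith

/-- The Schwarz lemma for maps from a disk into the right half-plane. -/
theorem schwarz_ball_halfPlane {g : ℂ → ℂ} {c : ℂ} {R : ℝ}
    (hg : DifferentiableOn ℂ g (ball c R)) (hmaps : ∀ z ∈ ball c R, 0 < (g z).re) {z : ℂ}
    (hz : z ∈ ball c R) :
    ‖g z - g c‖ * R ≤ ‖g z + conj (g c)‖ * ‖z - c‖ := by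
  have hR : 0 < R := nonempty_ball.1 ⟨z, hz⟩
  have hc : 0 < (g c).re := hmaps c (mem_ball_self hR)
  set h : ℂ → ℂ := fun w => (g w - g c) / (g w + conj (g c))
  have hd : DifferentiableOn ℂ h (ball c R) := (hg.sub_const _).div (hg.add_const _)
    fun w hw => add_conj_ne_zero (hmaps w hw) hc
  have hhc : h c = 0 := by simp [h]
  have hm : MapsTo h (ball c R) (closedBall (h c) 1) := by
    intro w hw
    rw [hhc, mem_closedBall_zero_iff, norm_div]
    exact div_le_one_of_le₀ (norm_sub_lt_norm_add_conj (hmaps w hw) hc).le (norm_nonneg _)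
  have := dist_le_div_mul_dist_of_mapsTo_ball hd hm hz
  rw [hhc, dist_zero_right, dist_eq_norm, norm_div, div_le_iff₀
    (norm_pos_iff.2 (add_conj_ne_zero (hmaps z hz) hc))] at this
  calc ‖g z - g c‖ * R ≤ (1 / R * ‖z - c‖ * ‖g z + conj (g c)‖) * R := by gcongr
    _ = _ := by field_simp

/-- The Schwarz-Pick lemma in the unit disk. -/
theorem schwarzPick_disk {φ : ℂ → ℂ} (hφ : DifferentiableOn ℂ φ (ball 0 1))
    (hmaps : MapsTo φ (ball 0 1) (ball 0 1)) {z w : ℂ} (hz : z ∈ ball (0 : ℂ) 1)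
    (hw : w ∈ ball (0 : ℂ) 1) :
    (1 - ‖z‖ ^ 2) * (1 - ‖w‖ ^ 2) * ‖1 - conj (φ w) * φ z‖ ^ 2 ≤
      (1 - ‖φ z‖ ^ 2) * (1 - ‖φ w‖ ^ 2) * ‖1 - conj w * z‖ ^ 2 := by
  have hz' : ‖z‖ < 1 := by simpa using hz
  have hw' : ‖w‖ < 1 := by simpa using hw
  have hm' : ∀ ζ : ℂ, ‖ζ‖ < 1 → ‖φ ζ‖ < 1 := fun ζ hζ => by simpa using hmaps (by simpa using hζ)
  have hcw : ‖-w‖ < 1 := by rwa [norm_neg]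
  -- the automorphism of the disk carrying `0` to `w`, and its inverse evaluated at `z`
  set τ : ℂ → ℂ := fun ζ => (ζ + w) / (1 + conj w * ζ)
  have hden : ∀ ζ : ℂ, ‖ζ‖ < 1 → 1 + conj w * ζ ≠ 0 := fun ζ hζ => by
    simpa using one_sub_conj_mul_ne_zero hζ hcw
  have hτ : ∀ ζ : ℂ, ‖ζ‖ < 1 → ‖τ ζ‖ < 1 := fun ζ hζ => by
    rw [norm_div, div_lt_one (norm_pos_iff.2 (hden ζ hζ))]
    simpa using norm_sub_lt_norm_one_sub_conj_mul hζ hcw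
  set ζ₀ : ℂ := (z - w) / (1 - conj w * z)
  have hζ₀ : ‖ζ₀‖ < 1 := by
    rw [norm_div, div_lt_one (norm_pos_iff.2 (one_sub_conj_mul_ne_zero hz' hw'))]
    exact norm_sub_lt_norm_one_sub_conj_mul hz' hw'
  have hτζ₀ : τ ζ₀ = z := by
    have h1 := one_sub_conj_mul_ne_zero hz' hw'
    have h1' : 1 - z * conj w ≠ 0 := by rwa [mul_comm]
    have h2 := one_sub_conj_mul_ne_zero hw' hw'
    have h2' : 1 - w * conj w ≠ 0 := by rwa [mul_comm]
    have h3 : 1 + conj w * ζ₀ = (1 - conj w * w) / (1 - conj w * z) := by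
      simp only [ζ₀]; field_simp; ring
    have h4 : ζ₀ + w = z * (1 - conj w * w) / (1 - conj w * z) := by
      simp only [ζ₀]; field_simp; ring
    simp only [τ]
    rw [h3, h4]
    field_simp
  set h : ℂ → ℂ := fun ζ => (φ (τ ζ) - φ w) / (1 - conj (φ w) * φ (τ ζ))
  have hτd : DifferentiableOn ℂ τ (ball 0 1) := by
    refine DifferentiableOn.div (by fun_prop) (by fun_prop) fun ζ hζ => hden ζ (by simpa using hζ)
  have hφτ : DifferentiableOn ℂ (fun ζ => φ (τ ζ)) (ball 0 1) :=
    hφ.comp hτd fun ζ hζ => by simpa using hτ ζ (by simpa using hζ)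
  have hhd : DifferentiableOn ℂ h (ball 0 1) := by
    refine (hφτ.sub_const _).div ((hφτ.const_mul _).const_sub _) fun ζ hζ => ?_
    exact one_sub_conj_mul_ne_zero (hm' _ (hτ ζ (by simpa using hζ))) (hm' w hw')
  have hmh : MapsTo h (ball 0 1) (closedBall 0 1) := by
    intro ζ hζ
    have h1 := hm' _ (hτ ζ (by simpa using hζ))
    rw [mem_closedBall_zero_iff, norm_div]
    exact div_le_one_of_le₀ (norm_sub_lt_norm_one_sub_conj_mul h1 (hm' w hw')).le (norm_nonneg _)
  have h0 : h 0 = 0 := by simp [h, τ]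
  have key := norm_le_norm_of_mapsTo_ball hhd hmh h0 hζ₀
  have hp1 : 0 < ‖1 - conj (φ w) * φ z‖ :=
    norm_pos_iff.2 (one_sub_conj_mul_ne_zero (hm' z hz') (hm' w hw'))
  have hp2 : 0 < ‖1 - conj w * z‖ := norm_pos_iff.2 (one_sub_conj_mul_ne_zero hz' hw')
  simp only [h] at key
  rw [hτζ₀, norm_div, norm_div, div_le_div_iff₀ hp1 hp2] at key
  have key2 := pow_le_pow_left₀ (by positivity) key 2
  rw [mul_pow, mul_pow] at key2
  have e1 := sq_norm_one_sub_conj_mul (φ z) (φ w)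
  have e2 := sq_norm_one_sub_conj_mul z w
  rw [← e1, ← e2]
  nlinarith

/-- The Schwarz-Pick lemma in the right half-plane. -/
theorem schwarzPick_halfPlane {p : ℂ → ℂ} (hp : DifferentiableOn ℂ p {u | 0 < u.re})
    (hmaps : ∀ u : ℂ, 0 < u.re → 0 < (p u).re) {u v : ℂ} (hu : 0 < u.re) (hv : 0 < v.re) :
    ‖p u - p v‖ * ‖u + conj v‖ ≤ ‖p u + conj (p v)‖ * ‖u - v‖ := by
  -- the Cayley map from the disk onto the half-plane that carries `0` to `v`
  set τ : ℂ → ℂ := fun ζ => (v + conj v * ζ) / (1 - ζ)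
  have hne : ∀ ζ : ℂ, ‖ζ‖ < 1 → 1 - ζ ≠ 0 := fun ζ hζ h => by
    have : ζ = 1 := by linear_combination -h
    simp [this] at hζ
  have hτ : ∀ ζ : ℂ, ‖ζ‖ < 1 → 0 < (τ ζ).re := by
    intro ζ hζ
    have hns : 0 < normSq (1 - ζ) := normSq_pos.2 (hne ζ hζ)
    have h1 : (τ ζ).re = v.re * (1 - ‖ζ‖ ^ 2) / normSq (1 - ζ) := by
      simp only [τ, Complex.div_re, Complex.sq_norm]
      rw [← add_div]
      congr 1
      simp [normSq_apply]
      ring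
    rw [h1]
    have : 0 < 1 - ‖ζ‖ ^ 2 := by nlinarith [norm_nonneg ζ]
    positivity
  set ζ₀ : ℂ := (u - v) / (u + conj v)
  have hne0 : u + conj v ≠ 0 := add_conj_ne_zero hu hv
  have hζ₀ : ‖ζ₀‖ < 1 := by
    rw [norm_div, div_lt_one (norm_pos_iff.2 hne0)]
    exact norm_sub_lt_norm_add_conj hu hv
  have hτζ₀ : τ ζ₀ = u := by
    have h2 : v + conj v ≠ 0 := add_conj_ne_zero hv hv
    have h3 : 1 - ζ₀ = (v + conj v) / (u + conj v) := by
      simp only [ζ₀]; field_simp; ring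
    have h4 : v + conj v * ζ₀ = u * (v + conj v) / (u + conj v) := by
      simp only [ζ₀]; field_simp; ring
    simp only [τ]
    rw [h3, h4]
    field_simp
  have hτd : DifferentiableOn ℂ τ (ball 0 1) := by
    refine DifferentiableOn.div (by fun_prop) (by fun_prop) fun ζ hζ => hne ζ (by simpa using hζ)
  have hd : DifferentiableOn ℂ (fun ζ => p (τ ζ)) (ball 0 1) :=
    hp.comp hτd fun ζ hζ => hτ ζ (by simpa using hζ)
  have key := schwarz_ball_halfPlane hd (fun ζ hζ => hmaps _ (hτ ζ (by simpa using hζ)))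
    (z := ζ₀) (by simpa using hζ₀)
  have hτ0 : τ 0 = v := by simp [τ]
  simp only [hτζ₀, hτ0, mul_one, sub_zero] at key
  calc ‖p u - p v‖ * ‖u + conj v‖ ≤ ‖p u + conj (p v)‖ * ‖ζ₀‖ * ‖u + conj v‖ := by gcongr
    _ = _ := by
      rw [mul_assoc, ← norm_mul, div_mul_cancel₀ _ hne0]

/-- The infinitesimal Schwarz-Pick lemma in the right half-plane. -/
theorem norm_deriv_mul_re_le {p : ℂ → ℂ} (hp : DifferentiableOn ℂ p {u | 0 < u.re})
    (hmaps : ∀ u : ℂ, 0 < u.re → 0 < (p u).re) {v : ℂ} (hv : 0 < v.re) :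
    ‖deriv p v‖ * v.re ≤ (p v).re := by
  have hopen : IsOpen {u : ℂ | 0 < u.re} := isOpen_lt continuous_const continuous_re
  have hdv : DifferentiableAt ℂ p v := hp.differentiableAt (hopen.mem_nhds hv)
  have h1 : Tendsto (fun u => ‖slope p v u‖ * ‖u + conj v‖) (𝓝[≠] v)
      (𝓝 (‖deriv p v‖ * ‖v + conj v‖)) := by
    refine (hasDerivAt_iff_tendsto_slope.1 hdv.hasDerivAt).norm.mul ?_
    exact tendsto_nhdsWithin_of_tendsto_nhds (by
      have : Continuous fun u : ℂ => ‖u + conj v‖ := by fun_prop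
      exact this.tendsto v)
  have h2 : Tendsto (fun u => ‖p u + conj (p v)‖) (𝓝[≠] v) (𝓝 ‖p v + conj (p v)‖) :=
    tendsto_nhdsWithin_of_tendsto_nhds ((hdv.continuousAt.add continuousAt_const).norm)
  have h3 := le_of_tendsto_of_tendsto h1 h2 (by
    filter_upwards [self_mem_nhdsWithin, mem_nhdsWithin_of_mem_nhds (hopen.mem_nhds hv)]
      with u hu hu'
    have hne : 0 < ‖u - v‖ := norm_pos_iff.2 (sub_ne_zero.2 hu)
    have := schwarzPick_halfPlane hp hmaps hu' hv
    rw [slope_def_field, norm_div, div_mul_eq_mul_div, div_le_iff₀ hne]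
    exact this)
  rw [add_conj, add_conj, norm_real, norm_real, Real.norm_of_nonneg (by positivity),
    Real.norm_of_nonneg (by have := hmaps v hv; positivity)] at h3
  linarith

/-! ### Holomorphic inverses and Wolff's lemma -/

/-- An injective holomorphic function on the disk has open image and a holomorphic inverse. The
inverse is continuous by the open mapping theorem, holomorphic off the discrete set of critical
values, and so holomorphic; in particular there are no critical points. -/
theorem exists_holomorphic_inverse {f : ℂ → ℂ} (hf : DifferentiableOn ℂ f (ball 0 1))
    (hinj : InjOn f (ball 0 1)) :
    IsOpen (f '' ball 0 1) ∧ (∀ z ∈ ball (0 : ℂ) 1, deriv f z ≠ 0) ∧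
      ∃ g : ℂ → ℂ, DifferentiableOn ℂ g (f '' ball 0 1) ∧ ∀ z ∈ ball (0 : ℂ) 1, g (f z) = z := by
  set U : Set ℂ := ball 0 1 with hUdef
  have hU : IsOpen U := isOpen_ball
  have hUc : IsPreconnected U := (convex_ball _ _).isPreconnected
  have hfa : AnalyticOnNhd ℂ f U := hf.analyticOnNhd hU
  have hopen : ∀ s ⊆ U, IsOpen s → IsOpen (f '' s) := by
    rcases hfa.is_constant_or_isOpen hUc with ⟨w, hw⟩ | h
    · exfalso
      have h0 : (0 : ℂ) ∈ U := by simp [hUdef]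
      have h1 : (1 / 2 : ℂ) ∈ U := by simp [hUdef]; norm_num
      have := hinj h0 h1 ((hw 0 h0).trans (hw _ h1).symm)
      norm_num at this
    · exact h
  have hΩ : IsOpen (f '' U) := hopen U subset_rfl hU
  set g := Function.invFunOn f U
  have hgf : ∀ z ∈ U, g (f z) = z := fun z hz => hinj.leftInvOn_invFunOn hz
  have hfg : ∀ w ∈ f '' U, f (g w) = w := fun w hw => Function.invFunOn_eq hw
  have hgU : ∀ w ∈ f '' U, g w ∈ U := fun w hw => Function.invFunOn_mem hw
  have hgc : ∀ w ∈ f '' U, ContinuousAt g w := by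
    rintro _ ⟨z, hz, rfl⟩
    rw [ContinuousAt, hgf z hz]
    intro V hV
    obtain ⟨V', hV'V, hV'o, hzV'⟩ := _root_.mem_nhds_iff.1 hV
    have : f '' (V' ∩ U) ∈ 𝓝 (f z) :=
      (hopen _ inter_subset_right (hV'o.inter hU)).mem_nhds ⟨z, ⟨hzV', hz⟩, rfl⟩
    refine mem_map.2 (mem_of_superset this ?_)
    rintro _ ⟨y, ⟨hyV, hyU⟩, rfl⟩
    change g (f y) ∈ V
    rw [hgf y hyU]
    exact hV'V hyV
  have hcrit : ∀ z ∈ U, ∀ᶠ y in 𝓝[≠] z, deriv f y ≠ 0 := by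
    intro z hz
    refine ((hfa z hz).deriv.eventually_eq_zero_or_eventually_ne_zero).resolve_left fun h => ?_
    obtain ⟨r, hr, hrU⟩ := Metric.mem_nhds_iff.1 (h.and (hU.mem_nhds hz))
    have hz' : z ∈ ball z r := mem_ball_self hr
    have hy' : z + (r / 2 : ℝ) ∈ ball z r := by
      rw [mem_ball, dist_eq_norm, add_sub_cancel_left, norm_real, Real.norm_of_nonneg (by linarith)]
      linarith
    have := hinj hz (hrU hy').2 (isOpen_ball.is_const_of_deriv_eq_zero
      (convex_ball z r).isPreconnected (hf.mono fun y hy => (hrU hy).2)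
      (fun y hy => (hrU hy).1) hz' hy')
    have h2 : ((r / 2 : ℝ) : ℂ) = 0 := by linear_combination -this
    rw [ofReal_eq_zero] at h2
    linarith
  have hgd : ∀ w ∈ f '' U, DifferentiableAt ℂ g w := by
    intro w hw
    refine (analyticAt_of_differentiable_on_punctured_nhds_of_continuousAt ?_
      (hgc w hw)).differentiableAt
    have htend : Tendsto g (𝓝[≠] w) (𝓝[≠] (g w)) := by
      refine tendsto_nhdsWithin_iff.2 ⟨(hgc w hw).tendsto.mono_left nhdsWithin_le_nhds, ?_⟩
      filter_upwards [self_mem_nhdsWithin, mem_nhdsWithin_of_mem_nhds (hΩ.mem_nhds hw)]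
        with y hy hyΩ
      intro h
      exact hy (by rw [mem_singleton_iff, ← hfg y hyΩ, h, hfg w hw])
    filter_upwards [htend.eventually (hcrit _ (hgU w hw)),
      mem_nhdsWithin_of_mem_nhds (hΩ.mem_nhds hw)]
        with y hy hyΩ
    refine (HasDerivAt.of_local_left_inverse (hgc y hyΩ)
      (hf.differentiableAt (hU.mem_nhds (hgU y hyΩ))).hasDerivAt hy ?_).differentiableAt
    filter_upwards [hΩ.mem_nhds hyΩ] with x hx using hfg x hx
  refine ⟨hΩ, fun z hz h0 => ?_, g, fun w hw => (hgd w hw).differentiableWithinAt, hgf⟩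
  have h1 : HasDerivAt (g ∘ f) (deriv g (f z) * deriv f z) z :=
    (hgd _ ⟨z, hz, rfl⟩).hasDerivAt.comp z (hf.differentiableAt (hU.mem_nhds hz)).hasDerivAt
  have h2 : HasDerivAt (g ∘ f) 1 z := by
    refine (hasDerivAt_id z).congr_of_eventuallyEq ?_
    filter_upwards [hU.mem_nhds hz] with y hy using hgf y hy
  have := h1.unique h2
  rw [h0, mul_zero] at this
  exact zero_ne_one this

/-- A contraction multiple of a holomorphic self-map of the disk has a fixed point. -/
theorem exists_fixedPoint_of_mul {φ : ℂ → ℂ} (hφ : DifferentiableOn ℂ φ (ball 0 1))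
    (hmaps : MapsTo φ (ball 0 1) (ball 0 1)) {ρ : ℝ} (h0 : 0 < ρ) (h1 : ρ < 1) :
    ∃ z ∈ ball (0 : ℂ) 1, (ρ : ℂ) * φ z = z := by
  by_contra! hne
  -- without a fixed point `z / (z - ρ φ z)` is holomorphic; near the circle its real part
  -- exceeds `1 / 2`, yet it vanishes at the origin
  have hsub : ∀ z ∈ ball (0 : ℂ) 1, z - ρ * φ z ≠ 0 := fun z hz h =>
    hne z hz (by linear_combination -h)
  have key := re_nonneg_of_forall_exists_isCompact (U := ball 0 1) isOpen_ball
    (φ := fun z => z / (z - ρ * φ z) - 1 / 2)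
    ((differentiableOn_id.div (differentiableOn_id.sub (hφ.const_mul _)) hsub).sub_const _)
    (fun ε hε => ⟨closedBall 0 ρ, closedBall_subset_ball h1, isCompact_closedBall 0 ρ, by
      rintro z ⟨hz, hzρ⟩
      have hφz : ‖φ z‖ < 1 := by simpa using hmaps hz
      have hzρ' : ρ < ‖z‖ := by simpa using hzρ
      have hlt : ‖(ρ : ℂ) * φ z‖ < ‖z‖ := by
        rw [norm_mul, norm_real, Real.norm_of_nonneg h0.le]
        nlinarith [norm_nonneg (φ z)]
      have hpos : 0 < normSq (z - ρ * φ z) := normSq_pos.2 (hsub z hz)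
      refine (neg_nonpos.2 hε.le).trans ?_
      set w := (ρ : ℂ) * φ z
      have hsq : normSq w < normSq z := by
        rw [normSq_eq_norm_sq, normSq_eq_norm_sq]
        gcongr
      have : (z / (z - w) - 1 / 2).re = (normSq z - normSq w) / (2 * normSq (z - w)) := by
        have h2 : z / (z - w) - 1 / 2 = (z + w) / (z - w) / 2 := by
          have : z - w ≠ 0 := hsub z hz
          field_simp
          ring
        rw [h2, show (2 : ℂ) = ((2 : ℝ) : ℂ) by norm_num, div_ofReal_re, Complex.div_re,
          ← add_div, div_div, mul_comm (normSq (z - w))]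
        congr 1
        simp only [normSq_apply, add_re, add_im, sub_re, sub_im]
        ring
      rw [this]
      have : 0 < normSq z - normSq w := by linarith
      positivity⟩) 0 (by simp)
  norm_num at key

/-- The Wolff lemma: for a holomorphic self-map of the disk without fixed points there is a
boundary point all of whose horodisks are mapped into themselves. -/
theorem exists_wolff_point {φ : ℂ → ℂ} (hφ : DifferentiableOn ℂ φ (ball 0 1))
    (hmaps : MapsTo φ (ball 0 1) (ball 0 1)) (hfix : ∀ z ∈ ball (0 : ℂ) 1, φ z ≠ z) :
    ∃ σ : ℂ, ‖σ‖ = 1 ∧ ∀ z ∈ ball (0 : ℂ) 1,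
      (1 - ‖z‖ ^ 2) * ‖1 - conj σ * φ z‖ ^ 2 ≤ (1 - ‖φ z‖ ^ 2) * ‖1 - conj σ * z‖ ^ 2 := by
  set ρ : ℕ → ℝ := fun n => 1 - 1 / ((n : ℝ) + 2)
  have hρ0 : ∀ n, 0 < ρ n := fun n => by
    simp only [ρ]
    rw [sub_pos, div_lt_one (by positivity)]
    linarith [Nat.cast_nonneg (α := ℝ) n]
  have hρ1 : ∀ n, ρ n < 1 := fun n =>
    sub_lt_self 1 (by positivity)
  have hρlim : Tendsto ρ atTop (𝓝 1) := by
    have h1 : Tendsto (fun n : ℕ => 1 / ((n : ℝ) + 2)) atTop (𝓝 0) := by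
      have := tendsto_one_div_add_atTop_nhds_zero_nat (𝕜 := ℝ)
      have h2 := (tendsto_add_atTop_iff_nat 1).2 this
      refine h2.congr fun n => ?_
      push_cast
      ring
    simpa only [sub_zero] using h1.const_sub 1
  choose ζ hζ hζfix using fun n => exists_fixedPoint_of_mul hφ hmaps (hρ0 n) (hρ1 n)
  obtain ⟨σ, hσ, κ, hκ, hlim⟩ := (isCompact_closedBall (0 : ℂ) 1).tendsto_subseq
    (fun n => ball_subset_closedBall (hζ n))
  have hρκ : Tendsto (fun n => (ρ (κ n) : ℂ)) atTop (𝓝 1) := by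
    exact_mod_cast (continuous_ofReal.tendsto 1).comp (hρlim.comp hκ.tendsto_atTop)
  have hσ1 : ‖σ‖ = 1 := by
    refine le_antisymm (by simpa using hσ) ?_
    by_contra! hlt
    have hσb : σ ∈ ball (0 : ℂ) 1 := by simpa using hlt
    have hc : ContinuousAt φ σ := hφ.continuousOn.continuousAt (isOpen_ball.mem_nhds hσb)
    have h1 : Tendsto (fun n => (ρ (κ n) : ℂ) * φ (ζ (κ n))) atTop (𝓝 (1 * φ σ)) :=
      hρκ.mul (hc.tendsto.comp hlim)
    have h2 := tendsto_nhds_unique h1 (hlim.congr fun n => (hζfix (κ n)).symm)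
    exact hfix σ hσb (by simpa using h2)
  refine ⟨σ, hσ1, fun z hz => ?_⟩
  -- Schwarz-Pick for `ρ φ` at its fixed point, before the limit `ρ → 1`
  have hn : ∀ n, (1 - ‖z‖ ^ 2) * ‖1 - conj (ζ n) * (ρ n * φ z)‖ ^ 2 ≤
      (1 - ‖(ρ n : ℂ) * φ z‖ ^ 2) * ‖1 - conj (ζ n) * z‖ ^ 2 := by
    intro n
    have hm : MapsTo (fun z => (ρ n : ℂ) * φ z) (ball 0 1) (ball 0 1) := by
      intro y hy
      have hφy : ‖φ y‖ < 1 := by simpa using hmaps hy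
      rw [mem_ball_zero_iff, norm_mul, norm_real, Real.norm_of_nonneg (hρ0 n).le]
      nlinarith [norm_nonneg (φ y), hρ0 n, hρ1 n]
    have h := schwarzPick_disk (hφ.const_mul (ρ n : ℂ)) hm hz (hζ n)
    simp only [hζfix n] at h
    have hpos : 0 < 1 - ‖ζ n‖ ^ 2 := by
      have : ‖ζ n‖ < 1 := by simpa using hζ n
      nlinarith [norm_nonneg (ζ n)]
    refine le_of_mul_le_mul_right ?_ hpos
    linarith
  have hconj : Tendsto (fun n => conj (ζ (κ n))) atTop (𝓝 (conj σ)) :=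
    (continuous_conj.tendsto σ).comp hlim
  have hL : Tendsto (fun n => (1 - ‖z‖ ^ 2) * ‖1 - conj (ζ (κ n)) * (ρ (κ n) * φ z)‖ ^ 2) atTop
      (𝓝 ((1 - ‖z‖ ^ 2) * ‖1 - conj σ * (1 * φ z)‖ ^ 2)) :=
    ((((hconj.mul (hρκ.mul_const _)).const_sub 1).norm).pow 2).const_mul _
  have hR : Tendsto (fun n => (1 - ‖(ρ (κ n) : ℂ) * φ z‖ ^ 2) * ‖1 - conj (ζ (κ n)) * z‖ ^ 2) atTop
      (𝓝 ((1 - ‖1 * φ z‖ ^ 2) * ‖1 - conj σ * z‖ ^ 2)) :=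
    (((hρκ.mul_const _).norm.pow 2).const_sub 1).mul
      (((hconj.mul_const _).const_sub 1).norm.pow 2)
  simpa using le_of_tendsto_of_tendsto' hL hR fun n => hn (κ n)

/-! ### Concave functions and the differential inequality -/

/-- `d` is a direction of recession of `K`: `K` contains, with each of its points, the ray from
that point in the direction `d`. -/
def IsRecession (K : Set ℂ) (d : ℂ) : Prop := ∀ k ∈ K, ∀ t : ℝ, 0 ≤ t → k + t * d ∈ K

/-- A closed convex set recedes in each direction in which it contains points tending to `∞`. -/
theorem isRecession_of_tendsto {K : Set ℂ} (hKc : IsClosed K) (hK : Convex ℝ K) {ι : Type*}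
    {l : Filter ι} [l.NeBot] {w : ι → ℂ} {d : ℂ} (hw : ∀ᶠ i in l, w i ∈ K)
    (hinf : Tendsto (fun i => ‖w i‖) l atTop) (hd : Tendsto (fun i => w i / ‖w i‖) l (𝓝 d)) :
    IsRecession K d := by
  intro k hk t ht
  have hinv : Tendsto (fun i => t / ‖w i‖) l (𝓝 0) := hinf.const_div_atTop t
  have hlim : Tendsto (fun i => k + (t * (w i / ‖w i‖) - ((t / ‖w i‖ : ℝ) : ℂ) * k)) l
      (𝓝 (k + (t * d - ((0 : ℝ) : ℂ) * k))) :=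
    ((hd.const_mul _).sub (((continuous_ofReal.tendsto 0).comp hinv).mul_const k)).const_add k
  simp only [ofReal_zero, zero_mul, sub_zero] at hlim
  refine hKc.mem_of_tendsto hlim ?_
  filter_upwards [hw, hinf.eventually_ge_atTop t, hinf.eventually_gt_atTop 0] with i hi hti hpos
  have h1 : t / ‖w i‖ ≤ 1 := by rwa [div_le_one hpos]
  have := hK.add_smul_sub_mem hk hi ⟨div_nonneg ht hpos.le, h1⟩
  convert this using 2
  rw [real_smul]
  push_cast
  ring

theorem exists_isRecession {K : Set ℂ} (hKc : IsClosed K) (hK : Convex ℝ K)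
    (hb : ¬ Bornology.IsBounded K) : ∃ d : ℂ, ‖d‖ = 1 ∧ IsRecession K d := by
  have h : ∀ n : ℕ, ∃ w ∈ K, (n : ℝ) + 1 ≤ ‖w‖ := by
    intro n
    by_contra! h
    exact hb (isBounded_iff_forall_norm_le.2 ⟨n + 1, fun w hw => (h w hw).le⟩)
  choose w hwK hwn using h
  have hnorm : ∀ n, ‖w n / ‖w n‖‖ = 1 := fun n => by
    have : (0 : ℝ) < ‖w n‖ := lt_of_lt_of_le (by positivity) (hwn n)
    rw [norm_div, norm_real, norm_norm, div_self this.ne']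
  obtain ⟨d, hd, κ, hκ, hlim⟩ := (isCompact_sphere (0 : ℂ) 1).tendsto_subseq
    (x := fun n => w n / ‖w n‖) (fun n => by simpa using hnorm n)
  refine ⟨d, by simpa using hd, isRecession_of_tendsto (l := atTop) hKc hK (w := fun n => w (κ n))
    (Eventually.of_forall fun n => hwK _) ?_ hlim⟩
  refine tendsto_atTop_mono (fun n => ?_) (tendsto_natCast_atTop_atTop (R := ℝ))
  have h1 := hwn (κ n)
  have h2 : (n : ℝ) ≤ κ n := by exact_mod_cast hκ.id_le n
  linarith

namespace IsCO

variable {α : ℝ} {f : ℂ → ℂ}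

theorem isClosed_compl (hf : IsCO α f) : IsClosed (f '' ball 0 1)ᶜ :=
  (exists_holomorphic_inverse hf.analytic hf.univalent).1.isClosed_compl

theorem deriv_ne_zero (hf : IsCO α f) {z : ℂ} (hz : z ∈ ball (0 : ℂ) 1) : deriv f z ≠ 0 :=
  (exists_holomorphic_inverse hf.analytic hf.univalent).2.1 z hz

theorem hasDerivAt (hf : IsCO α f) {z : ℂ} (hz : z ∈ ball (0 : ℂ) 1) :
    HasDerivAt f (deriv f z) z :=
  (hf.analytic.differentiableAt (isOpen_ball.mem_nhds hz)).hasDerivAt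

theorem deriv_analytic (hf : IsCO α f) : DifferentiableOn ℂ (deriv f) (ball 0 1) :=
  hf.analytic.deriv isOpen_ball

/-- The omitted set of a concave function is nonempty, by Liouville's theorem for the inverse. -/
theorem compl_nonempty (hf : IsCO α f) : ((f '' ball 0 1)ᶜ).Nonempty := by
  by_contra hne
  rw [not_nonempty_iff_eq_empty, compl_empty_iff] at hne
  obtain ⟨-, -, g, hg, hgf⟩ := exists_holomorphic_inverse hf.analytic hf.univalent
  rw [hne] at hg
  have hb : Bornology.IsBounded (range g) := by
    refine (isBounded_ball (x := (0 : ℂ)) (r := 1)).subset ?_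
    rintro _ ⟨w, rfl⟩
    obtain ⟨z, hz, rfl⟩ : w ∈ f '' ball 0 1 := hne ▸ mem_univ w
    rwa [hgf z hz]
  have h := (differentiableOn_univ.1 hg).apply_eq_apply_of_bounded hb (f 0) (f (1 / 2))
  rw [hgf 0 (by simp), hgf _ (by simp; norm_num)] at h
  norm_num at h

/-- The omitted set of a concave function is unbounded: otherwise `1 / (w - k)`, for an omitted
value `k`, would have a primitive on a circle around `k`. -/
theorem not_isBounded_compl (hf : IsCO α f) : ¬ Bornology.IsBounded (f '' ball 0 1)ᶜ := by
  intro hb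
  obtain ⟨k, hk⟩ := hf.compl_nonempty
  obtain ⟨hΩ, hf', g, hg, hgf⟩ := exists_holomorphic_inverse hf.analytic hf.univalent
  have hfk : ∀ z ∈ ball (0 : ℂ) 1, f z - k ≠ 0 := fun z hz h => hk ⟨z, hz, sub_eq_zero.1 h⟩
  obtain ⟨L, hL⟩ := (hf.deriv_analytic.div (hf.analytic.sub_const k) hfk).isExactOn_ball
  obtain ⟨R, hR⟩ := hb.subset_ball k
  have hR0 : 0 < R := nonempty_ball.1 ⟨k, hR hk⟩
  have h0 : (∮ w in C(k, R), (w - k)⁻¹) = 0 := by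
    refine circleIntegral.integral_eq_zero_of_hasDerivWithinAt (f := fun w => L (g w)) hR0.le
      fun w hw => ?_
    have hwΩ : w ∈ f '' ball 0 1 := by
      by_contra hwΩ
      have h1 := hR hwΩ
      rw [mem_ball] at h1
      rw [mem_sphere] at hw
      linarith
    obtain ⟨z, hz, rfl⟩ := hwΩ
    have hgd := (hg.differentiableAt (hΩ.mem_nhds ⟨z, hz, rfl⟩)).hasDerivAt
    have h1 : deriv g (f z) * deriv f z = 1 := by
      refine (hgd.comp z (hf.hasDerivAt hz)).unique
        ((hasDerivAt_id z).congr_of_eventuallyEq ?_)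
      filter_upwards [isOpen_ball.mem_nhds hz] with y hy using hgf y hy
    have h2 := HasDerivAt.comp (f z) (by rw [hgf z hz]; exact hL z hz) hgd
    refine (h2.congr_deriv ?_).hasDerivWithinAt
    have h3 := hfk z hz
    rw [Pi.div_apply]
    field_simp
    linear_combination h1
  rw [circleIntegral.integral_sub_center_inv k hR0.ne'] at h0
  exact Complex.two_pi_I_ne_zero h0

theorem exists_isRecession (hf : IsCO α f) : ∃ d : ℂ, ‖d‖ = 1 ∧ IsRecession (f '' ball 0 1)ᶜ d :=
  ConcaveUnivalent.exists_isRecession hf.isClosed_compl hf.convex_compl hf.not_isBounded_compl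

end IsCO

/-- If `a` lies in the horodisk at `σ` with `z` on its boundary, then `(σ + a) / (σ - a)` has at
least the real part of `(σ + z) / (σ - z)`; the claim is about the difference of these numbers. -/
theorem re_div_nonneg_of_horodisk {σ a z : ℂ} (hσ : ‖σ‖ = 1) (ha : ‖a‖ < 1) (hz : ‖z‖ < 1)
    (h : (1 - ‖z‖ ^ 2) * ‖1 - conj σ * a‖ ^ 2 ≤ (1 - ‖a‖ ^ 2) * ‖1 - conj σ * z‖ ^ 2) :
    0 ≤ (σ * (a - z) / ((σ - a) * (σ - z))).re := by
  have hne : ∀ b : ℂ, ‖b‖ < 1 → σ - b ≠ 0 := fun b hb h => by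
    rw [← sub_eq_zero.1 h, hσ] at hb
    exact lt_irrefl _ hb
  have hcs : σ * conj σ = 1 := by
    rw [mul_conj, normSq_eq_norm_sq, hσ]; norm_num
  have hn : ∀ b : ℂ, ‖1 - conj σ * b‖ = ‖σ - b‖ := fun b => by
    rw [← one_mul ‖1 - conj σ * b‖, ← hσ, ← norm_mul]
    congr 1
    linear_combination -b * hcs
  have hre : ∀ b : ℂ, ((σ + b) / (σ - b)).re = (1 - ‖b‖ ^ 2) / ‖σ - b‖ ^ 2 := by
    intro b
    have h1 : normSq σ = 1 := by rw [normSq_eq_norm_sq, hσ]; norm_num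
    rw [Complex.sq_norm, Complex.sq_norm, ← h1, Complex.div_re, ← add_div]
    congr 1
    simp only [normSq_apply, add_re, add_im, sub_re, sub_im]
    ring
  rw [hn, hn] at h
  have h1 : σ * (a - z) / ((σ - a) * (σ - z)) = ((σ + a) / (σ - a) - (σ + z) / (σ - z)) / 2 := by
    have := hne a ha
    have := hne z hz
    field_simp
    ring
  rw [h1, show (2 : ℂ) = ((2 : ℝ) : ℂ) by norm_num, div_ofReal_re, sub_re, hre, hre]
  have h2 : 0 < ‖σ - a‖ ^ 2 := by have := norm_pos_iff.2 (hne a ha); positivity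
  have h3 : 0 < ‖σ - z‖ ^ 2 := by have := norm_pos_iff.2 (hne z hz); positivity
  have : (1 - ‖z‖ ^ 2) / ‖σ - z‖ ^ 2 ≤ (1 - ‖a‖ ^ 2) / ‖σ - a‖ ^ 2 := by
    rwa [div_le_div_iff₀ h3 h2]
  linarith

namespace IsCO

variable {α : ℝ} {f : ℂ → ℂ}

/-- The dilations `f⁻¹(k + λ (f - k))`, `λ > 1`, about an omitted value `k` are self-maps of the
disk without fixed points. Their Wolff points accumulate, as `λ → 1`, at a point `σ` of the circle
that satisfies the inequality below. -/
theorem exists_re_nonneg (hf : IsCO α f) {k : ℂ} (hk : k ∈ (f '' ball 0 1)ᶜ) :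
    ∃ σ : ℂ, ‖σ‖ = 1 ∧ ∀ z ∈ ball (0 : ℂ) 1,
      0 ≤ (σ * ((f z - k) / deriv f z) / (σ - z) ^ 2).re := by
  obtain ⟨hΩ, hf', g, hg, hgf⟩ := exists_holomorphic_inverse hf.analytic hf.univalent
  have hfk : ∀ z ∈ ball (0 : ℂ) 1, f z - k ≠ 0 := fun z hz h => hk ⟨z, hz, sub_eq_zero.1 h⟩
  have hdil : ∀ t : ℝ, 0 ≤ t → ∀ z ∈ ball (0 : ℂ) 1, f z + t * (f z - k) ∈ f '' ball 0 1 := by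
    intro t ht z hz
    by_contra hmem
    have h1 := hf.convex_compl.add_smul_sub_mem hk hmem
      (t := 1 / (1 + t)) ⟨by positivity, by rw [div_le_one (by positivity)]; linarith⟩
    refine h1 ⟨z, hz, ?_⟩
    rw [real_smul]
    have : (1 : ℂ) + t ≠ 0 := by exact_mod_cast (by positivity : (0 : ℝ) < 1 + t).ne'
    push_cast
    field_simp
    ring
  set φ : ℝ → ℂ → ℂ := fun t z => g (f z + t * (f z - k))
  have hφmem : ∀ t : ℝ, 0 ≤ t → ∀ z ∈ ball (0 : ℂ) 1, φ t z ∈ ball (0 : ℂ) 1 ∧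
      f (φ t z) = f z + t * (f z - k) := by
    intro t ht z hz
    obtain ⟨y, hy, hyw⟩ := hdil t ht z hz
    simp only [φ]
    rw [← hyw, hgf y hy]
    exact ⟨hy, rfl⟩
  have hφd : ∀ t : ℝ, 0 ≤ t → DifferentiableOn ℂ (φ t) (ball 0 1) := fun t ht =>
    hg.comp (hf.analytic.add ((hf.analytic.sub_const k).const_mul _)) (hdil t ht)
  set τ : ℕ → ℝ := fun n => 1 / ((n : ℝ) + 1)
  have hτ : ∀ n, 0 < τ n := fun n => by simp only [τ]; positivity
  have hτlim : Tendsto τ atTop (𝓝 0) := tendsto_one_div_add_atTop_nhds_zero_nat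
  have hwolff : ∀ n, ∃ σ : ℂ, ‖σ‖ = 1 ∧ ∀ z ∈ ball (0 : ℂ) 1,
      (1 - ‖z‖ ^ 2) * ‖1 - conj σ * φ (τ n) z‖ ^ 2 ≤
        (1 - ‖φ (τ n) z‖ ^ 2) * ‖1 - conj σ * z‖ ^ 2 := by
    intro n
    refine exists_wolff_point (hφd _ (hτ n).le) (fun z hz => (hφmem _ (hτ n).le z hz).1) ?_
    intro z hz h
    have h1 := (hφmem _ (hτ n).le z hz).2
    rw [h] at h1
    have h2 : (τ n : ℂ) * (f z - k) = 0 := by linear_combination -h1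
    rcases mul_eq_zero.1 h2 with h3 | h3
    · exact (hτ n).ne' (by exact_mod_cast h3)
    · exact hfk z hz h3
  choose s hs1 hs using hwolff
  obtain ⟨σ, hσ, κ, hκ, hlim⟩ := (isCompact_sphere (0 : ℂ) 1).tendsto_subseq
    (x := s) (fun n => by simpa using hs1 n)
  have hσ1 : ‖σ‖ = 1 := by simpa using hσ
  refine ⟨σ, hσ1, fun z hz => ?_⟩
  have hz' : ‖z‖ < 1 := by simpa using hz
  have hgd := (hg.differentiableAt (hΩ.mem_nhds ⟨z, hz, rfl⟩)).hasDerivAt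
  have hg1 : deriv g (f z) * deriv f z = 1 := by
    refine (hgd.comp z (hf.hasDerivAt hz)).unique
      ((hasDerivAt_id z).congr_of_eventuallyEq ?_)
    filter_upwards [isOpen_ball.mem_nhds hz] with y hy using hgf y hy
  have hφ0 : φ 0 z = z := by simp [φ, hgf z hz]
  have hder : HasDerivAt (fun t : ℝ => φ t z) ((f z - k) / deriv f z) 0 := by
    have h1 : HasDerivAt (fun t : ℂ => f z + t * (f z - k)) (f z - k) 0 := by
      simpa using ((hasDerivAt_id (0 : ℂ)).mul_const (f z - k)).const_add (f z)
    have h0 : f z + 0 * (f z - k) = f z := by ring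
    have h2 := (HasDerivAt.comp (0 : ℂ) (h₂ := g) (h0.symm ▸ hgd) h1).comp_ofReal (z := 0)
    refine h2.congr_deriv ?_
    rw [eq_div_iff (hf' z hz), h0]
    linear_combination (f z - k) * hg1
  have hquot : Tendsto (fun n => ((τ (κ n))⁻¹ : ℝ) • (φ (τ (κ n)) z - z)) atTop
      (𝓝 ((f z - k) / deriv f z)) := by
    have h1 := hasDerivAt_iff_tendsto_slope_zero.1 hder
    have h2 : Tendsto (fun n => τ (κ n)) atTop (𝓝[≠] 0) :=
      tendsto_nhdsWithin_iff.2 ⟨hτlim.comp hκ.tendsto_atTop,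
        Eventually.of_forall fun n => (hτ _).ne'⟩
    have h3 := h1.comp h2
    simpa [Function.comp_def, hφ0] using h3
  have hφlim : Tendsto (fun n => φ (τ (κ n)) z) atTop (𝓝 z) := by
    have h1 := hder.continuousAt.tendsto
    rw [hφ0] at h1
    exact h1.comp (hτlim.comp hκ.tendsto_atTop)
  have hne : σ - z ≠ 0 := fun h => by
    rw [← sub_eq_zero.1 h, hσ1] at hz'
    exact lt_irrefl _ hz'
  have hL : Tendsto (fun n => s (κ n) * (((τ (κ n))⁻¹ : ℝ) • (φ (τ (κ n)) z - z)) /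
      ((s (κ n) - φ (τ (κ n)) z) * (s (κ n) - z))) atTop
      (𝓝 (σ * ((f z - k) / deriv f z) / ((σ - z) * (σ - z)))) :=
    (hlim.mul hquot).div ((hlim.sub hφlim).mul (hlim.sub_const z)) (mul_ne_zero hne hne)
  rw [sq]
  refine ge_of_tendsto' ((continuous_re.tendsto _).comp hL) fun n => ?_
  have h1 := re_div_nonneg_of_horodisk (hs1 (κ n))
    (by simpa using (hφmem _ (hτ (κ n)).le z hz).1) hz' (hs (κ n) z hz)
  have h2 : s (κ n) * (((τ (κ n))⁻¹ : ℝ) • (φ (τ (κ n)) z - z)) /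
      ((s (κ n) - φ (τ (κ n)) z) * (s (κ n) - z)) = ((τ (κ n))⁻¹ : ℝ) * (s (κ n) *
        (φ (τ (κ n)) z - z) / ((s (κ n) - φ (τ (κ n)) z) * (s (κ n) - z))) := by
    rw [real_smul]; ring
  simp only [Function.comp]
  rw [h2, re_ofReal_mul]
  exact mul_nonneg (inv_nonneg.2 (hτ _).le) h1

/-- The basic differential inequality for concave functions that are infinite at `1`. The point `σ`
of `exists_re_nonneg` is `1`: by the inequality `|f - k|` increases along the curves
`(σ + z) / (σ - z) = x + iy`, `x > 0`, and if `σ ≠ 1` one of these ends, for `x → 0`, at the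
point `1`, where `f` tends to infinity. -/
theorem re_div_nonneg (hf : IsCO α f) {k : ℂ} (hk : k ∈ (f '' ball 0 1)ᶜ) {z : ℂ}
    (hz : z ∈ ball (0 : ℂ) 1) : 0 ≤ ((f z - k) / ((1 - z) ^ 2 * deriv f z)).re := by
  obtain ⟨σ, hσ1, hσ⟩ := hf.exists_re_nonneg hk
  by_cases h1 : σ = 1
  · have := hσ z hz
    rw [h1, one_mul, div_div, mul_comm (deriv f z)] at this
    exact this
  exfalso
  have hσ0 : σ ≠ 0 := fun h => by simp [h] at hσ1
  have hσs : normSq σ = 1 := by rw [normSq_eq_norm_sq, hσ1]; norm_num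
  have hσ1' : σ - 1 ≠ 0 := sub_ne_zero.2 h1
  set c : ℂ := (σ + 1) / (σ - 1)
  have hc : c.re = 0 := by
    have h2 : (σ + 1).re * (σ - 1).re + (σ + 1).im * (σ - 1).im = 0 := by
      rw [normSq_apply] at hσs
      simp only [add_re, add_im, sub_re, sub_im, one_re, one_im]
      linear_combination hσs
    simp only [c]
    rw [Complex.div_re, ← add_div, h2, zero_div]
  -- the inverse of the map `z ↦ (σ + z) / (σ - z)`
  set ζ : ℂ → ℂ := fun U => σ * (U - 1) / (U + 1)
  have hne : ∀ U : ℂ, 0 ≤ U.re → U + 1 ≠ 0 := fun U hU h => by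
    have := congrArg re h
    simp at this
    linarith
  have hζmem : ∀ U : ℂ, 0 < U.re → ζ U ∈ ball (0 : ℂ) 1 := by
    intro U hU
    rw [mem_ball_zero_iff, norm_div, norm_mul, hσ1, one_mul,
      div_lt_one (norm_pos_iff.2 (hne U hU.le))]
    simpa using norm_sub_lt_norm_add_conj hU (b := 1) (by simp)
  have hζd : ∀ U : ℂ, 0 ≤ U.re → HasDerivAt ζ ((σ - ζ U) ^ 2 / (2 * σ)) U := by
    intro U hU
    have h2 := (((hasDerivAt_id U).sub_const 1).const_mul σ).div ((hasDerivAt_id U).add_const 1)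
      (hne U hU)
    refine h2.congr_deriv ?_
    have := hne U hU
    simp only [ζ, id]
    field_simp
    ring
  have hζc : ζ c = 1 := by
    have h2 : c - 1 = 2 / (σ - 1) := by simp only [c]; field_simp; ring
    have h3 : c + 1 = 2 * σ / (σ - 1) := by simp only [c]; field_simp; ring
    simp only [ζ]
    rw [h2, h3]
    field_simp
  set N : ℝ → ℝ := fun x => normSq (f (ζ (c + x)) - k)
  have hNd : ∀ x : ℝ, 0 < x → ∃ N' : ℝ, 0 ≤ N' ∧ HasDerivAt N N' x := by
    intro x hx
    have hre : 0 < (c + x).re := by simp [hc, hx]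
    have hz := hζmem _ hre
    set y := ζ (c + x) with hy
    have h2 : HasDerivAt (fun x : ℝ => f (ζ (c + x)) - k)
        (deriv f y * ((σ - y) ^ 2 / (2 * σ))) x := by
      have h3 : HasDerivAt (fun w : ℂ => c + w) 1 (x : ℂ) := by
        simpa using (hasDerivAt_id (x : ℂ)).const_add c
      have h4 := HasDerivAt.comp (x : ℂ) (h₂ := fun U => f (ζ U))
        ((hf.hasDerivAt hz).comp (c + x) (hζd _ hre.le)) h3
      refine ((h4.sub_const k).comp_ofReal).congr_deriv ?_
      rw [← hy, mul_one]
    set P := f y - k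
    set Q := deriv f y * ((σ - y) ^ 2 / (2 * σ))
    have hsy : σ - y ≠ 0 := fun h => by
      rw [← sub_eq_zero.1 h, mem_ball_zero_iff, hσ1] at hz
      exact lt_irrefl _ hz
    have hQ : Q ≠ 0 := mul_ne_zero (hf.deriv_ne_zero hz) (div_ne_zero (pow_ne_zero 2 hsy)
      (mul_ne_zero two_ne_zero hσ0))
    have hPQ : 0 ≤ (P / Q).re := by
      have h5 : P / Q = (2 : ℝ) * (σ * (P / deriv f y) / (σ - y) ^ 2) := by
        have := hf.deriv_ne_zero hz
        simp only [Q]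
        push_cast
        field_simp
      rw [h5, re_ofReal_mul]
      exact mul_nonneg zero_le_two (hσ y hz)
    refine ⟨2 * (P.re * Q.re + P.im * Q.im), ?_, ?_⟩
    · rw [Complex.div_re, ← add_div] at hPQ
      have h6 := mul_nonneg hPQ (normSq_nonneg Q)
      rw [div_mul_cancel₀ _ (normSq_pos.2 hQ).ne'] at h6
      linarith
    · have hr : HasDerivAt (fun x : ℝ => (f (ζ (c + x)) - k).re) Q.re x :=
        (reCLM.hasFDerivAt.comp_hasDerivAt x h2)
      have hi : HasDerivAt (fun x : ℝ => (f (ζ (c + x)) - k).im) Q.im x :=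
        (imCLM.hasFDerivAt.comp_hasDerivAt x h2)
      have h7 := (hr.mul hr).add (hi.mul hi)
      refine h7.congr_deriv ?_
      simp only [← hy]
      ring
  have hmono : MonotoneOn N (Ioi 0) := by
    refine monotoneOn_of_deriv_nonneg (convex_Ioi 0) (fun x hx => ?_) (fun x hx => ?_)
      fun x hx => ?_
    · obtain ⟨N', -, h⟩ := hNd x hx
      exact h.continuousAt.continuousWithinAt
    · rw [interior_Ioi] at hx
      obtain ⟨N', -, h⟩ := hNd x hx
      exact h.differentiableAt.differentiableWithinAt
    · rw [interior_Ioi] at hx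
      obtain ⟨N', h0, h⟩ := hNd x hx
      rwa [h.deriv]
  have hlim : Tendsto (fun x : ℝ => ζ (c + x)) (𝓝[>] 0) (𝓝[ball 0 1] 1) := by
    refine tendsto_nhdsWithin_iff.2 ⟨?_, ?_⟩
    · have h2 : ContinuousAt (fun x : ℝ => ζ (c + x)) 0 := by
        refine ContinuousAt.comp (g := ζ) ?_ (by fun_prop)
        simpa using (hζd c hc.ge).continuousAt
      have h3 := h2.tendsto
      simp only [ofReal_zero, add_zero, hζc] at h3
      exact h3.mono_left nhdsWithin_le_nhds
    · filter_upwards [self_mem_nhdsWithin] with x hx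
      exact hζmem _ (by simpa [hc] using hx)
  have hinf := tendsto_norm_atTop_iff_cobounded.2 (hf.map_one.comp hlim)
  have hev := hinf.eventually_gt_atTop (‖k‖ + √(N 1))
  obtain ⟨x, hx, hx0, hx1⟩ := (hev.and (Ioo_mem_nhdsGT (zero_lt_one' ℝ))).exists
  have h8 : N x ≤ N 1 := hmono hx0 (mem_Ioi.2 one_pos) hx1.le
  have h9 : ‖f (ζ (c + x)) - k‖ ≤ √(N 1) := by
    refine Real.le_sqrt_of_sq_le ?_
    rw [← normSq_eq_norm_sq]
    exact h8
  have h10 := norm_sub_norm_le (f (ζ (c + x))) k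
  simp only [Function.comp] at hx
  linarith

/-- The differential inequality for the omitted values `k + t * d` in the limit `t → ∞`. -/
theorem re_nonneg_of_isRecession (hf : IsCO α f) {d : ℂ}
    (hd : IsRecession (f '' ball 0 1)ᶜ d) {z : ℂ} (hz : z ∈ ball (0 : ℂ) 1) :
    0 ≤ (-conj d * ((1 - z) ^ 2 * deriv f z)).re := by
  obtain ⟨k, hk⟩ := hf.compl_nonempty
  set G := (1 - z) ^ 2 * deriv f z
  have hz1 : (1 - z) ≠ 0 := fun h => by
    rw [← sub_eq_zero.1 h] at hz
    simp at hz
  have hG : G ≠ 0 := mul_ne_zero (pow_ne_zero 2 hz1) (hf.deriv_ne_zero hz)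
  have h1 : ∀ t : ℝ, 0 ≤ t → 0 ≤ ((f z - k) / G).re + t * (-d / G).re := by
    intro t ht
    have := hf.re_div_nonneg (hd k hk t ht) hz
    have h2 : (f z - (k + t * d)) / G = (f z - k) / G + t * (-d / G) := by ring
    rwa [h2, add_re, re_ofReal_mul] at this
  have h2 : 0 ≤ (-d / G).re := by
    by_contra! hneg
    set A := ((f z - k) / G).re
    have hA : 0 ≤ A := by simpa using h1 0 le_rfl
    have h3 := h1 ((A + 1) / -(-d / G).re) (div_nonneg (by linarith) (by linarith))
    rw [div_mul_eq_mul_div, div_neg, mul_div_cancel_right₀ _ hneg.ne] at h3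
    linarith
  have h3 : -conj d * G = conj (-d / G) * ((normSq G : ℝ) : ℂ) := by
    have : conj G ≠ 0 := by simpa using hG
    rw [← mul_conj, map_div₀, map_neg]
    field_simp
  rw [h3, mul_comm, re_ofReal_mul, conj_re]
  exact mul_nonneg (normSq_nonneg _) h2

end IsCO

/-! ### Directions of recession and the opening angle -/

theorem re_exp_neg_mul_I_mul (σ : ℝ) (w : ℂ) :
    (exp (-(σ * I)) * w).re = Real.cos σ * w.re + Real.sin σ * w.im := by
  have : -((σ : ℂ) * I) = ((-σ : ℝ) : ℂ) * I := by push_cast; ring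
  rw [this, mul_re, exp_ofReal_mul_I_re, exp_ofReal_mul_I_im, Real.cos_neg, Real.sin_neg]
  ring

/-- The half-planes in which `e^{-iσ} w` has nonnegative real part: intermediate directions follow
from the extreme ones, since `sin (b - a) e^{-iσ} = sin (b - σ) e^{-ia} + sin (σ - a) e^{-ib}`. -/
theorem re_exp_mul_nonneg_of_mem_Icc {a b σ : ℝ} (hab : b - a < Real.pi) (hσ : σ ∈ Icc a b) {w : ℂ}
    (ha : 0 ≤ (exp (-(a * I)) * w).re) (hb : 0 ≤ (exp (-(b * I)) * w).re) :
    0 ≤ (exp (-(σ * I)) * w).re := by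
  rcases eq_or_lt_of_le (hσ.1.trans hσ.2) with h | h
  · have : σ = a := le_antisymm (h ▸ hσ.2) hσ.1
    rwa [this]
  have hs : 0 < Real.sin (b - a) := Real.sin_pos_of_pos_of_lt_pi (by linarith) hab
  have h1 : 0 ≤ Real.sin (b - σ) :=
    Real.sin_nonneg_of_nonneg_of_le_pi (by linarith [hσ.2]) (by linarith [hσ.1])
  have h2 : 0 ≤ Real.sin (σ - a) :=
    Real.sin_nonneg_of_nonneg_of_le_pi (by linarith [hσ.1]) (by linarith [hσ.2])
  have key : Real.sin (b - a) * (exp (-(σ * I)) * w).re =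
      Real.sin (b - σ) * (exp (-(a * I)) * w).re + Real.sin (σ - a) * (exp (-(b * I)) * w).re := by
    simp only [re_exp_neg_mul_I_mul, Real.sin_sub]
    ring
  have h3 : 0 ≤ Real.sin (b - a) * (exp (-(σ * I)) * w).re := by
    rw [key]
    exact add_nonneg (mul_nonneg h1 ha) (mul_nonneg h2 hb)
  exact nonneg_of_mul_nonneg_right h3 hs

/-- The Cayley transform maps the disk into the right half-plane. -/
theorem re_cayley_pos {z : ℂ} (hz : z ∈ ball (0 : ℂ) 1) : 0 < ((1 + z) / (1 - z)).re := by
  have hz' : ‖z‖ < 1 := by simpa using hz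
  have hz1 : (1 - z) ≠ 0 := fun h => by
    rw [← sub_eq_zero.1 h] at hz'
    simp at hz'
  have h1 : ((1 + z) / (1 - z)).re = (1 - ‖z‖ ^ 2) / normSq (1 - z) := by
    rw [Complex.sq_norm, Complex.div_re, ← add_div]
    congr 1
    simp only [normSq_apply, add_re, add_im, sub_re, sub_im, one_re, one_im]
    ring
  rw [h1]
  have : 0 < 1 - ‖z‖ ^ 2 := by nlinarith [norm_nonneg z]
  have := normSq_pos.2 hz1
  positivity

namespace IsCO

variable {α : ℝ} {f : ℂ → ℂ}

theorem re_exp_nonneg_of_isRecession (hf : IsCO α f) {σ : ℝ}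
    (h : IsRecession (f '' ball 0 1)ᶜ (-exp (σ * I))) {z : ℂ} (hz : z ∈ ball (0 : ℂ) 1) :
    0 ≤ (exp (-(σ * I)) * ((1 - z) ^ 2 * deriv f z)).re := by
  have := hf.re_nonneg_of_isRecession h hz
  rwa [map_neg, neg_neg, ← exp_conj, map_mul, conj_ofReal, conj_I, mul_neg] at this

theorem cos_nonneg_of_isRecession (hf : IsCO α f) {σ : ℝ}
    (h : IsRecession (f '' ball 0 1)ᶜ (-exp (σ * I))) : 0 ≤ Real.cos σ := by
  have := hf.re_exp_nonneg_of_isRecession h (z := 0) (by simp)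
  rw [re_exp_neg_mul_I_mul] at this
  simpa [hf.deriv_zero] using this

/-- The directions of recession of the omitted set fill an angle that, by the bound on the opening
angle, is at least `π (2 - α)`; its end points `a` and `b` give two half-plane conditions. -/
theorem exists_extreme_directions (hf : IsCO α f) (hα : 1 < α) :
    ∃ a b : ℝ, -(Real.pi / 2) ≤ a ∧ b ≤ Real.pi / 2 ∧ Real.pi * (2 - α) ≤ b - a ∧
      ∀ z ∈ ball (0 : ℂ) 1, 0 ≤ (exp (-(a * I)) * ((1 - z) ^ 2 * deriv f z)).re ∧
        0 ≤ (exp (-(b * I)) * ((1 - z) ^ 2 * deriv f z)).re := by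
  have hpi := Real.pi_pos
  set K := (f '' ball 0 1)ᶜ with hK
  set S : Set ℝ := {σ | σ ∈ Icc (-(Real.pi / 2)) (Real.pi / 2) ∧
    ∀ z ∈ ball (0 : ℂ) 1, 0 ≤ (exp (-(σ * I)) * ((1 - z) ^ 2 * deriv f z)).re}
  have hScl : IsClosed S := by
    refine isClosed_Icc.inter ?_
    have : {σ : ℝ | ∀ z ∈ ball (0 : ℂ) 1, 0 ≤ (exp (-(σ * I)) * ((1 - z) ^ 2 * deriv f z)).re} =
        ⋂ z ∈ ball (0 : ℂ) 1, {σ : ℝ | 0 ≤ (exp (-(σ * I)) * ((1 - z) ^ 2 * deriv f z)).re} := by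
      ext σ
      simp
    change IsClosed {σ : ℝ | ∀ z ∈ ball (0 : ℂ) 1,
      0 ≤ (exp (-(σ * I)) * ((1 - z) ^ 2 * deriv f z)).re}
    rw [this]
    refine isClosed_biInter fun z _ => isClosed_le continuous_const ?_
    fun_prop
  have hSc : IsCompact S := isCompact_Icc.of_isClosed_subset hScl fun σ hσ => hσ.1
  have hmem : ∀ σ ∈ Icc (-Real.pi) Real.pi, IsRecession K (-exp (σ * I)) → σ ∈ S := by
    intro σ hσ h
    refine ⟨?_, fun z hz => hf.re_exp_nonneg_of_isRecession h hz⟩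
    have hcos := hf.cos_nonneg_of_isRecession h
    constructor <;> by_contra! hlt
    · have := Real.cos_neg_of_pi_div_two_lt_of_lt (x := -σ) (by linarith) (by linarith [hσ.1])
      rw [Real.cos_neg] at this
      linarith
    · have := Real.cos_neg_of_pi_div_two_lt_of_lt (x := σ) (by linarith) (by linarith [hσ.2])
      linarith
  have hSne : S.Nonempty := by
    obtain ⟨d, hd1, hd⟩ := hf.exists_isRecession
    refine ⟨arg (-d), hmem _ ⟨(neg_pi_lt_arg _).le, arg_le_pi _⟩ ?_⟩
    have h1 := norm_mul_exp_arg_mul_I (-d)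
    rw [norm_neg, hd1, ofReal_one, one_mul] at h1
    rwa [h1, neg_neg]
  obtain ⟨a, haS, ha⟩ := hSc.exists_isMinOn hSne continuousOn_id
  obtain ⟨b, hbS, hb⟩ := hSc.exists_isMaxOn hSne continuousOn_id
  refine ⟨a, b, haS.1.1, hbS.1.2, ?_, fun z hz => ⟨haS.2 z hz, hbS.2 z hz⟩⟩
  have hSab : S ⊆ Icc a b := fun σ hσ => ⟨ha hσ, hb hσ⟩
  have hab : a ≤ b := ha hbS
  -- a direction that does not count for the opening angle is a direction of recession
  set T : Set ℝ := {t | t ∈ Ioc (-Real.pi) Real.pi ∧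
    ∀ᶠ r : ℝ in atTop, (r : ℂ) * exp ((t : ℂ) * I) ∈ f '' ball 0 1}
  have hrec : ∀ t ∈ Ioc (-Real.pi) Real.pi \ T, IsRecession K (exp (t * I)) := by
    rintro t ⟨ht, htT⟩
    have hfr : ∃ᶠ r : ℝ in atTop, (r : ℂ) * exp ((t : ℂ) * I) ∈ K := by
      intro h
      refine htT ⟨ht, h.mono fun r hr => ?_⟩
      simpa [hK] using hr
    have := frequently_iff_neBot.1 hfr
    have hnorm : ∀ᶠ r : ℝ in atTop ⊓ 𝓟 {r : ℝ | (r : ℂ) * exp ((t : ℂ) * I) ∈ K},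
        ‖(r : ℂ) * exp ((t : ℂ) * I)‖ = r ∧ 0 < r := by
      refine Eventually.filter_mono inf_le_left ?_
      filter_upwards [eventually_gt_atTop 0] with r hr
      rw [norm_mul, norm_exp_ofReal_mul_I, mul_one, norm_real, Real.norm_of_nonneg hr.le]
      exact ⟨rfl, hr⟩
    refine isRecession_of_tendsto (l := atTop ⊓ 𝓟 {r : ℝ | (r : ℂ) * exp ((t : ℂ) * I) ∈ K})
      hf.isClosed_compl hf.convex_compl (w := fun r => (r : ℂ) * exp ((t : ℂ) * I))
      (mem_inf_of_right (mem_principal_self _)) ?_ ?_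
    · refine (tendsto_id.mono_left inf_le_left).congr' ?_
      filter_upwards [hnorm] with r hr using hr.1.symm
    · refine tendsto_const_nhds.congr' ?_
      filter_upwards [hnorm] with r hr
      have : (r : ℂ) ≠ 0 := by exact_mod_cast hr.2.ne'
      rw [hr.1]
      field_simp
  have hcover : Ioc (-Real.pi) Real.pi ⊆
      T ∪ ((fun t => t + -Real.pi) ⁻¹' (Icc a b ∩ Iic 0) ∪
        (fun t => t + Real.pi) ⁻¹' (Icc a b \ Iic 0)) := by
    intro t ht
    by_cases htT : t ∈ T
    · exact Or.inl htT
    right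
    have hr := hrec t ⟨ht, htT⟩
    rcases le_or_gt t 0 with h0 | h0
    · right
      refine ⟨hSab (hmem _ ⟨by linarith [ht.1], by linarith⟩ ?_), ?_⟩
      · rw [show ((t + Real.pi : ℝ) : ℂ) * I = t * I + Real.pi * I by push_cast; ring, exp_add,
          exp_pi_mul_I]
        simpa using hr
      · simpa using (by linarith [ht.1] : 0 < t + Real.pi)
    · left
      refine ⟨hSab (hmem _ ⟨by linarith, by linarith [ht.2]⟩ ?_), ?_⟩
      · rw [show ((t + -Real.pi : ℝ) : ℂ) * I = t * I - Real.pi * I by push_cast; ring, exp_sub,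
          exp_pi_mul_I, div_neg, div_one, neg_neg]
        exact hr
      · simpa using ht.2
  have hvol : ENNReal.ofReal (2 * Real.pi) ≤
      ENNReal.ofReal (Real.pi * α) + ENNReal.ofReal (b - a) := by
    calc ENNReal.ofReal (2 * Real.pi) = volume (Ioc (-Real.pi) Real.pi) := by
          rw [Real.volume_Ioc]; congr 1; ring
      _ ≤ volume T + (volume ((fun t => t + -Real.pi) ⁻¹' (Icc a b ∩ Iic 0)) +
          volume ((fun t => t + Real.pi) ⁻¹' (Icc a b \ Iic 0))) :=
          (measure_mono hcover).trans ((measure_union_le _ _).trans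
            (add_le_add le_rfl (measure_union_le _ _)))
      _ = volume T + volume (Icc a b) := by
          rw [measure_preimage_add_right, measure_preimage_add_right,
            measure_inter_add_sdiff _ measurableSet_Iic]
      _ ≤ _ := by
          rw [Real.volume_Icc]
          exact add_le_add hf.angle_le le_rfl
  rw [← ENNReal.ofReal_add (by positivity) (by linarith),
    ENNReal.ofReal_le_ofReal_iff (by nlinarith)] at hvol
  linarith

/-- A fractional power of the Cayley transform absorbs the angle of recession directions. -/
theorem exists_re_exp_mul_nonneg (hf : IsCO α f) (hα : 1 < α) (hα2 : α ≤ 2) :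
    ∃ ω : ℝ, ∀ z ∈ ball (0 : ℂ) 1, 0 ≤ (exp (-(ω * I)) *
      ((1 - z) ^ 2 * deriv f z * ((1 + z) / (1 - z)) ^ ((2 - α : ℝ) : ℂ))).re := by
  obtain ⟨a, b, ha, hb, hab, h⟩ := hf.exists_extreme_directions hα
  have hpi := Real.pi_pos
  set G : ℂ → ℂ := fun z => (1 - z) ^ 2 * deriv f z with hGdef
  change ∀ z ∈ ball (0 : ℂ) 1, 0 ≤ (exp (-(a * I)) * G z).re ∧ 0 ≤ (exp (-(b * I)) * G z).re at h
  change ∃ ω : ℝ, ∀ z ∈ ball (0 : ℂ) 1, 0 ≤ (exp (-(ω * I)) *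
    (G z * ((1 + z) / (1 - z)) ^ ((2 - α : ℝ) : ℂ))).re
  -- the condition at the end points extends to all intermediate directions
  have hmid : ∀ σ ∈ Icc a b, ∀ z ∈ ball (0 : ℂ) 1, 0 ≤ (exp (-(σ * I)) * G z).re := by
    intro σ hσ
    rcases lt_or_ge (b - a) Real.pi with hlt | hge
    · exact fun z hz => re_exp_mul_nonneg_of_mem_Icc hlt hσ (h z hz).1 (h z hz).2
    · have ha' : a = -(Real.pi / 2) := by linarith
      have hb' : b = Real.pi / 2 := by linarith
      -- the two conditions force `G` to be real, hence constant
      have him : ∀ z ∈ ball (0 : ℂ) 1, (G z).im = 0 := by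
        intro z hz
        have := h z hz
        simp only [re_exp_neg_mul_I_mul, ha', hb', Real.cos_neg, Real.sin_neg, Real.cos_pi_div_two,
          Real.sin_pi_div_two] at this
        exact le_antisymm (by simpa using this.1) (by simpa using this.2)
      have hGd : DifferentiableOn ℂ G (ball 0 1) :=
        DifferentiableOn.mul (by fun_prop) hf.deriv_analytic
      obtain ⟨x, hx⟩ := AnalyticOnNhd.eq_const_of_im_eq_const (hGd.analyticOnNhd isOpen_ball) him
        isOpen_ball ((convex_ball _ _).isConnected ⟨0, by simp⟩)
      intro z hz
      have h0 : G 0 = 1 := by simp [G, hf.deriv_zero]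
      rw [hx z hz, ← hx 0 (by simp), h0, re_exp_neg_mul_I_mul]
      simpa using Real.cos_nonneg_of_mem_Icc ⟨by linarith [hσ.1], by linarith [hσ.2]⟩
  refine ⟨(a + b) / 2, fun z hz => ?_⟩
  set u := (1 + z) / (1 - z)
  have hu : 0 < u.re := re_cayley_pos hz
  have hu0 : u ≠ 0 := fun h => by simp [h] at hu
  have harg : |arg u| < Real.pi / 2 := abs_arg_lt_pi_div_two_iff.2 (Or.inl hu)
  rw [abs_lt] at harg
  clear_value G
  have hrot : exp (-(((a + b) / 2 : ℝ) * I)) * (G z * u ^ ((2 - α : ℝ) : ℂ)) =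
      (Real.exp (Real.log ‖u‖ * (2 - α)) : ℝ) *
        (exp (-(((a + b) / 2 - (2 - α) * arg u : ℝ) * I)) * G z) := by
    rw [cpow_def_of_ne_zero hu0, Complex.log, ofReal_exp, mul_comm (G z), ← mul_assoc, ← exp_add,
      ← mul_assoc, ← exp_add]
    congr 2
    push_cast
    ring
  rw [hrot, re_ofReal_mul]
  refine mul_nonneg (Real.exp_pos _).le (hmid _ ⟨?_, ?_⟩ z hz)
  · nlinarith
  · nlinarith

end IsCO

/-! ### Taylor coefficients -/

/-- The Taylor series of `f` at the origin as a formal power series, so that identities between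
functions become identities in the ring of power series. -/
noncomputable def taylor (f : ℂ → ℂ) : PowerSeries ℂ :=
  PowerSeries.mk fun n => iteratedDeriv n f 0 / (n.factorial : ℂ)

theorem analyticAt_of_differentiableOn_ball {f : ℂ → ℂ} (hf : DifferentiableOn ℂ f (ball 0 1)) :
    AnalyticAt ℂ f 0 :=
  hf.analyticAt (ball_mem_nhds 0 one_pos)

theorem hasSum_taylor {f : ℂ → ℂ} (hf : DifferentiableOn ℂ f (ball 0 1)) {z : ℂ}
    (hz : z ∈ ball (0 : ℂ) 1) : HasSum (fun n => (taylor f).coeff n * z ^ n) (f z) := by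
  refine (hasSum_taylorSeries_on_ball hf hz).congr_fun fun n => ?_
  simp only [taylor, PowerSeries.coeff_mk, smul_eq_mul, sub_zero]
  ring

theorem taylor_eq_of_hasSum {f : ℂ → ℂ} {p : PowerSeries ℂ}
    (h : ∀ z ∈ ball (0 : ℂ) 1, HasSum (fun n => p.coeff n * z ^ n) (f z)) : taylor f = p := by
  have h1 : HasFPowerSeriesAt f (FormalMultilinearSeries.ofScalars ℂ fun n => p.coeff n) 0 := by
    rw [hasFPowerSeriesAt_iff]
    filter_upwards [ball_mem_nhds 0 one_pos] with z hz
    simpa [mul_comm, FormalMultilinearSeries.coeff_ofScalars] using h z hz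
  have h2 := h1.eq_formalMultilinearSeries h1.analyticAt.hasFPowerSeriesAt
  ext n
  have h3 := congrArg (fun q => FormalMultilinearSeries.coeff q n) h2
  simp only [FormalMultilinearSeries.coeff_ofScalars] at h3
  rw [taylor, PowerSeries.coeff_mk, ← h3]

theorem taylor_congr {f g : ℂ → ℂ} (h : EqOn f g (ball 0 1)) : taylor f = taylor g := by
  ext n
  simp only [taylor, PowerSeries.coeff_mk]
  rw [(h.eventuallyEq_of_mem (ball_mem_nhds 0 one_pos)).iteratedDeriv_eq n]

theorem taylor_mul {f g : ℂ → ℂ} (hf : DifferentiableOn ℂ f (ball 0 1))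
    (hg : DifferentiableOn ℂ g (ball 0 1)) :
    taylor (fun z => f z * g z) = taylor f * taylor g := by
  ext n
  have hfc := (analyticAt_of_differentiableOn_ball hf).contDiffAt (n := n)
  have hgc := (analyticAt_of_differentiableOn_ball hg).contDiffAt (n := n)
  simp only [taylor, PowerSeries.coeff_mk, PowerSeries.coeff_mul]
  rw [iteratedDeriv_fun_mul hfc hgc, Finset.Nat.sum_antidiagonal_eq_sum_range_succ
    (fun i j => iteratedDeriv i f 0 / (i.factorial : ℂ) * (iteratedDeriv j g 0 / j.factorial)),
    Finset.sum_div]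
  refine Finset.sum_congr rfl fun i hi => ?_
  have hin : i ≤ n := Nat.lt_succ_iff.1 (Finset.mem_range.1 hi)
  rw [Nat.cast_choose ℂ hin]
  have h1 : (n.factorial : ℂ) ≠ 0 := by exact_mod_cast n.factorial_ne_zero
  have h2 : (i.factorial : ℂ) ≠ 0 := by exact_mod_cast i.factorial_ne_zero
  have h3 : ((n - i).factorial : ℂ) ≠ 0 := by exact_mod_cast (n - i).factorial_ne_zero
  field_simp

theorem taylor_deriv (f : ℂ → ℂ) : taylor (deriv f) = PowerSeries.derivative ℂ (taylor f) := by
  ext n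
  rw [PowerSeries.coeff_derivative]
  simp only [taylor, PowerSeries.coeff_mk]
  rw [iteratedDeriv_succ', Nat.factorial_succ]
  have h1 : (n.factorial : ℂ) ≠ 0 := by exact_mod_cast n.factorial_ne_zero
  have h2 : (n : ℂ) + 1 ≠ 0 := by exact_mod_cast n.succ_ne_zero
  push_cast
  field_simp

theorem taylor_eval (p : Polynomial ℂ) : taylor (fun z => p.eval z) = (p : PowerSeries ℂ) := by
  refine taylor_eq_of_hasSum fun z _ => ?_
  simp only [Polynomial.coeff_coe]
  rw [Polynomial.eval_eq_sum_range]
  refine hasSum_sum_of_ne_finset_zero fun n hn => ?_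
  rw [Polynomial.coeff_eq_zero_of_natDegree_lt, zero_mul]
  simpa [Nat.lt_succ_iff] using hn

theorem coeff_zero_taylor (f : ℂ → ℂ) : (taylor f).coeff 0 = f 0 := by simp [taylor]

theorem HasExpansion.eq_coeff_taylor {f : ℂ → ℂ} {a : ℕ → ℂ} (h : HasExpansion f a) {n : ℕ}
    (hn : 2 ≤ n) : a n = (taylor f).coeff n := by
  have h1 : taylor f = PowerSeries.mk fun n => if n = 0 then 0 else if n = 1 then 1 else a n := by
    refine taylor_eq_of_hasSum fun z hz => ?_
    have h2 := (hasSum_nat_add_iff (f := fun n => (PowerSeries.mk fun n => if n = 0 then (0 : ℂ)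
      else if n = 1 then 1 else a n).coeff n * z ^ n) (g := f z - z) 2).1
      (by simpa using h z hz)
    simpa [Finset.sum_range_succ] using h2
  rw [h1, PowerSeries.coeff_mk, if_neg (by lia), if_neg (by lia)]

theorem integral_exp_int_mul_I (m : ℤ) :
    ∫ t : ℝ in (0)..(2 * Real.pi), exp (m * t * I) = if m = 0 then (2 * Real.pi : ℂ) else 0 := by
  split_ifs with hm
  · simp [hm]
  · have hc : (m * I : ℂ) ≠ 0 := mul_ne_zero (by exact_mod_cast hm) I_ne_zero
    have h1 := integral_exp_mul_complex (a := 0) (b := 2 * Real.pi) hc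
    have h2 : (m * I * ((2 * Real.pi : ℝ) : ℂ)) = m * (2 * Real.pi * I) := by push_cast; ring
    rw [h2, exp_int_mul_two_pi_mul_I] at h1
    simp only [ofReal_zero, mul_zero, exp_zero, sub_self, zero_div] at h1
    rw [← h1]
    refine intervalIntegral.integral_congr fun t _ => ?_
    simp only [mul_right_comm]

/-- Fourier coefficients of a holomorphic function on a circle. -/
theorem integral_mul_exp {p : ℂ → ℂ} (hp : DifferentiableOn ℂ p (ball 0 1)) {r : ℝ} (h0 : 0 ≤ r)
    (h1 : r < 1) (j k : ℕ) :
    ∫ t : ℝ in (0)..(2 * Real.pi), p (r * exp (t * I)) * exp (((j : ℤ) - k : ℤ) * t * I) =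
      if j ≤ k then 2 * Real.pi * ((taylor p).coeff (k - j) * r ^ (k - j)) else 0 := by
  have hmem : ∀ t : ℝ, (r : ℂ) * exp (t * I) ∈ ball (0 : ℂ) 1 := fun t => by
    rw [mem_ball_zero_iff, norm_mul, norm_exp_ofReal_mul_I, mul_one, norm_real,
      Real.norm_of_nonneg h0]
    exact h1
  have hsum : Summable fun n => ‖(taylor p).coeff n * (r : ℂ) ^ n‖ := by
    have := (hasSum_taylor hp (z := r) (by simpa using hmem 0)).summable
    exact this.norm
  set F : ℕ → ℝ → ℂ := fun n t =>
    (taylor p).coeff n * r ^ n * exp ((((n + j : ℕ) : ℤ) - k : ℤ) * t * I)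
  have hF := intervalIntegral.hasSum_integral_of_dominated_convergence (μ := volume) (a := 0)
    (b := 2 * Real.pi) (F := F)
    (f := fun t => p (r * exp (t * I)) * exp (((j : ℤ) - k : ℤ) * t * I))
    (fun n _ => ‖(taylor p).coeff n * (r : ℂ) ^ n‖)
    (fun n => (by fun_prop : Continuous (F n)).aestronglyMeasurable)
    (fun n => Eventually.of_forall fun t _ => by
      have : ((((n + j : ℕ) : ℤ) - k : ℤ) * t * I : ℂ) =
        (((((n + j : ℕ) : ℤ) - k : ℤ) * t : ℝ) : ℂ) * I := by push_cast; ring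
      simp only [F]
      rw [norm_mul, this, norm_exp_ofReal_mul_I, mul_one])
    (Eventually.of_forall fun t _ => hsum) intervalIntegrable_const
    (Eventually.of_forall fun t _ => by
      refine ((hasSum_taylor hp (hmem t)).mul_right _).congr_fun fun n => ?_
      simp only [F]
      have : exp ((((n + j : ℕ) : ℤ) - k : ℤ) * t * I : ℂ) =
          exp (t * I) ^ n * exp (((j : ℤ) - k : ℤ) * t * I) := by
        rw [← exp_nat_mul, ← exp_add]
        congr 1
        push_cast
        ring
      rw [this]
      ring)
  have hint : ∀ n, ∫ t in (0)..(2 * Real.pi), F n t =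
      if n + j = k then 2 * Real.pi * ((taylor p).coeff n * r ^ n) else 0 := by
    intro n
    simp only [F]
    rw [intervalIntegral.integral_const_mul, integral_exp_int_mul_I]
    split_ifs with h2 h3 h3
    · ring
    · exact absurd (by lia) h3
    · exact absurd (by lia) h2
    · simp
  simp only [hint] at hF
  refine hF.unique ?_
  split_ifs with hjk
  · refine (hasSum_ite_eq (k - j)
      (2 * Real.pi * ((taylor p).coeff (k - j) * r ^ (k - j)) : ℂ)).congr_fun fun n => ?_
    by_cases h2 : n = k - j
    · rw [if_pos (by lia), if_pos h2, h2]
    · rw [if_neg (by lia), if_neg h2]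
  · refine hasSum_zero.congr_fun fun n => ?_
    rw [if_neg (by lia)]

/-- Positivity of the Toeplitz forms of a function with nonnegative real part: integrate that real
part against the square of the modulus of a trigonometric polynomial. -/
theorem toeplitz_nonneg {p : ℂ → ℂ} (hp : DifferentiableOn ℂ p (ball 0 1))
    (hre : ∀ z ∈ ball (0 : ℂ) 1, 0 ≤ (p z).re) (N : ℕ) (c : ℕ → ℂ) :
    0 ≤ (∑ j ∈ Finset.range N, ∑ k ∈ Finset.range N,
      if j ≤ k then c j * conj (c k) * (taylor p).coeff (k - j) else 0).re := by
  have hr : ∀ r : ℝ, 0 ≤ r → r < 1 → 0 ≤ (∑ j ∈ Finset.range N, ∑ k ∈ Finset.range N,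
      if j ≤ k then c j * conj (c k) * ((taylor p).coeff (k - j) * r ^ (k - j)) else 0).re := by
    intro r h0 h1
    have hmem : ∀ t : ℝ, (r : ℂ) * exp (t * I) ∈ ball (0 : ℂ) 1 := fun t => by
      rw [mem_ball_zero_iff, norm_mul, norm_exp_ofReal_mul_I, mul_one, norm_real,
        Real.norm_of_nonneg h0]
      exact h1
    have hcont : Continuous fun t : ℝ => p (r * exp (t * I)) :=
      hp.continuousOn.comp_continuous (by fun_prop) hmem
    set Q : ℝ → ℂ := fun t => ∑ j ∈ Finset.range N, c j * exp (j * t * I)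
    have hexp : ∀ t : ℝ, p (r * exp (t * I)) * (normSq (Q t) : ℂ) =
        ∑ j ∈ Finset.range N, ∑ k ∈ Finset.range N, c j * conj (c k) *
          (p (r * exp (t * I)) * exp (((j : ℤ) - k : ℤ) * t * I)) := by
      intro t
      rw [← mul_conj]
      simp only [Q]
      rw [map_sum, Finset.sum_mul_sum, Finset.mul_sum]
      refine Finset.sum_congr rfl fun j _ => ?_
      rw [Finset.mul_sum]
      refine Finset.sum_congr rfl fun k _ => ?_
      have : exp (((j : ℤ) - k : ℤ) * t * I : ℂ) = exp (j * t * I) * conj (exp (k * t * I)) := by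
        rw [← exp_conj, ← exp_add]
        congr 1
        simp only [map_mul, conj_I, conj_ofReal, map_natCast]
        push_cast
        ring
      rw [this, map_mul]
      ring
    have hterm : ∀ j k : ℕ, Continuous fun t : ℝ => c j * conj (c k) *
        (p (r * exp (t * I)) * exp (((j : ℤ) - k : ℤ) * t * I)) := fun j k =>
      continuous_const.mul (hcont.mul (by fun_prop))
    have hint : ∫ t in (0)..(2 * Real.pi), p (r * exp (t * I)) * (normSq (Q t) : ℂ) =
        2 * Real.pi * ∑ j ∈ Finset.range N, ∑ k ∈ Finset.range N,
        if j ≤ k then c j * conj (c k) * ((taylor p).coeff (k - j) * r ^ (k - j)) else 0 := by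
      simp only [hexp]
      rw [intervalIntegral.integral_finsetSum fun j _ =>
        (continuous_finsetSum _ fun k _ => hterm j k).intervalIntegrable _ _, Finset.mul_sum]
      refine Finset.sum_congr rfl fun j _ => ?_
      rw [intervalIntegral.integral_finsetSum fun k _ =>
        (hterm j k).intervalIntegrable _ _, Finset.mul_sum]
      refine Finset.sum_congr rfl fun k _ => ?_
      rw [intervalIntegral.integral_const_mul, integral_mul_exp hp h0 h1]
      split_ifs <;> ring
    have hQc : Continuous Q := by fun_prop
    have hcont2 : Continuous fun t : ℝ => p (r * exp (t * I)) * (normSq (Q t) : ℂ) :=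
      hcont.mul (continuous_ofReal.comp (continuous_normSq.comp hQc))
    have hpos : 0 ≤ (∫ t in (0)..(2 * Real.pi), p (r * exp (t * I)) * (normSq (Q t) : ℂ)).re := by
      have h2 := reCLM.intervalIntegral_comp_comm (hcont2.intervalIntegrable (μ := volume) 0
        (2 * Real.pi))
      simp only [reCLM_apply] at h2
      rw [← h2]
      refine intervalIntegral.integral_nonneg (by positivity) fun t _ => ?_
      rw [mul_comm, re_ofReal_mul]
      exact mul_nonneg (normSq_nonneg _) (hre _ (hmem t))
    rw [hint, show (2 * Real.pi : ℂ) = ((2 * Real.pi : ℝ) : ℂ) by push_cast; ring,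
      re_ofReal_mul] at hpos
    exact nonneg_of_mul_nonneg_right hpos (by positivity)
  have hlim : Tendsto (fun r : ℝ => (∑ j ∈ Finset.range N, ∑ k ∈ Finset.range N,
      if j ≤ k then c j * conj (c k) * ((taylor p).coeff (k - j) * (r : ℂ) ^ (k - j)) else 0).re)
      (𝓝[<] 1) (𝓝 (∑ j ∈ Finset.range N, ∑ k ∈ Finset.range N,
      if j ≤ k then c j * conj (c k) * ((taylor p).coeff (k - j) * ((1 : ℝ) : ℂ) ^ (k - j))
        else 0).re) := by
    refine tendsto_nhdsWithin_of_tendsto_nhds (Continuous.tendsto (continuous_re.comp ?_) 1)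
    refine continuous_finsetSum _ fun j _ => continuous_finsetSum _ fun k _ => ?_
    split_ifs <;> fun_prop
  simp only [ofReal_one, one_pow, mul_one] at hlim
  refine ge_of_tendsto hlim ?_
  filter_upwards [Ioo_mem_nhdsLT (zero_lt_one' ℝ)] with r hr'
  exact hr r hr'.1.le hr'.2

theorem taylor_const_mul {f : ℂ → ℂ} (hf : DifferentiableOn ℂ f (ball 0 1)) (c : ℂ) :
    taylor (fun z => c * f z) = PowerSeries.C c * taylor f :=
  taylor_eq_of_hasSum fun z hz => by
    simpa [mul_assoc] using (hasSum_taylor hf hz).mul_left c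

theorem taylor_one_sub_const_mul {f : ℂ → ℂ} (hf : DifferentiableOn ℂ f (ball 0 1)) (c : ℂ) :
    taylor (fun z => 1 - c * f z) = 1 - PowerSeries.C c * taylor f :=
  taylor_eq_of_hasSum fun z hz => by
    have h1 : HasSum (fun n => (1 : PowerSeries ℂ).coeff n * z ^ n) 1 := by
      refine (hasSum_ite_eq (0 : ℕ) (1 : ℂ)).congr_fun fun n => ?_
      rcases eq_or_ne n 0 with rfl | hn <;> simp [PowerSeries.coeff_one, *]
    simpa [mul_assoc, sub_mul] using h1.sub ((hasSum_taylor hf hz).mul_left c)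

/-- Carathéodory's coefficient bound for functions with nonnegative real part. -/
theorem norm_coeff_taylor_le_two_mul_re {p : ℂ → ℂ} (hp : DifferentiableOn ℂ p (ball 0 1))
    (hre : ∀ z ∈ ball (0 : ℂ) 1, 0 ≤ (p z).re) {n : ℕ} (hn : n ≠ 0) :
    ‖(taylor p).coeff n‖ ≤ 2 * (p 0).re := by
  set P := (taylor p).coeff n with hP
  by_cases hP0 : P = 0
  · rw [hP0, norm_zero]
    have := hre 0 (by simp)
    positivity
  have hPn : (‖P‖ : ℂ) ≠ 0 := by simpa using hP0
  set e : ℂ := -(P / ‖P‖)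
  have hee : e * conj e = 1 := by
    rw [mul_conj, normSq_eq_norm_sq, norm_neg, norm_div, norm_real, norm_norm,
      div_self (by simpa using hP0)]
    norm_num
  have heP : conj e * P = -(‖P‖ : ℂ) := by
    have h1 : conj P * P = (‖P‖ : ℂ) ^ 2 := by
      rw [mul_comm, mul_conj, normSq_eq_norm_sq]; push_cast; ring
    simp only [e, map_neg, map_div₀, conj_ofReal]
    field_simp
    linear_combination -h1
  have key := toeplitz_nonneg hp hre (n + 1) fun j => if j = 0 then 1 else if j = n then e else 0
  have hsum : ∀ F : ℕ → ℂ, (∀ j, j ≠ 0 ∧ j ≠ n → F j = 0) →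
      ∑ j ∈ Finset.range (n + 1), F j = F 0 + F n := fun F hF =>
    Finset.sum_eq_add _ _ hn.symm (fun j _ h => hF j h) (by simp) (by simp)
  rw [hsum _ fun j hj => by simp [hj.1, hj.2], hsum _ fun j hj => by simp [hj.1, hj.2],
    hsum _ fun j hj => by simp [hj.1, hj.2]] at key
  simp only [hn, if_true, if_false, zero_le, Nat.sub_self, Nat.sub_zero, le_refl, map_one,
    one_mul, nonpos_iff_eq_zero, zero_add, ← hP, hee, heP, coeff_zero_taylor] at key
  simp only [add_re, neg_re, ofReal_re] at key
  linarith

open PowerSeries in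
theorem coeff_mul_mk_one (q : PowerSeries ℂ) (n : ℕ) :
    (q * PowerSeries.mk 1).coeff n = ∑ j ∈ Finset.range (n + 1), q.coeff j := by
  rw [coeff_mul, Finset.Nat.sum_antidiagonal_eq_sum_range_succ_mk]
  simp

open PowerSeries in
theorem coeff_mul_mk_one_mul_mk_one (q : PowerSeries ℂ) (n : ℕ) :
    (q * PowerSeries.mk 1 * PowerSeries.mk 1).coeff n =
      ∑ j ∈ Finset.range (n + 1), ∑ k ∈ Finset.range (n + 1),
        if j ≤ k then q.coeff (k - j) else 0 := by
  rw [coeff_mul_mk_one, Finset.sum_comm]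
  refine Finset.sum_congr rfl fun k hk => ?_
  rw [coeff_mul_mk_one, ← Finset.sum_filter, ← Finset.sum_range_reflect]
  have h1 : Finset.filter (fun j => j ≤ k) (Finset.range (n + 1)) = Finset.range (k + 1) := by
    ext j
    simp only [Finset.mem_filter, Finset.mem_range] at hk ⊢
    lia
  rw [h1]
  exact Finset.sum_congr rfl fun j _ => by congr 1

open PowerSeries in
theorem coeff_mk_one_sq (n : ℕ) :
    (PowerSeries.mk 1 * PowerSeries.mk 1 : PowerSeries ℂ).coeff n = n + 1 := by
  rw [coeff_mul_mk_one]
  simp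

theorem sum_range_add_one {K : Type*} [Field K] [CharZero K] (n : ℕ) :
    ∑ l ∈ Finset.range n, ((l : K) + 1) = n * (n + 1) / 2 := by
  induction n with
  | zero => simp
  | succ n ih =>
    rw [Finset.sum_range_succ, ih]
    push_cast
    field_simp
    ring

/-- Fejér's bound for the Cesàro means of a bounded function. -/
theorem norm_coeff_taylor_mul_mk_one_sq_le {ψ : ℂ → ℂ} (hψ : DifferentiableOn ℂ ψ (ball 0 1))
    (hb : ∀ z ∈ ball (0 : ℂ) 1, ‖ψ z‖ ≤ 1) (n : ℕ) :
    ‖(taylor ψ * PowerSeries.mk 1 * PowerSeries.mk 1).coeff n‖ ≤ n + 1 := by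
  set S := (taylor ψ * PowerSeries.mk 1 * PowerSeries.mk 1).coeff n with hS
  by_cases hS0 : S = 0
  · rw [hS0, norm_zero]; positivity
  have hSn : (‖S‖ : ℂ) ≠ 0 := by simpa using hS0
  set e : ℂ := conj S / ‖S‖
  have he : ‖e‖ = 1 := by
    rw [norm_div, norm_real, norm_norm, RCLike.norm_conj, div_self (by simpa using hS0)]
  have heS : e * S = ‖S‖ := by
    have h1 : conj S * S = (‖S‖ : ℂ) ^ 2 := by
      rw [mul_comm, mul_conj, normSq_eq_norm_sq]; push_cast; ring
    simp only [e]
    field_simp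
    linear_combination h1
  have key := toeplitz_nonneg (p := fun z => 1 - e * ψ z) ((hψ.const_mul e).const_sub 1)
    (fun z hz => by
      have h1 := re_le_norm (e * ψ z)
      rw [norm_mul, he, one_mul] at h1
      have := hb z hz
      rw [sub_re, one_re]
      linarith) (n + 1) fun _ => 1
  simp only [map_one, one_mul] at key
  rw [← coeff_mul_mk_one_mul_mk_one, taylor_one_sub_const_mul hψ, sub_mul, sub_mul, one_mul,
    mul_assoc (PowerSeries.C e), mul_assoc (PowerSeries.C e), map_sub, PowerSeries.coeff_C_mul,
    coeff_mk_one_sq, ← hS, heS, sub_re, ofReal_re] at key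
  simp at key
  exact key

open PowerSeries in
/-- The coefficients of a function whose derivative is `(1 - z ψ) / (1 - z) ^ 3` with `|ψ| ≤ 1`. -/
theorem norm_coeff_taylor_sub_le {f ψ : ℂ → ℂ} (hf : DifferentiableOn ℂ f (ball 0 1))
    (hψ : DifferentiableOn ℂ ψ (ball 0 1)) (hb : ∀ z ∈ ball (0 : ℂ) 1, ‖ψ z‖ ≤ 1)
    (h : ∀ z ∈ ball (0 : ℂ) 1, (1 - z) ^ 3 * deriv f z = 1 - z * ψ z) (N : ℕ) :
    ‖(taylor f).coeff (N + 2) - ((N + 2 : ℂ) + 1) / 2‖ ≤ ((N + 2 : ℝ) - 1) / 2 := by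
  have hX : taylor (fun z => (1 - z) ^ 3) = ((1 : PowerSeries ℂ) - X) ^ 3 := by
    have := taylor_eval ((1 - Polynomial.X) ^ 3)
    simpa using this
  have hX1 : taylor (fun z => z * ψ z) = X * taylor ψ := by
    rw [taylor_mul (f := fun z => z) differentiableOn_id hψ]
    have := taylor_eval Polynomial.X
    simp only [Polynomial.eval_X, Polynomial.coe_X] at this
    rw [this]
  have h1 : ((1 : PowerSeries ℂ) - X) ^ 3 * taylor (deriv f) = 1 - X * taylor ψ := by
    rw [← hX, ← taylor_mul (by fun_prop) (hf.deriv isOpen_ball), taylor_congr h]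
    have := taylor_one_sub_const_mul (differentiableOn_id.mul hψ) 1
    simp only [one_mul, map_one, Pi.mul_apply, id] at this
    rw [this, ← hX1]
    rfl
  have hE := mk_one_mul_one_sub_eq_one ℂ
  have h2 : taylor (deriv f) = PowerSeries.mk 1 * PowerSeries.mk 1 * PowerSeries.mk 1 -
      X * (taylor ψ * PowerSeries.mk 1 * PowerSeries.mk 1 * PowerSeries.mk 1) := by
    calc taylor (deriv f) = (PowerSeries.mk 1 * (1 - X)) ^ 3 * taylor (deriv f) := by rw [hE]; ring
      _ = PowerSeries.mk 1 ^ 3 * ((1 - X) ^ 3 * taylor (deriv f)) := by ring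
      _ = _ := by rw [h1]; ring
  have h3 := congrArg (coeff (N + 1)) h2
  have h4 : (∑ l ∈ Finset.range (N + 2), ((l : ℂ) + 1)) = (N + 2) * (N + 3) / 2 := by
    rw [sum_range_add_one]
    push_cast
    ring
  have h5 : ∑ l ∈ Finset.range (N + 1), ((l : ℝ) + 1) = (N + 1) * (N + 2) / 2 := by
    rw [sum_range_add_one]
    push_cast
    ring
  have h6 : ‖(taylor ψ * PowerSeries.mk 1 * PowerSeries.mk 1 * PowerSeries.mk 1).coeff N‖ ≤
      (N + 1) * (N + 2) / 2 := by
    rw [coeff_mul_mk_one, ← h5]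
    exact (norm_sum_le _ _).trans (Finset.sum_le_sum fun l _ =>
      norm_coeff_taylor_mul_mk_one_sq_le hψ hb l)
  rw [taylor_deriv, coeff_derivative, map_sub, coeff_succ_X_mul, coeff_mul_mk_one] at h3
  simp only [coeff_mk_one_sq] at h3
  rw [h4] at h3
  push_cast at h3
  have hN : (N : ℂ) + 2 ≠ 0 := by exact_mod_cast (N + 1).succ_ne_zero
  have h7 : (taylor f).coeff (N + 2) - ((N + 2 : ℂ) + 1) / 2 =
      -(taylor ψ * PowerSeries.mk 1 * PowerSeries.mk 1 * PowerSeries.mk 1).coeff N / (N + 2) := by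
    rw [eq_div_iff hN]
    linear_combination h3
  have h8 : ‖(N : ℂ) + 2‖ = N + 2 := by
    rw [show (N : ℂ) + 2 = ((N + 2 : ℝ) : ℂ) by push_cast; ring, norm_real,
      Real.norm_of_nonneg (by positivity)]
  rw [h7, norm_div, norm_neg, h8, div_le_iff₀ (by positivity)]
  linarith

/-! ### The coefficient bound for `CO α` -/

theorem one_sub_ne_zero_of_mem_ball {z : ℂ} (hz : z ∈ ball (0 : ℂ) 1) : 1 - z ≠ 0 := fun h => by
  rw [← sub_eq_zero.1 h] at hz
  simp at hz

theorem cayley_mem_slitPlane {z : ℂ} (hz : z ∈ ball (0 : ℂ) 1) : (1 + z) / (1 - z) ∈ slitPlane :=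
  Or.inl (re_cayley_pos hz)

theorem hasDerivAt_cayley_cpow {z : ℂ} (hz : z ∈ ball (0 : ℂ) 1) (c : ℂ) :
    HasDerivAt (fun z => ((1 + z) / (1 - z)) ^ c)
      (2 * c * ((1 - z) ^ 2)⁻¹ * ((1 + z) / (1 - z)) ^ (c - 1)) z := by
  have h1 := one_sub_ne_zero_of_mem_ball hz
  have h2 : HasDerivAt (fun z : ℂ => (1 + z) / (1 - z)) (2 / (1 - z) ^ 2) z := by
    refine (((hasDerivAt_id z).const_add 1).div ((hasDerivAt_id z).const_sub 1) h1).congr_deriv ?_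
    simp only [id]
    ring
  refine (h2.cpow_const (cayley_mem_slitPlane hz)).congr_deriv ?_
  ring

theorem differentiableOn_cayley :
    DifferentiableOn ℂ (fun z : ℂ => (1 + z) / (1 - z)) (ball 0 1) :=
  DifferentiableOn.fun_div (by fun_prop) (by fun_prop) fun _ hz => one_sub_ne_zero_of_mem_ball hz

theorem differentiableOn_cayley_cpow (c : ℂ) :
    DifferentiableOn ℂ (fun z : ℂ => ((1 + z) / (1 - z)) ^ c) (ball 0 1) := fun _ hz =>
  (hasDerivAt_cayley_cpow hz c).differentiableAt.differentiableWithinAt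

theorem differentiableOn_inv_one_sub_sq_mul_cayley_cpow (c : ℂ) :
    DifferentiableOn ℂ (fun z : ℂ => ((1 - z) ^ 2)⁻¹ * ((1 + z) / (1 - z)) ^ c) (ball 0 1) :=
  DifferentiableOn.mul (DifferentiableOn.inv (by fun_prop)
    fun _ hz => pow_ne_zero 2 (one_sub_ne_zero_of_mem_ball hz)) (differentiableOn_cayley_cpow c)

open PowerSeries in
/-- The linear differential equation `(1 - X ^ 2) κ' = (2 b + 2 X) κ` with `b ≥ 0` preserves the
nonnegativity of the coefficients. -/
theorem exists_coeff_eq_ofReal {κ : PowerSeries ℂ} {b : ℝ} (hb : 0 ≤ b) (h0 : κ.coeff 0 = 1)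
    (h : (1 - X ^ 2) * derivative ℂ κ = (C (2 * b : ℂ) + 2 * X) * κ) (n : ℕ) :
    ∃ x : ℝ, 0 ≤ x ∧ κ.coeff n = x := by
  have h1 : κ.coeff 1 = 2 * b := by
    have := congrArg (coeff 0) h
    rw [sub_mul, add_mul, one_mul, sq, mul_assoc, mul_assoc 2, mul_left_comm 2 X] at this
    simpa [coeff_derivative, -coeff_zero_eq_constantCoeff, h0, coeff_zero_X_mul,
      ← map_mul] using this
  have h2 : ∀ n, κ.coeff (n + 2) = (2 * b * κ.coeff (n + 1) + (n + 2) * κ.coeff n) / (n + 2) := by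
    intro n
    have hn : (n : ℂ) + 2 ≠ 0 := by exact_mod_cast (n + 1).succ_ne_zero
    rw [eq_div_iff hn]
    have := congrArg (coeff (n + 1)) h
    rw [sub_mul, add_mul, one_mul, sq, mul_assoc, mul_assoc 2, mul_left_comm 2 X, map_sub, map_add,
      coeff_succ_X_mul, coeff_succ_X_mul, coeff_C_mul, coeff_derivative,
      show (2 : PowerSeries ℂ) = C 2 from (map_ofNat C 2).symm, coeff_C_mul] at this
    rcases n with _ | n
    · simp only [coeff_zero_X_mul] at this
      push_cast at this ⊢
      linear_combination this
    · rw [coeff_succ_X_mul, coeff_derivative] at this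
      push_cast at this ⊢
      linear_combination this
  induction n using Nat.strong_induction_on with
  | _ n ih =>
    rcases n with _ | _ | n
    · exact ⟨1, zero_le_one, by simpa using h0⟩
    · exact ⟨2 * b, by positivity, by rw [zero_add, h1]; push_cast; ring⟩
    · obtain ⟨x, hx, hxe⟩ := ih n (by lia)
      obtain ⟨y, hy, hye⟩ := ih (n + 1) (by lia)
      refine ⟨(2 * b * y + (n + 2) * x) / (n + 2), by positivity, ?_⟩
      rw [h2, hxe, hye]
      push_cast
      ring

/-- The function `(1 - z) ^ (-2) ((1 + z) / (1 - z)) ^ (α - 2)`, which is `1 / (2 α)` times the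
derivative of `((1 + z) / (1 - z)) ^ α` divided by `(1 + z) / (1 - z)`, has nonnegative
coefficients. -/
theorem exists_coeff_taylor_eq_ofReal {α : ℝ} (hα : 1 ≤ α) (n : ℕ) :
    ∃ x : ℝ, 0 ≤ x ∧ (taylor fun z : ℂ =>
      ((1 - z) ^ 2)⁻¹ * ((1 + z) / (1 - z)) ^ ((α : ℂ) - 2)).coeff n = x := by
  set κ : ℂ → ℂ := fun z => ((1 - z) ^ 2)⁻¹ * ((1 + z) / (1 - z)) ^ ((α : ℂ) - 2)
  have hκ : DifferentiableOn ℂ κ (ball 0 1) := differentiableOn_inv_one_sub_sq_mul_cayley_cpow _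
  have hode : EqOn (fun z => (1 - z ^ 2) * deriv κ z)
      (fun z => (2 * (α - 1 : ℝ) + 2 * z) * κ z) (ball 0 1) := by
    intro z hz
    have h1 := one_sub_ne_zero_of_mem_ball hz
    have hu : (1 + z) / (1 - z) ≠ 0 := slitPlane_ne_zero (cayley_mem_slitPlane hz)
    have h1' : 1 + z ≠ 0 := fun h => hu (by rw [h, zero_div])
    have hd := ((((hasDerivAt_id z).const_sub 1).pow 2).inv (pow_ne_zero 2 h1)).mul
      (hasDerivAt_cayley_cpow hz (α - 2))
    have hd' : deriv κ z = _ := hd.deriv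
    simp only [hd']
    have h2 : ((1 + z) / (1 - z)) ^ ((α : ℂ) - 2 - 1) =
        ((1 + z) / (1 - z)) ^ ((α : ℂ) - 2) / ((1 + z) / (1 - z)) := by
      rw [cpow_sub (_ - 2) _ hu, cpow_one]
    rw [h2]
    simp only [κ, id, Pi.pow_apply, Pi.inv_apply]
    push_cast
    field_simp
    ring
  have hT := taylor_congr hode
  rw [taylor_mul (by fun_prop) (hκ.deriv isOpen_ball), taylor_deriv,
    taylor_mul (by fun_prop) hκ] at hT
  have e1 := taylor_eval (1 - Polynomial.X ^ 2)
  have e2 := taylor_eval (Polynomial.C (2 * (α - 1 : ℝ) : ℂ) + 2 * Polynomial.X)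
  simp only [Polynomial.eval_sub, Polynomial.eval_one, Polynomial.eval_pow, Polynomial.eval_X,
    Polynomial.coe_sub, Polynomial.coe_one, Polynomial.coe_pow, Polynomial.coe_X] at e1
  simp only [Polynomial.eval_add, Polynomial.eval_C, Polynomial.eval_mul, Polynomial.eval_X,
    Polynomial.eval_ofNat, Polynomial.coe_add, Polynomial.coe_C, Polynomial.coe_mul,
    Polynomial.coe_X] at e2
  have e3 : ((2 : Polynomial ℂ) : PowerSeries ℂ) = 2 := by
    rw [show (2 : Polynomial ℂ) = Polynomial.C 2 from (map_ofNat Polynomial.C 2).symm,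
      Polynomial.coe_C, map_ofNat]
  rw [e1, e2, e3] at hT
  exact exists_coeff_eq_ofReal (by linarith : (0 : ℝ) ≤ α - 1)
    (by rw [coeff_zero_taylor]; simp [κ]) hT n

open PowerSeries in
theorem taylor_cayley : taylor (fun z => (1 + z) / (1 - z)) = (1 + X) * PowerSeries.mk 1 := by
  have h1 : EqOn (fun z : ℂ => (1 - z) * ((1 + z) / (1 - z))) (fun z => 1 + z) (ball 0 1) :=
    fun z hz => mul_div_cancel₀ _ (one_sub_ne_zero_of_mem_ball hz)
  have h2 := taylor_congr h1
  rw [taylor_mul (by fun_prop) differentiableOn_cayley] at h2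
  have e1 := taylor_eval (1 - Polynomial.X)
  have e2 := taylor_eval (1 + Polynomial.X)
  simp only [Polynomial.eval_sub, Polynomial.eval_add, Polynomial.eval_one, Polynomial.eval_X,
    Polynomial.coe_sub, Polynomial.coe_add, Polynomial.coe_one, Polynomial.coe_X] at e1 e2
  rw [e1, e2] at h2
  calc _ = PowerSeries.mk 1 * (1 - X) * taylor (fun z => (1 + z) / (1 - z)) := by
        rw [mk_one_mul_one_sub_eq_one ℂ, one_mul]
    _ = PowerSeries.mk 1 * ((1 - X) * taylor (fun z => (1 + z) / (1 - z))) := by ring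
    _ = _ := by rw [h2, mul_comm]

open PowerSeries in
theorem coeff_taylor_cayley (n : ℕ) :
    (taylor fun z => (1 + z) / (1 - z)).coeff n = if n = 0 then 1 else 2 := by
  rw [taylor_cayley, add_mul, one_mul]
  rcases n with _ | n
  · simp
  · rw [map_add, coeff_succ_X_mul]
    norm_num

open PowerSeries in
/-- The derivative of `u ^ α`, for `u = (1 + z) / (1 - z)`, is `2 α κ u` with `κ` the function
`(1 - z) ^ (-2) u ^ (α - 2)`, and `u` has the coefficients `1, 2, 2, …`. -/
theorem coeff_taylor_cayley_cpow {α : ℝ} {k : ℕ → ℝ} (hk : ∀ n, (taylor fun z : ℂ =>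
      ((1 - z) ^ 2)⁻¹ * ((1 + z) / (1 - z)) ^ ((α : ℂ) - 2)).coeff n = k n) (n : ℕ) :
    (taylor fun z : ℂ => ((1 + z) / (1 - z)) ^ (α : ℂ)).coeff (n + 1) * (n + 1) =
      2 * α * ∑ x ∈ Finset.HasAntidiagonal.antidiagonal n, k x.1 * if x.2 = 0 then 1 else 2 := by
  have h1 : EqOn (deriv fun z : ℂ => ((1 + z) / (1 - z)) ^ (α : ℂ))
      (fun z => 2 * α * ((((1 - z) ^ 2)⁻¹ * ((1 + z) / (1 - z)) ^ ((α : ℂ) - 2)) *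
        ((1 + z) / (1 - z)))) (ball 0 1) := by
    intro z hz
    have hu : (1 + z) / (1 - z) ≠ 0 := slitPlane_ne_zero (cayley_mem_slitPlane hz)
    have h2 : ((1 + z) / (1 - z)) ^ ((α : ℂ) - 1) =
        ((1 + z) / (1 - z)) ^ ((α : ℂ) - 2) * ((1 + z) / (1 - z)) := by
      rw [show (α : ℂ) - 1 = (α - 2) + 1 by ring, cpow_add _ _ hu, cpow_one]
    simp only []
    rw [(hasDerivAt_cayley_cpow hz α).deriv, h2]
    ring
  have h2 := taylor_congr h1
  have hκ := differentiableOn_inv_one_sub_sq_mul_cayley_cpow ((α : ℂ) - 2)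
  rw [taylor_deriv, taylor_const_mul (hκ.fun_mul differentiableOn_cayley),
    taylor_mul hκ differentiableOn_cayley] at h2
  have h3 := congrArg (coeff n) h2
  rw [coeff_derivative, coeff_C_mul, coeff_mul] at h3
  simp only [hk, coeff_taylor_cayley] at h3
  rw [h3]
  push_cast
  simp only [apply_ite (ofReal), ofReal_one, ofReal_ofNat]

theorem A_eq_re_coeff_taylor (α : ℝ) (n : ℕ) :
    A α n = ((taylor fun z : ℂ => ((1 + z) / (1 - z)) ^ (α : ℂ)).coeff n).re := by
  simp [A, taylor]

theorem ofReal_A {α : ℝ} (hα : 1 ≤ α) (n : ℕ) :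
    (A α n : ℂ) = (taylor fun z : ℂ => ((1 + z) / (1 - z)) ^ (α : ℂ)).coeff n := by
  rw [A_eq_re_coeff_taylor]
  suffices ∃ x : ℝ, (taylor fun z : ℂ => ((1 + z) / (1 - z)) ^ (α : ℂ)).coeff n = x by
    obtain ⟨x, hx⟩ := this
    rw [hx, ofReal_re]
  rcases n with _ | n
  · exact ⟨1, by rw [coeff_zero_taylor]; simp⟩
  · choose k hk0 hk using exists_coeff_taylor_eq_ofReal hα
    have h1 := coeff_taylor_cayley_cpow hk n
    have hn : (n : ℂ) + 1 ≠ 0 := by exact_mod_cast n.succ_ne_zero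
    refine ⟨2 * α * (∑ x ∈ Finset.HasAntidiagonal.antidiagonal n,
      k x.1 * if x.2 = 0 then 1 else 2) / (n + 1), ?_⟩
    rw [← eq_div_iff hn] at h1
    rw [h1]
    push_cast
    simp only [apply_ite (ofReal), ofReal_one, ofReal_ofNat]

theorem A_succ_mul {α : ℝ} (hα : 1 ≤ α) {k : ℕ → ℝ} (hk : ∀ n, (taylor fun z : ℂ =>
      ((1 - z) ^ 2)⁻¹ * ((1 + z) / (1 - z)) ^ ((α : ℂ) - 2)).coeff n = k n) (n : ℕ) :
    A α (n + 1) * (n + 1) =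
      2 * α * ∑ x ∈ Finset.HasAntidiagonal.antidiagonal n, k x.1 * if x.2 = 0 then 1 else 2 := by
  have h1 := coeff_taylor_cayley_cpow hk n
  rw [← ofReal_A hα] at h1
  exact_mod_cast h1

theorem A_nonneg {α : ℝ} (hα : 1 ≤ α) (n : ℕ) : 0 ≤ A α (n + 1) := by
  choose k hk0 hk using exists_coeff_taylor_eq_ofReal hα
  have h1 := A_succ_mul hα hk n
  have h2 : 0 ≤ A α (n + 1) * (n + 1) := by
    rw [h1]
    refine mul_nonneg (by positivity) (Finset.sum_nonneg fun x _ => mul_nonneg (hk0 _) ?_)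
    split_ifs <;> norm_num
  exact nonneg_of_mul_nonneg_left h2 (by positivity)

/-- The coefficient bound for `CO α`: the derivative is the product of a function with nonnegative
coefficients and a function with positive real part (after a rotation) and value `1` at the
origin. -/
theorem IsCO.norm_coeff_taylor_le {α : ℝ} {f : ℂ → ℂ} (hf : IsCO α f) (hα : 1 < α) (hα2 : α ≤ 2)
    (n : ℕ) : ‖(taylor f).coeff (n + 1)‖ ≤ 1 / (2 * α) * A α (n + 1) := by
  obtain ⟨ω, hω⟩ := hf.exists_re_exp_mul_nonneg hα hα2
  choose k hk0 hk using exists_coeff_taylor_eq_ofReal hα.le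
  set W : ℂ → ℂ := fun z => (1 - z) ^ 2 * deriv f z * ((1 + z) / (1 - z)) ^ ((2 - α : ℝ) : ℂ)
  have hW : DifferentiableOn ℂ W (ball 0 1) :=
    (DifferentiableOn.mul (by fun_prop) hf.deriv_analytic).mul (differentiableOn_cayley_cpow _)
  have hW0 : W 0 = 1 := by simp [W, hf.deriv_zero]
  have hWn : ∀ j, ‖(taylor W).coeff j‖ ≤ if j = 0 then 1 else 2 := by
    intro j
    split_ifs with hj
    · rw [hj, coeff_zero_taylor, hW0, norm_one]
    · have h1 := norm_coeff_taylor_le_two_mul_re (hW.const_mul (exp (-(ω * I)))) hω hj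
      have h2 : ‖exp (-((ω : ℂ) * I))‖ = 1 := by
        rw [show -((ω : ℂ) * I) = ((-ω : ℝ) : ℂ) * I by push_cast; ring, norm_exp_ofReal_mul_I]
      have h3 := re_le_norm (exp (-((ω : ℂ) * I)) * W 0)
      rw [hW0, mul_one, h2] at h3
      rw [taylor_const_mul hW, PowerSeries.coeff_C_mul, norm_mul, h2, one_mul, hW0, mul_one] at h1
      linarith
  have hprod : EqOn (deriv f) (fun z => ((1 - z) ^ 2)⁻¹ * ((1 + z) / (1 - z)) ^ ((α : ℂ) - 2) * W z)
      (ball 0 1) := by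
    intro z hz
    have h1 := one_sub_ne_zero_of_mem_ball hz
    have hu : (1 + z) / (1 - z) ≠ 0 := slitPlane_ne_zero (cayley_mem_slitPlane hz)
    have h2 : ((1 + z) / (1 - z)) ^ ((α : ℂ) - 2) *
        ((1 + z) / (1 - z)) ^ ((2 - α : ℝ) : ℂ) = 1 := by
      rw [← cpow_add _ _ hu]
      push_cast
      simp
    simp only [W]
    calc deriv f z = ((1 - z) ^ 2)⁻¹ * (1 - z) ^ 2 * deriv f z *
          (((1 + z) / (1 - z)) ^ ((α : ℂ) - 2) * ((1 + z) / (1 - z)) ^ ((2 - α : ℝ) : ℂ)) := by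
          rw [h2, inv_mul_cancel₀ (pow_ne_zero 2 h1)]; ring
      _ = _ := by ring
  have hT := congrArg (PowerSeries.coeff n) (taylor_congr hprod)
  rw [taylor_deriv, taylor_mul (differentiableOn_inv_one_sub_sq_mul_cayley_cpow _) hW,
    PowerSeries.coeff_derivative, PowerSeries.coeff_mul] at hT
  have h1 : ‖(taylor f).coeff (n + 1)‖ * (n + 1) ≤
      ∑ x ∈ Finset.HasAntidiagonal.antidiagonal n, k x.1 * if x.2 = 0 then 1 else 2 := by
    have h2 : ‖((n : ℂ) + 1)‖ = n + 1 := by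
      rw [show (n : ℂ) + 1 = ((n + 1 : ℝ) : ℂ) by push_cast; ring, norm_real,
        Real.norm_of_nonneg (by positivity)]
    rw [← h2, ← norm_mul, hT]
    refine (norm_sum_le _ _).trans (Finset.sum_le_sum fun x _ => ?_)
    rw [norm_mul, hk, norm_real, Real.norm_of_nonneg (hk0 _)]
    exact mul_le_mul_of_nonneg_left (hWn _) (hk0 _)
  have h2 := A_succ_mul hα.le hk n
  have h3 : 0 < α := by linarith
  refine le_of_mul_le_mul_right (h1.trans_eq ?_) (by positivity : (0 : ℝ) < n + 1)
  rw [mul_assoc, h2]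
  field_simp

/-! ### Concave functions in the half-plane -/

/-- The function `f` transplanted to the right half-plane by the Cayley transform
`u = (1 + z) / (1 - z)`; the boundary point `1` of the disk goes to infinity. -/
noncomputable def halfPlaneMap (f : ℂ → ℂ) (u : ℂ) : ℂ := f ((u - 1) / (u + 1))

theorem add_one_ne_zero_of_re_pos {u : ℂ} (hu : 0 < u.re) : u + 1 ≠ 0 := by
  simpa using add_conj_ne_zero hu (b := 1) (by simp)

theorem inv_cayley_mem_ball {u : ℂ} (hu : 0 < u.re) : (u - 1) / (u + 1) ∈ ball (0 : ℂ) 1 := by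
  rw [mem_ball_zero_iff, norm_div, div_lt_one (norm_pos_iff.2 (add_one_ne_zero_of_re_pos hu))]
  simpa using norm_sub_lt_norm_add_conj hu (b := 1) (by simp)

theorem one_sub_inv_cayley {u : ℂ} (hu : 0 < u.re) : 1 - (u - 1) / (u + 1) = 2 / (u + 1) := by
  have := add_one_ne_zero_of_re_pos hu
  field_simp
  ring

theorem inv_cayley_cayley {z : ℂ} (hz : z ∈ ball (0 : ℂ) 1) :
    ((1 + z) / (1 - z) - 1) / ((1 + z) / (1 - z) + 1) = z := by
  have h1 := one_sub_ne_zero_of_mem_ball hz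
  have h2 : (1 + z) / (1 - z) + 1 = 2 / (1 - z) := by field_simp; ring
  have h3 : (1 + z) / (1 - z) - 1 = 2 * z / (1 - z) := by field_simp; ring
  rw [h2, h3]
  field_simp

theorem isOpen_re_pos : IsOpen {u : ℂ | 0 < u.re} := isOpen_lt continuous_const continuous_re

theorem re_cpow_half_pos {w : ℂ} (hw : w ∈ slitPlane) : 0 < (w ^ (2⁻¹ : ℂ)).re := by
  have hpi := Real.pi_pos
  have h0 := slitPlane_ne_zero hw
  have harg : |arg w| < Real.pi := by
    refine lt_of_le_of_ne (abs_arg_le_pi w) fun h => ?_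
    rcases (abs_eq hpi.le).1 h with h | h
    · exact (mem_slitPlane_iff_arg.1 hw).1 h
    · exact absurd h (neg_pi_lt_arg w).ne'
  rw [abs_lt] at harg
  rw [cpow_def_of_ne_zero h0, exp_re]
  refine mul_pos (Real.exp_pos _) (Real.cos_pos_of_mem_Ioo ?_)
  have : (Complex.log w * 2⁻¹).im = arg w / 2 := by
    rw [show (2⁻¹ : ℂ) = ((2⁻¹ : ℝ) : ℂ) by push_cast; rfl, im_mul_ofReal, log_im]
    ring
  rw [this]
  constructor <;> linarith

theorem cpow_half_sq (w : ℂ) : (w ^ (2⁻¹ : ℂ)) ^ 2 = w := by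
  simp

/-- An ultrafilter on the plane converges or tends to infinity. -/
theorem le_cocompact_or_exists_le_nhds (m : Ultrafilter ℂ) :
    (m : Filter ℂ) ≤ cocompact ℂ ∨ ∃ x, (m : Filter ℂ) ≤ 𝓝 x := by
  by_cases h : (m : Filter ℂ) ≤ cocompact ℂ
  · exact Or.inl h
  right
  obtain ⟨s, hs, hsm⟩ := Filter.not_le.1 h
  obtain ⟨t, ht, hts⟩ := mem_cocompact.1 hs
  have htm : t ∈ m := by
    by_contra htm
    exact hsm (mem_of_superset (Ultrafilter.compl_mem_iff_notMem.2 htm) hts)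
  obtain ⟨x, -, hx⟩ := isCompact_iff_ultrafilter_le_nhds.1 ht m (le_principal_iff.2 htm)
  exact ⟨x, hx⟩

/-- The minimum principle in terms of ultrafilters that leave all compact subsets of `U`: such an
ultrafilter tends to infinity or to a point outside `U`. -/
theorem re_nonneg_of_ultrafilter {U : Set ℂ} (hU : IsOpen U) {φ : ℂ → ℂ}
    (hφ : DifferentiableOn ℂ φ U)
    (hinf : ∀ ε > 0, ∀ m : Ultrafilter ℂ, U ∈ m → (m : Filter ℂ) ≤ cocompact ℂ →
      ∀ᶠ z in m, -ε ≤ (φ z).re)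
    (hbd : ∀ ε > 0, ∀ m : Ultrafilter ℂ, U ∈ m → ∀ x ∉ U, (m : Filter ℂ) ≤ 𝓝 x →
      ∀ᶠ z in m, -ε ≤ (φ z).re) :
    ∀ z ∈ U, 0 ≤ (φ z).re := by
  refine re_nonneg_of_forall_exists_isCompact hU hφ fun ε hε => ?_
  have := hU.locallyCompactSpace
  have key : ∀ᶠ z : U in cocompact U, -ε ≤ (φ z).re := by
    refine mem_iff_ultrafilter.2 fun m hm => ?_
    set M : Ultrafilter ℂ := m.map Subtype.val
    have hUM : U ∈ M := by
      rw [Ultrafilter.mem_map]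
      filter_upwards with z using z.2
    suffices ∀ᶠ z in M, -ε ≤ (φ z).re from this
    rcases le_cocompact_or_exists_le_nhds M with h | ⟨x, hx⟩
    · exact hinf ε hε M hUM h
    · refine hbd ε hε M hUM x (fun hxU => ?_) hx
      have h1 : (m : Filter U) ≤ 𝓝 ⟨x, hxU⟩ := by
        rw [nhds_subtype_eq_comap]
        exact map_le_iff_le_comap.1 hx
      have h2 := (disjoint_nhds_cocompact (⟨x, hxU⟩ : U)).mono h1 hm
      exact m.neBot.ne (disjoint_self.1 h2)
  obtain ⟨t, ht, hts⟩ := mem_cocompact.1 key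
  refine ⟨Subtype.val '' t, by rintro _ ⟨z, -, rfl⟩; exact z.2, ht.image continuous_subtype_val, ?_⟩
  rintro z ⟨hz, hzt⟩
  exact hts (a := ⟨z, hz⟩) fun h => hzt ⟨⟨z, hz⟩, h, rfl⟩

namespace IsCO

variable {α : ℝ} {f : ℂ → ℂ}

theorem hasDerivAt_halfPlaneMap (hf : IsCO α f) {u : ℂ} (hu : 0 < u.re) :
    HasDerivAt (halfPlaneMap f)
      ((1 - (u - 1) / (u + 1)) ^ 2 * deriv f ((u - 1) / (u + 1)) / 2) u := by
  have h0 := add_one_ne_zero_of_re_pos hu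
  have h1 : HasDerivAt (fun u : ℂ => (u - 1) / (u + 1)) (2 / (u + 1) ^ 2) u := by
    refine (((hasDerivAt_id u).sub_const 1).div ((hasDerivAt_id u).add_const 1) h0).congr_deriv ?_
    simp only [id]
    ring
  refine ((hf.hasDerivAt (inv_cayley_mem_ball hu)).comp u h1).congr_deriv ?_
  rw [one_sub_inv_cayley hu]
  field_simp

theorem differentiableOn_halfPlaneMap (hf : IsCO α f) :
    DifferentiableOn ℂ (halfPlaneMap f) {u | 0 < u.re} := fun _ hu =>
  (hf.hasDerivAt_halfPlaneMap hu).differentiableAt.differentiableWithinAt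

theorem deriv_halfPlaneMap (hf : IsCO α f) {u : ℂ} (hu : 0 < u.re) :
    deriv (halfPlaneMap f) u =
      (1 - (u - 1) / (u + 1)) ^ 2 * deriv f ((u - 1) / (u + 1)) / 2 :=
  (hf.hasDerivAt_halfPlaneMap hu).deriv

theorem differentiableOn_deriv_halfPlaneMap (hf : IsCO α f) :
    DifferentiableOn ℂ (deriv (halfPlaneMap f)) {u | 0 < u.re} :=
  hf.differentiableOn_halfPlaneMap.deriv isOpen_re_pos

theorem deriv_halfPlaneMap_ne_zero (hf : IsCO α f) {u : ℂ} (hu : 0 < u.re) :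
    deriv (halfPlaneMap f) u ≠ 0 := by
  have hz := inv_cayley_mem_ball hu
  rw [hf.deriv_halfPlaneMap hu]
  exact div_ne_zero (mul_ne_zero (pow_ne_zero 2 (one_sub_ne_zero_of_mem_ball hz))
    (hf.deriv_ne_zero hz)) two_ne_zero

theorem halfPlaneMap_mem (u : ℂ) (hu : 0 < u.re) : halfPlaneMap f u ∈ f '' ball 0 1 :=
  ⟨_, inv_cayley_mem_ball hu, rfl⟩

theorem exists_inverse_halfPlaneMap (hf : IsCO α f) :
    ∃ g : ℂ → ℂ, DifferentiableOn ℂ g (f '' ball 0 1) ∧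
      (∀ u : ℂ, 0 < u.re → g (halfPlaneMap f u) = u) ∧ ∀ w ∈ f '' ball 0 1, 0 < (g w).re := by
  obtain ⟨-, -, g, hg, hgf⟩ := exists_holomorphic_inverse hf.analytic hf.univalent
  have hgm : ∀ w ∈ f '' ball 0 1, g w ∈ ball (0 : ℂ) 1 := by
    rintro _ ⟨z, hz, rfl⟩
    rwa [hgf z hz]
  refine ⟨fun w => (1 + g w) / (1 - g w), ?_, fun u hu => ?_, fun w hw => re_cayley_pos (hgm w hw)⟩
  · exact (hg.const_add 1).fun_div (hg.const_sub 1)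
      fun w hw => one_sub_ne_zero_of_mem_ball (hgm w hw)
  · have h0 := add_one_ne_zero_of_re_pos hu
    simp only [halfPlaneMap]
    rw [hgf _ (inv_cayley_mem_ball hu), one_sub_inv_cayley hu]
    field_simp
    ring

theorem re_sub_div_deriv_nonneg (hf : IsCO α f) {k : ℂ} (hk : k ∈ (f '' ball 0 1)ᶜ) {u : ℂ}
    (hu : 0 < u.re) : 0 ≤ ((halfPlaneMap f u - k) / deriv (halfPlaneMap f) u).re := by
  have h1 := hf.re_div_nonneg hk (inv_cayley_mem_ball hu)
  rw [hf.deriv_halfPlaneMap hu, div_div_eq_mul_div, mul_comm, mul_div_assoc]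
  have h2 := mul_nonneg zero_le_two h1
  rwa [← re_ofReal_mul, ofReal_ofNat] at h2

/-- The distance from a value to the omitted set is at least a quarter of the conformal radius
`2 * Re u * |F' u|` (Koebe's theorem, which is elementary for these functions): with a direction of
recession `d` the function `((F - k) / (-d)) ^ (1 / 2)` maps into the half-plane. -/
theorem re_mul_norm_deriv_le (hf : IsCO α f) {k : ℂ} (hk : k ∈ (f '' ball 0 1)ᶜ) {u : ℂ}
    (hu : 0 < u.re) : u.re * ‖deriv (halfPlaneMap f) u‖ ≤ 2 * ‖halfPlaneMap f u - k‖ := by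
  obtain ⟨d, hd1, hd⟩ := hf.exists_isRecession
  have hd0 : d ≠ 0 := fun h => by simp [h] at hd1
  set F := halfPlaneMap f with hF
  have hslit : ∀ v : ℂ, 0 < v.re → (F v - k) / (-d) ∈ slitPlane := by
    intro v hv
    by_contra hns
    obtain ⟨t, ht, hte⟩ : ∃ t : ℝ, 0 ≤ t ∧ (F v - k) / (-d) = -(t : ℂ) := by
      rw [mem_slitPlane_iff, not_or, not_lt, not_not] at hns
      refine ⟨-((F v - k) / (-d)).re, by linarith [hns.1], ?_⟩
      apply Complex.ext <;> simp [hns.2]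
    refine hd k hk t ht ?_
    have : k + t * d = F v := by
      rw [div_eq_iff (neg_ne_zero.2 hd0)] at hte
      linear_combination -hte
    rw [this]
    exact halfPlaneMap_mem v hv
  set S : ℂ → ℂ := fun v => ((F v - k) / (-d)) ^ (2⁻¹ : ℂ)
  have hS : ∀ v : ℂ, 0 < v.re →
      HasDerivAt S (S v * deriv F v / (2 * (F v - k))) v := by
    intro v hv
    have h1 := hslit v hv
    have h2 := slitPlane_ne_zero h1
    have h3 : F v - k ≠ 0 := fun h => h2 (by rw [h, zero_div])
    have h4 := hf.hasDerivAt_halfPlaneMap hv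
    rw [← hf.deriv_halfPlaneMap hv, ← hF] at h4
    refine (((h4.sub_const k).div_const (-d)).cpow_const (c := (2⁻¹ : ℂ)) h1).congr_deriv ?_
    rw [cpow_sub _ _ h2, cpow_one]
    simp only [S]
    field_simp
  have h1 := norm_deriv_mul_re_le (p := S)
    (fun v hv => (hS v hv).differentiableAt.differentiableWithinAt)
    (fun v hv => re_cpow_half_pos (hslit v hv)) hu
  have hS0 : 0 < ‖S u‖ := lt_of_lt_of_le (re_cpow_half_pos (hslit u hu)) (re_le_norm _)
  have h3 : 0 < ‖F u - k‖ := by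
    rw [norm_pos_iff]
    exact fun h => slitPlane_ne_zero (hslit u hu) (by rw [h, zero_div])
  rw [(hS u hu).deriv, norm_div, norm_mul, norm_mul, Complex.norm_two] at h1
  have h2 := h1.trans (re_le_norm (S u))
  have h4 : ‖S u‖ * ‖deriv F u‖ / (2 * ‖F u - k‖) * u.re =
      ‖S u‖ * (u.re * ‖deriv F u‖ / (2 * ‖F u - k‖)) := by ring
  rw [h4] at h2
  have h5 : u.re * ‖deriv F u‖ / (2 * ‖F u - k‖) ≤ 1 := by
    refine le_of_mul_le_mul_left ?_ hS0
    rwa [mul_one]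
  rwa [div_le_one (by positivity)] at h5

/-- A lower bound for the distance of two values, from the Schwarz lemma for the inverse function
in a disk free of omitted values. -/
theorem norm_sub_mul_le (hf : IsCO α f) {u v : ℂ} (hu : 0 < u.re) (hv : 0 < v.re) :
    ‖v - u‖ * (u.re * ‖deriv (halfPlaneMap f) u‖) ≤
      2 * ‖v + conj u‖ * ‖halfPlaneMap f v - halfPlaneMap f u‖ := by
  obtain ⟨g, hg, hgF, hgm⟩ := hf.exists_inverse_halfPlaneMap
  set F := halfPlaneMap f
  set R := u.re * ‖deriv F u‖ / 2 with hR
  have hR0 : 0 ≤ R := by positivity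
  have hball : ball (F u) R ⊆ f '' ball 0 1 := by
    intro w hw
    by_contra hwK
    have h1 := hf.re_mul_norm_deriv_le hwK hu
    rw [mem_ball, dist_eq_norm, norm_sub_rev] at hw
    linarith
  have key : ‖v - u‖ * R ≤ ‖v + conj u‖ * ‖F v - F u‖ := by
    by_cases hvb : F v ∈ ball (F u) R
    · have := schwarz_ball_halfPlane (hg.mono hball) (fun w hw => hgm w (hball hw)) hvb
      rwa [hgF u hu, hgF v hv] at this
    · rw [mem_ball, dist_eq_norm, not_lt] at hvb
      exact mul_le_mul (norm_sub_lt_norm_add_conj hv hu).le hvb hR0 (norm_nonneg _)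
  rw [hR] at key
  linarith

end IsCO

/-! ### The logarithmic derivative of `F'` in the half-plane -/

theorem re_div_nonneg_comm {a b : ℂ} (h : 0 ≤ (a / b).re) : 0 ≤ (b / a).re := by
  rw [← inv_div, inv_re]
  exact div_nonneg h (normSq_nonneg _)

theorem norm_le_two_mul_sq_re_cpow_half {w : ℂ} (hw : 0 ≤ w.re) :
    ‖w‖ ≤ 2 * (w ^ (2⁻¹ : ℂ)).re ^ 2 := by
  have h1 := congrArg re (cpow_half_sq w)
  have h2 := congrArg norm (cpow_half_sq w)
  rw [norm_pow, Complex.sq_norm, normSq_apply] at h2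
  rw [sq, mul_re] at h1
  nlinarith

namespace IsCO

variable {α : ℝ} {f : ℂ → ℂ}

theorem halfPlaneMap_sub_ne_zero (hf : IsCO α f) {u v : ℂ} (hu : 0 < u.re) (hv : 0 < v.re)
    (huv : u ≠ v) : halfPlaneMap f u - halfPlaneMap f v ≠ 0 := by
  obtain ⟨g, -, hgF, -⟩ := hf.exists_inverse_halfPlaneMap
  intro h
  refine huv ?_
  rw [← hgF u hu, ← hgF v hv, sub_eq_zero.1 h]

/-- The finite version of convexity of the images of vertical lines: translating by `δ`, which
points out of the half-plane `Re u > 0`, one compares values on two vertical lines. As the shifted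
point approaches the boundary, its value approaches the omitted set or infinity, and the claim
becomes the differential inequality of `re_sub_div_deriv_nonneg`; the square root is a barrier at
infinity. -/
theorem re_deriv_div_sub_nonneg (hf : IsCO α f) {δ : ℂ} (hδ : δ.re < 0) {u : ℂ}
    (hu : -δ.re < u.re) :
    0 ≤ (deriv (halfPlaneMap f) u / (halfPlaneMap f u - halfPlaneMap f (u + δ))).re := by
  set F := halfPlaneMap f
  set h := -δ.re with hh
  have hh0 : 0 < h := by linarith
  have hδ0 : δ ≠ 0 := fun h0 => by simp [h0] at hδ
  set U : Set ℂ := {u | h < u.re} with hU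
  have hUo : IsOpen U := isOpen_lt continuous_const continuous_re
  have hUpos : ∀ v ∈ U, 0 < v.re := fun v hv => hh0.trans hv
  have hUshift : ∀ v ∈ U, 0 < (v + δ).re := fun v (hv : h < v.re) => by
    rw [add_re]; linarith
  have hne : ∀ v ∈ U, F v - F (v + δ) ≠ 0 := fun v hv =>
    hf.halfPlaneMap_sub_ne_zero (hUpos v hv) (hUshift v hv) (by simpa using hδ0)
  set g : ℂ → ℂ := fun v => deriv F v / (F v - F (v + δ)) with hg
  have hgd : DifferentiableOn ℂ g U := by
    refine (hf.differentiableOn_deriv_halfPlaneMap.mono hUpos).fun_div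
      ((hf.differentiableOn_halfPlaneMap.mono hUpos).fun_sub ?_) hne
    exact DifferentiableOn.comp (g := F) (f := fun v => v + δ) (t := {u : ℂ | 0 < u.re})
      hf.differentiableOn_halfPlaneMap (by fun_prop) hUshift
  have hbound : ∀ v ∈ U, ‖g v‖ ≤ 6 / h := by
    intro v hv
    have hvh : h < v.re := hv
    have hv0 := hUpos v hv
    have h1 := hf.norm_sub_mul_le hv0 (hUshift v hv)
    rw [add_sub_cancel_left] at h1
    have h2 : ‖v + δ + conj v‖ ≤ 2 * v.re + ‖δ‖ := by
      have : v + δ + conj v = ((2 * v.re : ℝ) : ℂ) + δ := by rw [← add_conj]; ring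
      rw [this]
      refine (norm_add_le _ _).trans ?_
      rw [norm_real, Real.norm_of_nonneg (by linarith)]
    have h3 : h ≤ ‖δ‖ := by
      have := abs_re_le_norm δ
      rwa [abs_of_neg hδ] at this
    have h4 : 0 < ‖F v - F (v + δ)‖ := norm_pos_iff.2 (hne v hv)
    rw [norm_div, div_le_div_iff₀ h4 hh0]
    rw [norm_sub_rev] at h4
    have h5 : ‖δ‖ * (v.re * ‖deriv F v‖) ≤ 2 * (2 * v.re + ‖δ‖) * ‖F (v + δ) - F v‖ :=
      h1.trans (by gcongr)
    rw [norm_sub_rev (F v)]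
    have h6 : (2 * (2 * v.re + ‖δ‖)) * h ≤ 6 * (‖δ‖ * v.re) := by nlinarith
    have h7 : 0 < ‖δ‖ * v.re := mul_pos (hh0.trans_le h3) hv0
    refine le_of_mul_le_mul_left ?_ h7
    calc ‖δ‖ * v.re * (‖deriv F v‖ * h) = ‖δ‖ * (v.re * ‖deriv F v‖) * h := by ring
      _ ≤ 2 * (2 * v.re + ‖δ‖) * ‖F (v + δ) - F v‖ * h := by gcongr
      _ = 2 * (2 * v.re + ‖δ‖) * h * ‖F (v + δ) - F v‖ := by ring
      _ ≤ 6 * (‖δ‖ * v.re) * ‖F (v + δ) - F v‖ := by gcongr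
      _ = _ := by ring
  -- the barrier: its real part is positive and tends to infinity at infinity
  set b : ℂ → ℂ := fun v => (v - h + 1) ^ (2⁻¹ : ℂ) with hb
  have hbre : ∀ v ∈ U, 0 < (v - h + 1).re := fun v (hv : h < v.re) => by
    simp only [add_re, sub_re, ofReal_re, one_re]
    linarith
  have hbpos : ∀ v ∈ U, 0 < (b v).re := fun v hv => re_cpow_half_pos (Or.inl (hbre v hv))
  have hbd : DifferentiableOn ℂ b U := by
    intro v hv
    have h1 : DifferentiableAt ℂ (fun v : ℂ => v - h + 1) v := by fun_prop
    exact ((h1.hasDerivAt.cpow_const (c := (2⁻¹ : ℂ))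
      (Or.inl (hbre v hv))).differentiableAt).differentiableWithinAt
  have key : ∀ η : ℝ, 0 < η → 0 ≤ (g u + η * b u).re := by
    intro η hη
    refine re_nonneg_of_ultrafilter hUo (φ := fun v => g v + η * b v)
      (hgd.add (hbd.const_mul _)) (fun ε hε m hUm hm => ?_) (fun ε hε m hUm x hxU hm => ?_) u hu
    · set M := 6 / h / η
      have hM : 0 < M := by positivity
      filter_upwards [hUm, hm ((tendsto_norm_cocompact_atTop (E := ℂ)).eventually_ge_atTop
        (2 * M ^ 2 + ‖(1 - h : ℂ)‖))] with v hv hvn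
      have h1 := norm_le_two_mul_sq_re_cpow_half (hbre v hv).le
      have h2 : ‖v‖ ≤ ‖v - h + 1‖ + ‖(1 - h : ℂ)‖ := by
        have := norm_sub_le (v - h + 1) (1 - h : ℂ)
        rwa [show v - h + 1 - (1 - h) = v by ring] at this
      have h3 : M ^ 2 ≤ (b v).re ^ 2 := by
        change _ ≤ ((v - h + 1) ^ (2⁻¹ : ℂ)).re ^ 2
        linarith
      have h4 : M ≤ (b v).re := le_of_sq_le_sq h3 (hbpos v hv).le
      have h5 : 6 / h ≤ η * (b v).re := by
        rwa [div_le_iff₀' hη] at h4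
      have h6 := (abs_le.1 ((abs_re_le_norm (g v)).trans (hbound v hv))).1
      rw [add_re, re_ofReal_mul]
      linarith
    · suffices ∀ᶠ v in m, -ε ≤ (g v).re by
        filter_upwards [this, hUm] with v hv hvU
        rw [add_re, re_ofReal_mul]
        have := mul_pos hη (hbpos v hvU)
        linarith
      have hxh : x.re = h := by
        refine le_antisymm (not_lt.1 hxU) ?_
        exact ge_of_tendsto ((continuous_re.tendsto x).mono_left hm)
          (by filter_upwards [hUm] with v hv using le_of_lt hv)
      have hx0 : 0 < x.re := hxh ▸ hh0
      have hFx : Tendsto F m (𝓝 (F x)) :=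
        (hf.hasDerivAt_halfPlaneMap hx0).continuousAt.tendsto.mono_left hm
      have hF'x : Tendsto (deriv F) m (𝓝 (deriv F x)) :=
        ((hf.differentiableOn_deriv_halfPlaneMap.differentiableAt
          (isOpen_re_pos.mem_nhds hx0)).continuousAt.tendsto).mono_left hm
      rcases le_cocompact_or_exists_le_nhds (m.map fun v => F (v + δ)) with hc | ⟨k, hk⟩
      · have h1 : Tendsto (fun v => F (v + δ)) m (cocompact ℂ) := hc
        have h2 : Tendsto (fun v => ‖F v - F (v + δ)‖) m atTop := by
          have h3 := (tendsto_norm_cocompact_atTop (E := ℂ)).comp h1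
          refine tendsto_atTop_mono (fun v => ?_) (h3.atTop_add hFx.norm.neg)
          have := norm_sub_norm_le (F (v + δ)) (F v)
          rw [norm_sub_rev] at this
          simp only [Function.comp]
          linarith
        have h4 : Tendsto (fun v => ‖g v‖) m (𝓝 0) := by
          simp only [hg, norm_div]
          exact hF'x.norm.div_atTop h2
        filter_upwards [h4.eventually_le_const hε] with v hv
        exact (abs_le.1 ((abs_re_le_norm (g v)).trans hv)).1
      · have h1 : Tendsto (fun v => F (v + δ)) m (𝓝 k) := hk
        have hkK : k ∈ (f '' ball 0 1)ᶜ := by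
          intro hkΩ
          obtain ⟨G, hG, hGF, hGm⟩ := hf.exists_inverse_halfPlaneMap
          have hΩ := hf.isClosed_compl.isOpen_compl
          rw [compl_compl] at hΩ
          have h2 : Tendsto (fun v => G (F (v + δ))) m (𝓝 (G k)) :=
            (hG.continuousOn.continuousAt (hΩ.mem_nhds hkΩ)).tendsto.comp h1
          have h3 : Tendsto (fun v => v + δ) m (𝓝 (x + δ)) :=
            (tendsto_id.mono_left hm).add_const δ
          have h4 := tendsto_nhds_unique h2 (h3.congr' (by
            filter_upwards [hUm] with v hv using (hGF _ (hUshift v hv)).symm))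
          have h5 := hGm k hkΩ
          rw [h4, add_re, hxh, hh] at h5
          linarith
        have h2 : F x - k ≠ 0 := fun h0 => hkK (by
          rw [← sub_eq_zero.1 h0]; exact halfPlaneMap_mem x hx0)
        have h3 : Tendsto (fun v => (g v).re) m (𝓝 (deriv F x / (F x - k)).re) :=
          (continuous_re.tendsto _).comp (hF'x.div (hFx.sub h1) h2)
        have h4 := re_div_nonneg_comm (hf.re_sub_div_deriv_nonneg hkK hx0)
        filter_upwards [h3.eventually_const_le (u := -ε) (by
          change -ε < (deriv F x / (F x - k)).re
          linarith)] with v hv using hv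
  have hlim : Tendsto (fun η : ℝ => (g u + η * b u).re) (𝓝[>] 0)
      (𝓝 (g u + ((0 : ℝ) : ℂ) * b u).re) := by
    refine tendsto_nhdsWithin_of_tendsto_nhds (Continuous.tendsto (by fun_prop) 0)
  simp only [ofReal_zero, zero_mul, add_zero] at hlim
  refine ge_of_tendsto hlim ?_
  filter_upwards [self_mem_nhdsWithin] with η hη using key η hη

/-- Images of vertical lines under the half-plane map turn to one side only. -/
theorem re_deriv_deriv_div_deriv_nonneg (hf : IsCO α f) {u : ℂ} (hu : 0 < u.re) :
    0 ≤ (deriv (deriv (halfPlaneMap f)) u / deriv (halfPlaneMap f) u).re := by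
  set F := halfPlaneMap f with hF
  have hF' := hf.deriv_halfPlaneMap_ne_zero hu
  have hline : ∀ s : ℝ, 0 < (u + s * I).re := fun s => by simpa using hu
  -- the image of the vertical line through `u` lies on one side of its tangent at `F u`
  set φ : ℝ → ℝ := fun s => ((F (u + s * I) - F u) / deriv F u).re
  have hφle : ∀ s, φ s ≤ 0 := by
    intro s
    have h1 : Tendsto (fun h : ℝ => ((F u - F (u + (s * I - h))) / deriv F u).re) (𝓝[>] 0)
        (𝓝 (((F u - F (u + (s * I - (0 : ℝ)))) / deriv F u).re)) := by
      refine tendsto_nhdsWithin_of_tendsto_nhds ?_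
      refine ((continuous_re.tendsto _).comp (Tendsto.div_const (Tendsto.const_sub _ ?_) _))
      have h2 : ContinuousAt F (u + (s * I - (0 : ℝ))) := by
        simpa using (hf.hasDerivAt_halfPlaneMap (hline s)).continuousAt
      have h3 : ContinuousAt (fun h : ℝ => u + (s * I - (h : ℂ))) 0 := by fun_prop
      exact h2.tendsto.comp h3.tendsto
    have h2 := ge_of_tendsto h1 (by
      filter_upwards [Ioo_mem_nhdsGT hu] with h hh
      exact re_div_nonneg_comm (hf.re_deriv_div_sub_nonneg (δ := s * I - h) (by simpa using hh.1)
        (by simpa using hh.2)))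
    rw [ofReal_zero, sub_zero, ← neg_sub, neg_div, neg_re] at h2
    simpa using h2
  have hcomp : ∀ {P : ℂ → ℂ} {P' : ℂ} {s : ℝ}, HasDerivAt P P' (u + s * I) →
      HasDerivAt (fun s : ℝ => (P (u + s * I) / deriv F u).re) (P' * I / deriv F u).re s := by
    intro P P' s hP
    have h1 : HasDerivAt (fun w : ℂ => u + w * I) I (s : ℂ) := by
      simpa using ((hasDerivAt_id (s : ℂ)).mul_const I).const_add u
    have h2 := ((HasDerivAt.comp (s : ℂ) hP h1).div_const (deriv F u)).comp_ofReal
    exact reCLM.hasFDerivAt.comp_hasDerivAt s h2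
  have hd1 : ∀ s : ℝ, HasDerivAt φ (deriv F (u + s * I) * I / deriv F u).re s := by
    intro s
    have h1 := hf.hasDerivAt_halfPlaneMap (hline s)
    rw [← hf.deriv_halfPlaneMap (hline s), ← hF] at h1
    exact hcomp (P := fun w => F w - F u) (h1.sub_const _)
  have hd1' : deriv φ = fun s : ℝ => ((deriv F (u + s * I) * I) / deriv F u).re :=
    funext fun s => (hd1 s).deriv
  have hd2 : HasDerivAt (deriv φ) (-(deriv (deriv F) u / deriv F u).re) 0 := by
    rw [hd1']
    have h1 : HasDerivAt (deriv F) (deriv (deriv F) u) (u + (0 : ℝ) * I) := by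
      rw [ofReal_zero, zero_mul, add_zero]
      exact (hf.differentiableOn_deriv_halfPlaneMap.differentiableAt
        (isOpen_re_pos.mem_nhds hu)).hasDerivAt
    refine (hcomp (P := fun w => deriv F w * I) (h1.mul_const I)).congr_deriv ?_
    rw [mul_assoc, I_mul_I, mul_neg_one, neg_div, neg_re]
  -- otherwise `0` would be a local minimum as well as a maximum of `φ`
  by_contra! hneg
  have hφ0 : φ 0 = 0 := by simp [φ]
  have hmin := isLocalMin_of_deriv_deriv_pos (f := φ) (x₀ := 0) (by rw [hd2.deriv]; linarith)
    (by
    rw [hd1']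
    simp only [ofReal_zero, zero_mul, add_zero]
    rw [mul_div_cancel_left₀ _ hF', I_re]) (hd1 0).continuousAt
  have hzero : φ =ᶠ[𝓝 0] fun _ => 0 := by
    filter_upwards [hmin] with s hs
    rw [hφ0] at hs
    exact le_antisymm (hφle s) hs
  have h3 := hzero.deriv.deriv_eq
  rw [hd2.deriv] at h3
  simp at h3
  linarith

/-- Schwarz-Pick for `F'`, which a direction of recession turns into the half-plane. -/
theorem norm_deriv_deriv_mul_re_le (hf : IsCO α f) {u : ℂ} (hu : 0 < u.re) :
    ‖deriv (deriv (halfPlaneMap f)) u‖ * u.re ≤ ‖deriv (halfPlaneMap f) u‖ := by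
  obtain ⟨d, hd1, hd⟩ := hf.exists_isRecession
  set F := halfPlaneMap f
  have hpos : ∀ v : ℂ, 0 < v.re → 0 ≤ (-conj d * deriv F v).re := by
    intro v hv
    have h1 := hf.re_nonneg_of_isRecession hd (inv_cayley_mem_ball hv)
    rw [hf.deriv_halfPlaneMap hv, mul_div_assoc', show (2 : ℂ) = ((2 : ℝ) : ℂ) by norm_num,
      div_ofReal_re]
    positivity
  have hdiff := hf.differentiableOn_deriv_halfPlaneMap
  have h1 : ∀ ε : ℝ, 0 < ε →
      ‖deriv (deriv F) u‖ * u.re ≤ (-conj d * deriv F u).re + ε := by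
    intro ε hε
    have h2 := norm_deriv_mul_re_le (p := fun v => -conj d * deriv F v + ε)
      ((hdiff.const_mul _).add_const _) (fun v hv => by
        rw [add_re, ofReal_re]; linarith [hpos v hv]) hu
    have h3 := (hdiff.differentiableAt (isOpen_re_pos.mem_nhds hu)).hasDerivAt
    rw [((h3.const_mul (-conj d)).add_const (ε : ℂ)).deriv, norm_mul, norm_neg,
      RCLike.norm_conj, hd1, one_mul, add_re, ofReal_re] at h2
    exact h2
  refine (le_of_forall_pos_le_add h1).trans ((re_le_norm _).trans ?_)
  rw [norm_mul, norm_neg, RCLike.norm_conj, hd1, one_mul]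

/-- A Julia-type inequality at infinity for `q = F'' / F'`: the two bounds `Re q ≥ 0` and
`|q| ≤ 1 / Re u` together give that `q` lies in the disk with diameter `[0, 1 / Re u]`. -/
theorem re_mul_sq_norm_le (hf : IsCO α f) {u : ℂ} (hu : 0 < u.re) :
    u.re * ‖deriv (deriv (halfPlaneMap f)) u / deriv (halfPlaneMap f) u‖ ^ 2 ≤
      (deriv (deriv (halfPlaneMap f)) u / deriv (halfPlaneMap f) u).re := by
  set F := halfPlaneMap f
  set q : ℂ → ℂ := fun u => deriv (deriv F) u / deriv F u
  change u.re * ‖q u‖ ^ 2 ≤ (q u).re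
  have hq : DifferentiableOn ℂ q {u | 0 < u.re} :=
    (hf.differentiableOn_deriv_halfPlaneMap.deriv isOpen_re_pos).fun_div
      hf.differentiableOn_deriv_halfPlaneMap fun v hv => hf.deriv_halfPlaneMap_ne_zero hv
  have hqre : ∀ v : ℂ, 0 < v.re → 0 ≤ (q v).re := fun v hv => hf.re_deriv_deriv_div_deriv_nonneg hv
  have hqn : ∀ v : ℂ, 0 < v.re → ‖q v‖ * v.re ≤ 1 := by
    intro v hv
    rw [norm_div, div_mul_eq_mul_div,
      div_le_one (norm_pos_iff.2 (hf.deriv_halfPlaneMap_ne_zero hv))]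
    exact hf.norm_deriv_deriv_mul_re_le hv
  -- Schwarz-Pick for `q` between `u` and a large real number `X`
  have h1 : ∀ X : ℝ, 0 < X → ‖q u + conj (q X)‖ ^ 2 * (u.re * X) ≤
      (q u).re * (q X).re * ‖u + X‖ ^ 2 := by
    intro X hX
    have h2 : ∀ ε : ℝ, 0 < ε → ‖q u + ε + conj (q X + ε)‖ ^ 2 * (u.re * X) ≤
        (q u + ε).re * (q X + ε).re * ‖u + X‖ ^ 2 := by
      intro ε hε
      have h3 := schwarzPick_halfPlane (p := fun v => q v + ε) (hq.add_const _) (fun v hv => by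
        rw [add_re, ofReal_re]; linarith [hqre v hv]) hu (v := X) (by simpa using hX)
      have h4 := pow_le_pow_left₀ (by positivity) h3 2
      rw [mul_pow, mul_pow, conj_ofReal] at h4
      have h5 := sq_norm_add_conj (q u + ε) (q X + ε)
      have h6 := sq_norm_add_conj u X
      rw [conj_ofReal, ofReal_re] at h6
      nlinarith
    have h7 : Tendsto (fun ε : ℝ => ‖q u + ε + conj (q X + ε)‖ ^ 2 * (u.re * X)) (𝓝[>] 0)
        (𝓝 (‖q u + (0 : ℝ) + conj (q X + (0 : ℝ))‖ ^ 2 * (u.re * X))) :=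
      tendsto_nhdsWithin_of_tendsto_nhds (Continuous.tendsto (by fun_prop) 0)
    have h8 : Tendsto (fun ε : ℝ => (q u + ε).re * (q X + ε).re * ‖u + X‖ ^ 2) (𝓝[>] 0)
        (𝓝 ((q u + (0 : ℝ)).re * (q X + (0 : ℝ)).re * ‖u + X‖ ^ 2)) :=
      tendsto_nhdsWithin_of_tendsto_nhds (Continuous.tendsto (by fun_prop) 0)
    have h9 := le_of_tendsto_of_tendsto h7 h8 (by
      filter_upwards [self_mem_nhdsWithin] with ε hε using h2 ε hε)
    simpa using h9
  have h2 : ∀ X : ℝ, 0 < X → ‖q u + conj (q X)‖ ^ 2 * u.re ≤ (q u).re * ‖u / X + 1‖ ^ 2 := by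
    intro X hX
    have h3 := h1 X hX
    have h4 : (q X).re * X ≤ 1 := by
      refine le_trans ?_ (hqn X (by simpa using hX))
      rw [ofReal_re]
      exact mul_le_mul_of_nonneg_right (re_le_norm _) hX.le
    have h5 : u + X = X * (u / X + 1) := by
      have : (X : ℂ) ≠ 0 := by exact_mod_cast hX.ne'
      field_simp
    rw [h5, norm_mul, norm_real, Real.norm_of_nonneg hX.le, mul_pow] at h3
    refine le_of_mul_le_mul_right ?_ hX
    calc ‖q u + conj (q X)‖ ^ 2 * u.re * X = ‖q u + conj (q X)‖ ^ 2 * (u.re * X) := by ring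
      _ ≤ (q u).re * (q X).re * (X ^ 2 * ‖u / X + 1‖ ^ 2) := h3
      _ = (q X).re * X * ((q u).re * ‖u / X + 1‖ ^ 2 * X) := by ring
      _ ≤ 1 * ((q u).re * ‖u / X + 1‖ ^ 2 * X) := by
          have := hqre u hu
          gcongr
      _ = _ := one_mul _
  have hqX : Tendsto (fun X : ℝ => q X) atTop (𝓝 0) := by
    refine squeeze_zero_norm' ?_ tendsto_inv_atTop_zero
    filter_upwards [eventually_gt_atTop 0] with X hX
    have := hqn X (by simpa using hX)
    rwa [ofReal_re, ← le_div_iff₀ hX, one_div] at this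
  have huX : Tendsto (fun X : ℝ => u / (X : ℂ)) atTop (𝓝 0) := by
    have h3 : Tendsto (fun X : ℝ => u * ((X⁻¹ : ℝ) : ℂ)) atTop (𝓝 (u * ((0 : ℝ) : ℂ))) :=
      ((continuous_ofReal.tendsto 0).comp tendsto_inv_atTop_zero).const_mul u
    simpa [div_eq_mul_inv] using h3
  have h3 : Tendsto (fun X : ℝ => ‖q u + conj (q X)‖ ^ 2 * u.re) atTop
      (𝓝 (‖q u + conj 0‖ ^ 2 * u.re)) :=
    ((((continuous_conj.tendsto 0).comp hqX).const_add (q u)).norm.pow 2).mul_const _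
  have h4 : Tendsto (fun X : ℝ => (q u).re * ‖u / X + 1‖ ^ 2) atTop
      (𝓝 ((q u).re * ‖(0 : ℂ) + 1‖ ^ 2)) :=
    ((huX.add_const 1).norm.pow 2).const_mul _
  have h5 := le_of_tendsto_of_tendsto h3 h4 (by
    filter_upwards [eventually_gt_atTop 0] with X hX using h2 X hX)
  simpa [mul_comm] using h5

end IsCO

/-! ### The coefficient region for `CO 2` -/

theorem hasDerivAt_normSq_comp {P : ℝ → ℂ} {P' : ℂ} {s : ℝ} (h : HasDerivAt P P' s) :
    HasDerivAt (fun s => normSq (P s)) (2 * (conj (P s) * P').re) s := by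
  have hr : HasDerivAt (fun s => (P s).re) P'.re s := reCLM.hasFDerivAt.comp_hasDerivAt s h
  have hi : HasDerivAt (fun s => (P s).im) P'.im s := imCLM.hasFDerivAt.comp_hasDerivAt s h
  refine ((hr.mul hr).add (hi.mul hi)).congr_deriv ?_
  simp only [mul_re, conj_re, conj_im]
  ring

/-- Jack's lemma: at a point of least modulus where `|w| = 1`, for a holomorphic `w` with
`w 0 = 0`, the quotient `z w' / w` is real and at least `1`. -/
theorem jack {w : ℂ → ℂ} {w' z : ℂ} (hw : DifferentiableOn ℂ w (ball 0 ‖z‖)) (hw0 : w 0 = 0)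
    (hlt : ∀ y : ℂ, ‖y‖ < ‖z‖ → ‖w y‖ ≤ 1) (hle : ∀ y : ℂ, ‖y‖ = ‖z‖ → ‖w y‖ ≤ 1)
    (hz : ‖w z‖ = 1) (hd : HasDerivAt w w' z) :
    1 ≤ (conj (w z) * (z * w')).re ∧ (conj (w z) * (z * w')).im = 0 := by
  have hnz : normSq (w z) = 1 := by rw [normSq_eq_norm_sq, hz]; norm_num
  have hz0 : 0 < ‖z‖ := by
    rw [norm_pos_iff]
    rintro rfl
    rw [hw0, norm_zero] at hz
    exact zero_ne_one hz
  have hm : MapsTo w (ball 0 ‖z‖) (closedBall (w 0) 1) := fun y hy => by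
    rw [hw0, mem_closedBall_zero_iff]
    exact hlt y (by simpa using hy)
  constructor
  · have h1 : HasDerivAt (fun t : ℝ => w (t * z)) (z * w') 1 := by
      have h2 : HasDerivAt (fun t : ℂ => t * z) z ((1 : ℝ) : ℂ) := by
        simpa using (hasDerivAt_id ((1 : ℝ) : ℂ)).mul_const z
      have h3 := (HasDerivAt.comp ((1 : ℝ) : ℂ) (h₂ := w) (by simpa using hd) h2).comp_ofReal
      refine h3.congr_deriv (mul_comm _ _)
    -- by the Schwarz lemma `|w (t z)| ≤ t` for `t < 1`, with equality at `t = 1`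
    have h2 := (hasDerivAt_normSq_comp h1).sub (hasDerivAt_pow 2 (1 : ℝ))
    have h3 := (hasDerivWithinAt_iff_tendsto_slope' (s := Iio (1 : ℝ)) (by simp)).1
      h2.hasDerivWithinAt
    have h4 : ∀ᶠ t in 𝓝[<] (1 : ℝ),
        0 ≤ slope ((fun t : ℝ => normSq (w (t * z))) - fun x : ℝ => x ^ 2) 1 t := by
      filter_upwards [Ioo_mem_nhdsLT (zero_lt_one' ℝ)] with t ht
      have h5 : ‖(t : ℂ) * z‖ = t * ‖z‖ := by
        rw [norm_mul, norm_real, Real.norm_of_nonneg ht.1.le]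
      have h6 := dist_le_div_mul_dist_of_mapsTo_ball hw hm (z := t * z) (by
        rw [mem_ball_zero_iff, h5]
        nlinarith [ht.2])
      rw [hw0, dist_zero_right, dist_zero_right, h5] at h6
      have h7 : 1 / ‖z‖ * (t * ‖z‖) = t := by field_simp
      rw [h7] at h6
      rw [slope_def_field]
      simp only [Pi.sub_apply, ofReal_one, one_mul, hnz]
      refine div_nonneg_of_nonpos ?_ (by linarith [ht.2])
      rw [normSq_eq_norm_sq]
      nlinarith [norm_nonneg (w (t * z))]
    have h8 := ge_of_tendsto h3 h4
    simp only [ofReal_one, one_mul] at h8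
    norm_num at h8
    simp only [mul_re, mul_im, conj_re, conj_im] at h8 ⊢
    linarith
  · have h1 : HasDerivAt (fun t : ℝ => w (z * exp (t * I))) (z * w' * I) 0 := by
      have h2 : HasDerivAt (fun t : ℂ => z * exp (t * I)) (z * I) ((0 : ℝ) : ℂ) := by
        simpa using (((hasDerivAt_id ((0 : ℝ) : ℂ)).mul_const I).cexp).const_mul z
      have h3 := (HasDerivAt.comp ((0 : ℝ) : ℂ) (h₂ := w) (by simpa using hd) h2).comp_ofReal
      refine h3.congr_deriv (by ring)
    have h2 := hasDerivAt_normSq_comp h1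
    have h3 : IsLocalMax (fun t : ℝ => normSq (w (z * exp (t * I)))) 0 := by
      refine Eventually.of_forall fun t => ?_
      have h4 := hle (z * exp (t * I)) (by rw [norm_mul, norm_exp_ofReal_mul_I, mul_one])
      simp only [ofReal_zero, zero_mul, exp_zero, mul_one, hnz]
      rw [normSq_eq_norm_sq]
      exact pow_le_one₀ (norm_nonneg _) h4
    have h4 := h3.hasDerivAt_eq_zero h2
    simp only [ofReal_zero, zero_mul, exp_zero, mul_one] at h4
    rw [← mul_assoc, mul_I_re] at h4
    linarith

/-- A function with `D 0 = 1` whose logarithmic derivative satisfies `Re (z D' / D) < 1 / 2`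
differs from `1` by less than `1`. -/
theorem norm_sub_one_lt_one {D : ℂ → ℂ} (hD : DifferentiableOn ℂ D (ball 0 1)) (hD0 : D 0 = 1)
    (hne : ∀ z ∈ ball (0 : ℂ) 1, D z ≠ 0)
    (hre : ∀ z ∈ ball (0 : ℂ) 1, (z * deriv D z / D z).re < 1 / 2) :
    ∀ z ∈ ball (0 : ℂ) 1, ‖D z - 1‖ < 1 := by
  intro z₀ hz₀
  by_contra! hge
  set w : ℂ → ℂ := fun z => D z - 1
  have hwd : DifferentiableOn ℂ w (ball 0 1) := hD.sub_const 1
  have hw0 : w 0 = 0 := by simp [w, hD0]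
  have hz₀' : ‖z₀‖ < 1 := by simpa using hz₀
  have hsub : closedBall (0 : ℂ) ‖z₀‖ ⊆ ball 0 1 := closedBall_subset_ball hz₀'
  set C := closedBall (0 : ℂ) ‖z₀‖ ∩ (fun z => ‖w z‖) ⁻¹' Ici 1
  have hCc : IsCompact C := (isCompact_closedBall (0 : ℂ) ‖z₀‖).of_isClosed_subset
    ((hwd.continuousOn.mono hsub).norm.preimage_isClosed_of_isClosed isClosed_closedBall
      isClosed_Ici) inter_subset_left
  have hz₀C : z₀ ∈ C := ⟨by simp, hge⟩
  obtain ⟨z, hzC, hmin⟩ := hCc.exists_isMinOn ⟨z₀, hz₀C⟩ continuous_norm.continuousOn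
  have hzb : z ∈ ball (0 : ℂ) 1 := hsub hzC.1
  have hzz₀ : ‖z‖ ≤ ‖z₀‖ := hmin hz₀C
  have hz1 : ‖z‖ < 1 := hzz₀.trans_lt hz₀'
  have hlt : ∀ y : ℂ, ‖y‖ < ‖z‖ → ‖w y‖ < 1 := by
    intro y hy
    by_contra! h
    exact hy.not_ge (hmin ⟨by simpa using hy.le.trans hzz₀, h⟩)
  have hz0 : z ≠ 0 := by
    rintro rfl
    have h1 : (1 : ℝ) ≤ ‖w 0‖ := hzC.2
    rw [hw0, norm_zero] at h1
    linarith
  have hle : ∀ y : ℂ, ‖y‖ = ‖z‖ → ‖w y‖ ≤ 1 := by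
    intro y hy
    have hyb : y ∈ ball (0 : ℂ) 1 := by rw [mem_ball_zero_iff, hy]; exact hz1
    have hc : ContinuousAt w y := hwd.continuousOn.continuousAt (isOpen_ball.mem_nhds hyb)
    have h1 : Tendsto (fun t : ℝ => ‖w (t * y)‖) (𝓝[<] 1) (𝓝 ‖w y‖) := by
      have h2 : Tendsto (fun t : ℝ => (t : ℂ) * y) (𝓝[<] 1) (𝓝 y) := by
        have h3 : Continuous fun t : ℝ => (t : ℂ) * y := by fun_prop
        have h4 := h3.tendsto 1
        simp only [ofReal_one, one_mul] at h4
        exact h4.mono_left nhdsWithin_le_nhds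
      exact (hc.tendsto.comp h2).norm
    refine le_of_tendsto h1 ?_
    filter_upwards [Ioo_mem_nhdsLT (zero_lt_one' ℝ)] with t ht
    refine (hlt _ ?_).le
    have := norm_pos_iff.2 hz0
    rw [norm_mul, norm_real, Real.norm_of_nonneg ht.1.le, hy]
    nlinarith [ht.2]
  have hwz : ‖w z‖ = 1 := le_antisymm (hle z rfl) hzC.2
  have hDd := (hD.differentiableAt (isOpen_ball.mem_nhds hzb)).hasDerivAt
  obtain ⟨hm1, hm0⟩ := jack (hwd.mono (ball_subset_ball hz1.le)) hw0 (fun y hy => (hlt y hy).le)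
    hle hwz (hDd.sub_const 1)
  set m := conj (w z) * (z * deriv D z) with hm
  have hwc : w z * conj (w z) = 1 := by
    rw [mul_conj, normSq_eq_norm_sq, hwz]; norm_num
  have hmr : m = (m.re : ℂ) := by apply Complex.ext <;> simp [hm0]
  have hDz : D z = 1 + w z := by simp [w]
  have hDne := hne z hzb
  -- on the unit circle `w / (1 + w)` has real part `1 / 2`
  have h1 : z * deriv D z / D z = (m.re : ℝ) * (w z / (1 + w z)) := by
    rw [← hmr, hDz]
    have : z * deriv D z = m * w z := by
      rw [hm]
      linear_combination -(z * deriv D z) * hwc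
    rw [this, mul_div_assoc]
  have h2 : (w z / (1 + w z)).re = 1 / 2 := by
    rw [hDz] at hDne
    have hns : normSq (w z) = 1 := by rw [normSq_eq_norm_sq, hwz]; norm_num
    have h3 : 0 < normSq (1 + w z) := normSq_pos.2 hDne
    rw [Complex.div_re, ← add_div, div_eq_iff h3.ne']
    rw [normSq_apply] at hns h3 ⊢
    simp only [add_re, add_im, one_re, one_im] at h3 ⊢
    linear_combination (1 / 2) * hns
  have h4 := hre z hzb
  rw [h1, re_ofReal_mul, h2] at h4
  linarith

theorem re_sq_sub_one_mul_lt {u q : ℂ} (hu : 0 < u.re) (hq : u.re * ‖q‖ ^ 2 ≤ q.re) :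
    ((u ^ 2 - 1) * q).re < u.re := by
  set x := u.re with hx
  have hsq : (u ^ 2 - 1).re = x ^ 2 - u.im ^ 2 - 1 := by
    simp only [sub_re, one_re, sq, mul_re]; ring
  -- `q` lies in the closed disk with centre and radius `1 / (2 x)`
  have hdisk : ‖2 * x * q - 1‖ ≤ 1 := by
    refine le_of_sq_le_sq ?_ zero_le_one
    rw [Complex.sq_norm, normSq_apply] at hq ⊢
    simp only [sub_re, sub_im, mul_re, mul_im, ofReal_re, ofReal_im, one_re, one_im, re_ofNat,
      im_ofNat]
    nlinarith
  have hlt : ‖u ^ 2 - 1‖ < x ^ 2 + u.im ^ 2 + 1 := by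
    refine lt_of_pow_lt_pow_left₀ 2 (by positivity) ?_
    rw [Complex.sq_norm, normSq_apply, hsq]
    have h1 : (u ^ 2 - 1).im = 2 * x * u.im := by
      simp only [sub_im, one_im, sq, mul_im]; ring
    rw [h1]
    nlinarith [mul_pos hu hu]
  have h1 : 2 * x * ((u ^ 2 - 1) * q).re =
      (u ^ 2 - 1).re + ((u ^ 2 - 1) * (2 * x * q - 1)).re := by
    rw [← add_re, show u ^ 2 - 1 + (u ^ 2 - 1) * (2 * x * q - 1) =
      ((2 * x : ℝ) : ℂ) * ((u ^ 2 - 1) * q) by push_cast; ring, re_ofReal_mul]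
  have h2 : ((u ^ 2 - 1) * (2 * x * q - 1)).re ≤ ‖u ^ 2 - 1‖ := by
    refine (re_le_norm _).trans ?_
    rw [norm_mul]
    exact mul_le_of_le_one_right (norm_nonneg _) hdisk
  nlinarith

namespace IsCO

variable {α : ℝ} {f : ℂ → ℂ}

/-- The bound for `q = F'' / F'` transferred to `D = (1 - z) ^ 3 f'` in the disk, by means of
`z D' / D = ((u ^ 2 - 1) q - (u - 1)) / 2`. -/
theorem re_mul_deriv_div_lt (hf : IsCO α f) {z : ℂ} (hz : z ∈ ball (0 : ℂ) 1) :
    (z * deriv (fun z => (1 - z) ^ 3 * deriv f z) z / ((1 - z) ^ 3 * deriv f z)).re < 1 / 2 := by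
  set F := halfPlaneMap f
  have hz1 := one_sub_ne_zero_of_mem_ball hz
  set u := (1 + z) / (1 - z) with hu
  have hupos : 0 < u.re := re_cayley_pos hz
  have hEq : EqOn (fun z => (1 - z) ^ 3 * deriv f z)
      (fun z => 2 * (1 - z) * deriv F ((1 + z) / (1 - z))) (ball 0 1) := by
    intro y hy
    simp only [F]
    rw [hf.deriv_halfPlaneMap (re_cayley_pos hy), inv_cayley_cayley hy]
    ring
  have hF' := hf.deriv_halfPlaneMap_ne_zero hupos
  have hder : deriv (fun z => (1 - z) ^ 3 * deriv f z) z =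
      -2 * deriv F u + 4 / (1 - z) * deriv (deriv F) u := by
    rw [(hEq.eventuallyEq_of_mem (isOpen_ball.mem_nhds hz)).deriv_eq]
    have h1 : HasDerivAt (fun z : ℂ => (1 + z) / (1 - z)) (2 / (1 - z) ^ 2) z := by
      refine (((hasDerivAt_id z).const_add 1).div ((hasDerivAt_id z).const_sub 1) hz1).congr_deriv
        ?_
      simp only [id]
      ring
    have h2 := (hf.differentiableOn_deriv_halfPlaneMap.differentiableAt
      (isOpen_re_pos.mem_nhds hupos)).hasDerivAt
    have h3 := ((((hasDerivAt_id z).const_sub 1).const_mul 2).mul (h2.comp z h1)).deriv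
    refine h3.trans ?_
    simp only [id, Function.comp, ← hu]
    field_simp
    ring
  have hval : (1 - z) ^ 3 * deriv f z = 2 * (1 - z) * deriv F u := hEq hz
  have hq := hf.re_mul_sq_norm_le hupos
  have hlt := re_sq_sub_one_mul_lt hupos hq
  set q := deriv (deriv F) u / deriv F u with hqdef
  have hform : z * deriv (fun z => (1 - z) ^ 3 * deriv f z) z / ((1 - z) ^ 3 * deriv f z) =
      ((u ^ 2 - 1) * q - (u - 1)) / (2 : ℝ) := by
    rw [hder, hval, hqdef, hu]
    have hF'' : deriv F ((1 + z) / (1 - z)) ≠ 0 := hF'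
    push_cast
    field_simp
    ring
  rw [hform, div_ofReal_re, sub_re, sub_re, one_re]
  linarith

/-- The coefficient estimate for `CO 2` in terms of the Taylor series. -/
theorem norm_coeff_taylor_sub_le (hf : IsCO α f) (N : ℕ) :
    ‖(taylor f).coeff (N + 2) - ((N + 2 : ℂ) + 1) / 2‖ ≤ ((N + 2 : ℝ) - 1) / 2 := by
  set D : ℂ → ℂ := fun z => (1 - z) ^ 3 * deriv f z
  have hD : DifferentiableOn ℂ D (ball 0 1) :=
    DifferentiableOn.mul (by fun_prop) hf.deriv_analytic
  have hD0 : D 0 = 1 := by simp [D, hf.deriv_zero]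
  have hlt := norm_sub_one_lt_one hD hD0 (fun z hz => mul_ne_zero
    (pow_ne_zero 3 (one_sub_ne_zero_of_mem_ball hz)) (hf.deriv_ne_zero hz))
    fun z hz => hf.re_mul_deriv_div_lt hz
  set ψ : ℂ → ℂ := fun z => -dslope D 0 z
  have hψ : DifferentiableOn ℂ ψ (ball 0 1) :=
    ((differentiableOn_dslope (ball_mem_nhds 0 one_pos)).2 hD).neg
  have hb : ∀ z ∈ ball (0 : ℂ) 1, ‖ψ z‖ ≤ 1 := by
    intro z hz
    have := norm_dslope_le_div_of_mapsTo_ball (R₂ := 1) hD (fun y hy => by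
      rw [mem_closedBall, dist_eq_norm, hD0]; exact (hlt y hy).le) hz
    rwa [div_one, ← norm_neg] at this
  refine ConcaveUnivalent.norm_coeff_taylor_sub_le hf.analytic hψ hb (fun z hz => ?_) N
  have h1 := sub_smul_dslope D 0 z
  rw [hD0, sub_zero, smul_eq_mul] at h1
  simp only [ψ]
  linear_combination -h1

end IsCO

/-! ### The extremal functions -/

/-- The extremal function of `CO α`, whose image is a sector of opening `π α`. -/
noncomputable def extremal (α : ℝ) (z : ℂ) : ℂ := (((1 + z) / (1 - z)) ^ (α : ℂ) - 1) / (2 * α)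

/-- The closed convex sector of the points `v` with `v = 0` or `|arg v| ≥ θ`, for an angle `θ`
between `π / 2` and `π`, as an intersection of half-planes. The condition `v.re ≤ 0` matters only
for `θ = π`, when the sector is a ray. -/
def closedSector (θ : ℝ) : Set ℂ :=
  {v | v.re ≤ 0 ∧ Real.sin θ * v.re - Real.cos θ * v.im ≤ 0 ∧
    Real.sin θ * v.re + Real.cos θ * v.im ≤ 0}

theorem sin_sub_abs (θ : ℝ) {t : ℝ} (ht : |t| ≤ Real.pi) :
    Real.sin (θ - |t|) = Real.sin θ * Real.cos t - Real.cos θ * |Real.sin t| := by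
  have hsin : |Real.sin t| = Real.sin |t| := by
    rcases abs_cases t with ⟨h, h'⟩ | ⟨h, h'⟩
    · rw [h] at ht ⊢
      exact abs_of_nonneg (Real.sin_nonneg_of_nonneg_of_le_pi h' ht)
    · rw [h] at ht ⊢
      rw [Real.sin_neg]
      exact abs_of_nonpos (Real.sin_nonpos_of_nonpos_of_neg_pi_le h'.le (by linarith))
  rw [Real.sin_sub, Real.cos_abs, hsin]

theorem mem_closedSector_iff {θ : ℝ} (h1 : Real.pi / 2 < θ) (h2 : θ ≤ Real.pi) {r t : ℝ}
    (hr : 0 < r) (ht : |t| ≤ Real.pi) : (r : ℂ) * exp (t * I) ∈ closedSector θ ↔ θ ≤ |t| := by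
  have hc : Real.cos θ < 0 := Real.cos_neg_of_pi_div_two_lt_of_lt h1 (by linarith)
  have hdiff := sin_sub_abs θ ht
  have hmem : (r : ℂ) * exp (t * I) ∈ closedSector θ ↔
      Real.cos t ≤ 0 ∧ Real.sin (θ - |t|) ≤ 0 := by
    simp only [closedSector, mem_ofPred_eq, re_ofReal_mul, im_ofReal_mul, exp_ofReal_mul_I_re,
      exp_ofReal_mul_I_im]
    have e1 : Real.sin θ * (r * Real.cos t) - Real.cos θ * (r * Real.sin t) =
      r * (Real.sin θ * Real.cos t - Real.cos θ * Real.sin t) := by ring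
    have e2 : Real.sin θ * (r * Real.cos t) + Real.cos θ * (r * Real.sin t) =
      r * (Real.sin θ * Real.cos t + Real.cos θ * Real.sin t) := by ring
    rw [e1, e2, hdiff, mul_nonpos_iff_pos_imp_nonpos, mul_nonpos_iff_pos_imp_nonpos,
      mul_nonpos_iff_pos_imp_nonpos]
    have e3 : ∀ y : ℝ, (0 < r → y ≤ 0) ∧ (y < 0 → 0 ≤ r) ↔ y ≤ 0 := fun y =>
      ⟨fun h => h.1 hr, fun h => ⟨fun _ => h, fun _ => hr.le⟩⟩
    rw [e3, e3, e3]
    refine and_congr_right fun _ => ?_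
    rcases abs_cases (Real.sin t) with ⟨h, h'⟩ | ⟨h, h'⟩ <;> rw [h] <;>
      constructor <;> intro H
    · exact H.1
    · exact ⟨H, by nlinarith⟩
    · linarith [H.2]
    · exact ⟨by nlinarith, by linarith⟩
  rw [hmem]
  constructor
  · rintro ⟨hcos, hs⟩
    by_contra! hlt
    have hpos : 0 < θ - |t| := by linarith
    rcases lt_or_eq_of_le (show θ - |t| ≤ Real.pi by linarith [abs_nonneg t]) with h | h
    · exact hs.not_gt (Real.sin_pos_of_pos_of_lt_pi hpos h)
    · have : t = 0 := abs_eq_zero.1 (le_antisymm (by linarith) (abs_nonneg t))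
      rw [this, Real.cos_zero] at hcos
      linarith
  · intro h
    constructor
    · rw [← Real.cos_abs]
      exact (Real.cos_neg_of_pi_div_two_lt_of_lt (by linarith) (by linarith [Real.pi_pos])).le
    · exact Real.sin_nonpos_of_nonpos_of_neg_pi_le (by linarith) (by linarith)

theorem convex_closedSector (θ : ℝ) : Convex ℝ (closedSector θ) := by
  intro v hv w hw a b ha hb hab
  simp only [closedSector, mem_ofPred_eq, add_re, add_im, real_smul, re_ofReal_mul,
    im_ofReal_mul] at hv hw ⊢
  refine ⟨?_, ?_, ?_⟩
  · nlinarith [mul_nonneg ha (neg_nonneg.2 hv.1), mul_nonneg hb (neg_nonneg.2 hw.1)]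
  · nlinarith [mul_nonneg ha (neg_nonneg.2 hv.2.1), mul_nonneg hb (neg_nonneg.2 hw.2.1)]
  · nlinarith [mul_nonneg ha (neg_nonneg.2 hv.2.2), mul_nonneg hb (neg_nonneg.2 hw.2.2)]

theorem zero_mem_closedSector (θ : ℝ) : (0 : ℂ) ∈ closedSector θ := by simp [closedSector]

theorem arg_cpow_ofReal {u : ℂ} (hu : u ≠ 0) {c : ℝ} (h : |c * arg u| < Real.pi) :
    arg (u ^ (c : ℂ)) = c * arg u := by
  rw [abs_lt] at h
  have h1 : (Complex.log u * c).im = c * arg u := by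
    rw [im_mul_ofReal, log_im, mul_comm]
  rw [cpow_def_of_ne_zero hu, ← log_im, log_exp (by rw [h1]; exact h.1) (by rw [h1]; exact h.2.le),
    h1]

theorem cpow_cpow_inv_ofReal {u : ℂ} {c : ℝ} (hc : c ≠ 0) (h : |c * arg u| < Real.pi) :
    (u ^ (c : ℂ)) ^ ((c⁻¹ : ℝ) : ℂ) = u := by
  rw [abs_lt] at h
  have h1 : (Complex.log u * c).im = c * arg u := by
    rw [im_mul_ofReal, log_im, mul_comm]
  rw [← cpow_mul _ (by rw [h1]; exact h.1) (by rw [h1]; exact h.2.le), ← ofReal_mul,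
    mul_inv_cancel₀ hc, ofReal_one, cpow_one]

theorem abs_mul_arg_lt {α : ℝ} (h1 : 1 < α) {u : ℂ} (hu : 0 < u.re) :
    |α * arg u| < Real.pi * α / 2 := by
  have h3 : |arg u| < Real.pi / 2 := abs_arg_lt_pi_div_two_iff.2 (Or.inl hu)
  rw [abs_mul, abs_of_pos (by linarith : 0 < α)]
  nlinarith

/-- The omitted set of the extremal function is the sector `|arg (2 α w + 1)| ≥ π α / 2`. -/
theorem compl_image_extremal {α : ℝ} (h1 : 1 < α) (h2 : α ≤ 2) :
    (extremal α '' ball 0 1)ᶜ = {w : ℂ | 2 * α * w + 1 ∈ closedSector (Real.pi * α / 2)} := by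
  have hpi := Real.pi_pos
  have hα : (2 * α : ℂ) ≠ 0 := by exact_mod_cast (by linarith : (0 : ℝ) < 2 * α).ne'
  have hθ1 : Real.pi / 2 < Real.pi * α / 2 := by nlinarith
  have hθ2 : Real.pi * α / 2 ≤ Real.pi := by nlinarith
  have hpolar : ∀ v : ℂ, v ≠ 0 → (v ∈ closedSector (Real.pi * α / 2) ↔
      Real.pi * α / 2 ≤ |arg v|) := by
    intro v hv
    have h := mem_closedSector_iff hθ1 hθ2 (norm_pos_iff.2 hv) (abs_arg_le_pi v)
    rwa [norm_mul_exp_arg_mul_I] at h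
  ext w
  rw [mem_compl_iff, not_iff_comm, mem_ofPred_eq]
  constructor
  · intro hw
    set v := 2 * α * w + 1 with hv
    have hv0 : v ≠ 0 := fun h => hw (h ▸ zero_mem_closedSector _)
    rw [hpolar v hv0, not_le] at hw
    set u := v ^ ((α⁻¹ : ℝ) : ℂ) with hu
    have hα0 : (0 : ℝ) < α := by linarith
    have hinv : |α⁻¹ * arg v| < Real.pi / 2 := by
      rw [abs_mul, abs_of_pos (inv_pos.2 hα0), inv_mul_lt_iff₀ hα0]
      linarith
    have hu0 : u ≠ 0 := fun h => hv0 ((cpow_eq_zero_iff _ _).1 h).1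
    have hure : 0 < u.re := by
      have h3 := arg_cpow_ofReal hv0 (hinv.trans (by linarith))
      rw [← hu] at h3
      rw [← h3, abs_arg_lt_pi_div_two_iff] at hinv
      exact hinv.resolve_right hu0
    refine ⟨(u - 1) / (u + 1), inv_cayley_mem_ball hure, ?_⟩
    have h4 : (1 + (u - 1) / (u + 1)) / (1 - (u - 1) / (u + 1)) = u := by
      have := add_one_ne_zero_of_re_pos hure
      rw [one_sub_inv_cayley hure]
      field_simp
      ring
    have h5 : u ^ (α : ℂ) = v := by
      have := cpow_cpow_inv_ofReal (inv_ne_zero hα0.ne') (hinv.trans (by linarith))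
      rwa [inv_inv] at this
    rw [extremal, h4, h5, hv, add_sub_cancel_right, mul_div_cancel_left₀ _ hα]
  · rintro ⟨z, hz, rfl⟩
    have hu := re_cayley_pos hz
    have hu0 : (1 + z) / (1 - z) ≠ 0 := slitPlane_ne_zero (cayley_mem_slitPlane hz)
    rw [extremal, mul_div_cancel₀ _ hα, sub_add_cancel,
      hpolar _ fun h => hu0 ((cpow_eq_zero_iff _ _).1 h).1, not_le,
      arg_cpow_ofReal hu0 ((abs_mul_arg_lt h1 hu).trans_le hθ2)]
    exact abs_mul_arg_lt h1 hu

theorem tendsto_extremal {α : ℝ} (h1 : 1 < α) :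
    Tendsto (extremal α) (𝓝[ball 0 1] 1) (Bornology.cobounded ℂ) := by
  have hα0 : (0 : ℝ) < α := by linarith
  rw [← tendsto_norm_atTop_iff_cobounded]
  have hden : Tendsto (fun z : ℂ => ‖1 - z‖) (𝓝[ball 0 1] 1) (𝓝[>] 0) := by
    refine tendsto_nhdsWithin_iff.2 ⟨?_, ?_⟩
    · have h2 : Continuous fun z : ℂ => ‖1 - z‖ := by fun_prop
      have h3 := h2.tendsto 1
      simp only [sub_self, norm_zero] at h3
      exact h3.mono_left nhdsWithin_le_nhds
    · filter_upwards [self_mem_nhdsWithin] with z hz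
      exact norm_pos_iff.2 (one_sub_ne_zero_of_mem_ball hz)
  have hnum : Tendsto (fun z : ℂ => ‖1 + z‖) (𝓝[ball 0 1] 1) (𝓝 ‖(1 : ℂ) + 1‖) := by
    have h2 : Continuous fun z : ℂ => ‖1 + z‖ := by fun_prop
    exact (h2.tendsto 1).mono_left nhdsWithin_le_nhds
  have hu : Tendsto (fun z : ℂ => ‖(1 + z) / (1 - z)‖) (𝓝[ball 0 1] 1) atTop := by
    have h2 := hnum.pos_mul_atTop (by norm_num) (tendsto_inv_nhdsGT_zero.comp hden)
    refine h2.congr fun z => ?_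
    rw [norm_div, div_eq_mul_inv]
    rfl
  have hpow := (tendsto_rpow_atTop hα0).comp hu
  have h3 : Tendsto (fun z : ℂ => (‖(1 + z) / (1 - z)‖ ^ α + -1) / (2 * α)) (𝓝[ball 0 1] 1) atTop :=
    (tendsto_atTop_add_const_right _ (-1) hpow).atTop_div_const (by positivity)
  refine tendsto_atTop_mono (fun z => ?_) h3
  have h4 : ‖(2 * α : ℂ)‖ = 2 * α := by
    rw [norm_mul, Complex.norm_two, norm_real, Real.norm_of_nonneg hα0.le]
  rw [extremal, norm_div (_ - 1), h4, ← norm_cpow_real]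
  gcongr
  have := norm_sub_norm_le (((1 + z) / (1 - z)) ^ (α : ℂ)) 1
  rwa [norm_one, sub_eq_add_neg] at this

theorem isCO_extremal {α : ℝ} (h1 : 1 < α) (h2 : α ≤ 2) : IsCO α (extremal α) := by
  have hpi := Real.pi_pos
  have hα0 : (0 : ℝ) < α := by linarith
  have hα : (2 * α : ℂ) ≠ 0 := by exact_mod_cast (by linarith : (0 : ℝ) < 2 * α).ne'
  have hθ1 : Real.pi / 2 < Real.pi * α / 2 := by nlinarith
  have hθ2 : Real.pi * α / 2 ≤ Real.pi := by nlinarith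
  constructor
  · exact ((differentiableOn_cayley_cpow _).sub_const 1).div_const _
  · intro z hz w hw h
    have h3 : ((1 + z) / (1 - z)) ^ (α : ℂ) = ((1 + w) / (1 - w)) ^ (α : ℂ) := by
      simp only [extremal] at h
      exact sub_left_injective ((div_left_inj' hα).1 h)
    have h4 := fun y (hy : y ∈ ball (0 : ℂ) 1) =>
      cpow_cpow_inv_ofReal hα0.ne' ((abs_mul_arg_lt h1 (re_cayley_pos hy)).trans_le hθ2)
    have h5 := (h4 z hz).symm.trans ((congrArg (· ^ ((α⁻¹ : ℝ) : ℂ)) h3).trans (h4 w hw))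
    rw [← inv_cayley_cayley hz, ← inv_cayley_cayley hw, h5]
  · rw [compl_image_extremal h1 h2]
    intro v hv w hw a b ha hb hab
    have h3 := convex_closedSector _ hv hw ha hb hab
    rw [mem_ofPred_eq]
    convert h3 using 1
    have : (a : ℂ) + b = 1 := by exact_mod_cast hab
    simp only [real_smul]
    linear_combination -this
  · simp [extremal]
  · have h3 := (((hasDerivAt_cayley_cpow (z := 0) (by simp) α).sub_const 1).div_const
      (2 * α : ℂ)).deriv
    refine Eq.trans h3 ?_
    field_simp
    simp [hα0.ne']
  · exact tendsto_extremal h1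
  · -- directions outside the sector eventually stay in the omitted set
    have hsub : {t : ℝ | t ∈ Ioc (-Real.pi) Real.pi ∧
        ∀ᶠ r : ℝ in atTop, (r : ℂ) * exp ((t : ℂ) * I) ∈ extremal α '' ball 0 1} ⊆
        Icc (-(Real.pi * α / 2)) (Real.pi * α / 2) := by
      rintro t ⟨ht, hev⟩
      rw [mem_Icc, ← abs_le]
      by_contra! hlt
      have htpi : |t| ≤ Real.pi := abs_le.2 ⟨ht.1.le, ht.2⟩
      have hcos : Real.cos t < 0 := by
        rw [← Real.cos_abs]
        exact Real.cos_neg_of_pi_div_two_lt_of_lt (by linarith) (by linarith)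
      have hsin : Real.sin (Real.pi * α / 2 - |t|) < 0 :=
        Real.sin_neg_of_neg_of_neg_pi_lt (by linarith) (by linarith)
      have hcosθ : Real.cos (Real.pi * α / 2) < 0 :=
        Real.cos_neg_of_pi_div_two_lt_of_lt hθ1 (by linarith)
      obtain ⟨r, ⟨hr, hr1⟩, hr2, hr0⟩ := ((hev.and (eventually_ge_atTop (1 / -Real.cos t))).and
        ((eventually_ge_atTop (1 / -Real.sin (Real.pi * α / 2 - |t|))).and
          (eventually_gt_atTop 0))).exists
      rw [div_le_iff₀ (by linarith)] at hr1 hr2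
      refine absurd hr (?_ : _ ∈ (extremal α '' ball 0 1)ᶜ)
      rw [compl_image_extremal h1 h2, mem_ofPred_eq]
      have e1 : (2 * α * (r * exp (t * I)) + 1).re = 2 * α * r * Real.cos t + 1 := by
        rw [show (2 * α * (r * exp (t * I)) + 1 : ℂ) =
          ((2 * α * r : ℝ) : ℂ) * exp (t * I) + 1 by push_cast; ring, add_re, re_ofReal_mul,
          exp_ofReal_mul_I_re, one_re]
      have e2 : (2 * α * (r * exp (t * I)) + 1).im = 2 * α * r * Real.sin t := by
        rw [show (2 * α * (r * exp (t * I)) + 1 : ℂ) =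
          ((2 * α * r : ℝ) : ℂ) * exp (t * I) + 1 by push_cast; ring, add_im, im_ofReal_mul,
          exp_ofReal_mul_I_im, one_im, add_zero]
      simp only [closedSector, mem_ofPred_eq, e1, e2]
      have hαr : r ≤ 2 * α * r := by nlinarith
      have hs1 := Real.sin_le_one (Real.pi * α / 2)
      have k1 : 2 * α * r * Real.cos t + 1 ≤ 0 := by nlinarith
      have k2 : 2 * α * r * Real.sin (Real.pi * α / 2 - |t|) + 1 ≤ 0 := by nlinarith
      rw [sin_sub_abs _ htpi] at k2
      have k3 : 2 * α * r * (Real.cos (Real.pi * α / 2) * |Real.sin t|) ≤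
          2 * α * r * (Real.cos (Real.pi * α / 2) * Real.sin t) :=
        mul_le_mul_of_nonneg_left
          (mul_le_mul_of_nonpos_left (le_abs_self _) hcosθ.le) (by positivity)
      have k4 : 2 * α * r * (Real.cos (Real.pi * α / 2) * |Real.sin t|) ≤
          2 * α * r * (Real.cos (Real.pi * α / 2) * -Real.sin t) :=
        mul_le_mul_of_nonneg_left
          (mul_le_mul_of_nonpos_left (neg_le_abs _) hcosθ.le) (by positivity)
      exact ⟨k1, by linarith, by linarith⟩
    refine (measure_mono hsub).trans ?_
    rw [Real.volume_Icc]
    exact ENNReal.ofReal_le_ofReal (by linarith)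

open PowerSeries in
theorem coeff_taylor_extremal_succ {α : ℝ} (hα : 1 ≤ α) (n : ℕ) :
    (taylor (extremal α)).coeff (n + 1) = ((1 / (2 * α) * A α (n + 1) : ℝ) : ℂ) := by
  have h1 : EqOn (extremal α)
      (fun z => -(1 / (2 * α) : ℂ) * (1 - 1 * ((1 + z) / (1 - z)) ^ (α : ℂ))) (ball 0 1) := by
    intro z _
    simp only [extremal]
    ring
  have hd := differentiableOn_cayley_cpow α
  rw [taylor_congr h1, taylor_const_mul ((hd.const_mul 1).const_sub 1),
    taylor_one_sub_const_mul hd, coeff_C_mul, map_sub, coeff_C_mul, ← ofReal_A hα, coeff_one,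
    if_neg n.succ_ne_zero]
  push_cast
  ring

theorem IsCO.hasExpansion {α : ℝ} {f : ℂ → ℂ} (hf : IsCO α f) :
    HasExpansion f fun n => (taylor f).coeff n := by
  intro z hz
  have h0 : (taylor f).coeff 0 = 0 := by rw [coeff_zero_taylor, hf.map_zero]
  have h1 : (taylor f).coeff 1 = 1 := by simp [taylor, hf.deriv_zero]
  have h2 := hasSum_taylor hf.analytic hz
  refine (hasSum_nat_add_iff (f := fun n => (taylor f).coeff n * z ^ n) 2).2 ?_
  simpa [Finset.sum_range_succ, h0, h1] using h2

open PowerSeries in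
/-- The extremal function of `CO 2` is the Koebe function. -/
theorem coeff_taylor_extremal_two (n : ℕ) : (taylor (extremal 2)).coeff (n + 1) = n + 1 := by
  have h1 : EqOn (fun z => (1 - z) ^ 2 * extremal 2 z) (fun z => z) (ball 0 1) := by
    intro z hz
    have := one_sub_ne_zero_of_mem_ball hz
    simp only [extremal]
    rw [ofReal_ofNat, cpow_ofNat]
    field_simp
    ring
  have h2 := taylor_congr h1
  rw [taylor_mul (by fun_prop) (isCO_extremal one_lt_two le_rfl).analytic] at h2
  have e1 := taylor_eval ((1 - Polynomial.X) ^ 2)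
  have e2 := taylor_eval Polynomial.X
  simp only [Polynomial.eval_pow, Polynomial.eval_sub, Polynomial.eval_one, Polynomial.eval_X,
    Polynomial.coe_pow, Polynomial.coe_sub, Polynomial.coe_one, Polynomial.coe_X] at e1 e2
  rw [e1, e2] at h2
  have h3 : taylor (extremal 2) = X * (PowerSeries.mk 1 * PowerSeries.mk 1) := by
    calc taylor (extremal 2) = (PowerSeries.mk 1 * (1 - X)) ^ 2 * taylor (extremal 2) := by
          rw [mk_one_mul_one_sub_eq_one ℂ]; ring
      _ = PowerSeries.mk 1 ^ 2 * ((1 - X) ^ 2 * taylor (extremal 2)) := by ring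
      _ = _ := by rw [h2]; ring
  rw [h3, coeff_succ_X_mul, coeff_mk_one_sq]

end ConcaveUnivalent

theorem corollary3 :
    (∀ α : ℝ, 1 < α → α ≤ 2 →
      -- the real numbers `A α n` are the Taylor coefficients of `((1 + z) / (1 - z)) ^ α`
      (∀ z ∈ Metric.ball (0 : ℂ) 1,
        HasSum (fun n : ℕ => (ConcaveUnivalent.A α n : ℂ) * z ^ n)
          (((1 + z) / (1 - z)) ^ (α : ℂ))) ∧
      -- the coefficient bound
      (∀ (f : ℂ → ℂ) (a : ℕ → ℂ), ConcaveUnivalent.IsCO α f → ConcaveUnivalent.HasExpansion f a →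
        ∀ n : ℕ, 2 ≤ n → ‖a n‖ ≤ 1 / (2 * α) * ConcaveUnivalent.A α n) ∧
      -- its sharpness
      (∃ (f : ℂ → ℂ) (a : ℕ → ℂ), ConcaveUnivalent.IsCO α f ∧ ConcaveUnivalent.HasExpansion f a ∧
        ∀ n : ℕ, 2 ≤ n → ‖a n‖ = 1 / (2 * α) * ConcaveUnivalent.A α n)) ∧
    -- the coefficient estimate for `CO 2`
    (∀ (f : ℂ → ℂ) (a : ℕ → ℂ), ConcaveUnivalent.IsCO 2 f → ConcaveUnivalent.HasExpansion f a →
      ∀ n : ℕ, 2 ≤ n → ‖a n - ((n : ℂ) + 1) / 2‖ ≤ ((n : ℝ) - 1) / 2) ∧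
    -- its sharpness
    (∃ (f : ℂ → ℂ) (a : ℕ → ℂ), ConcaveUnivalent.IsCO 2 f ∧ ConcaveUnivalent.HasExpansion f a ∧
      ∀ n : ℕ, 2 ≤ n → ‖a n - ((n : ℂ) + 1) / 2‖ = ((n : ℝ) - 1) / 2) := by
  open ConcaveUnivalent in
  refine ⟨fun α h1 h2 => ⟨fun z hz => ?_, fun f a hf ha n hn => ?_, ?_⟩,
    fun f a hf ha n hn => ?_, ?_⟩
  · simp only [ofReal_A h1.le]
    exact hasSum_taylor (differentiableOn_cayley_cpow α) hz
  · obtain ⟨m, rfl⟩ := Nat.exists_eq_add_of_le' hn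
    rw [ha.eq_coeff_taylor hn]
    exact hf.norm_coeff_taylor_le h1 h2 (m + 1)
  · refine ⟨extremal α, _, isCO_extremal h1 h2, (isCO_extremal h1 h2).hasExpansion, fun n hn => ?_⟩
    obtain ⟨m, rfl⟩ := Nat.exists_eq_add_of_le' hn
    have h3 : (0 : ℝ) < α := by linarith
    have h4 := A_nonneg h1.le (m + 1)
    rw [coeff_taylor_extremal_succ h1.le, Complex.norm_real, Real.norm_of_nonneg (by positivity)]
  · obtain ⟨m, rfl⟩ := Nat.exists_eq_add_of_le' hn
    rw [ha.eq_coeff_taylor hn]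
    have := hf.norm_coeff_taylor_sub_le m
    push_cast
    exact this
  · have hco := isCO_extremal one_lt_two le_rfl
    refine ⟨extremal 2, _, hco, hco.hasExpansion, fun n hn => ?_⟩
    obtain ⟨m, rfl⟩ := Nat.exists_eq_add_of_le' hn
    rw [coeff_taylor_extremal_two]
    have h3 : ((m + 1 : ℕ) : ℂ) + 1 - (((m + 2 : ℕ) : ℂ) + 1) / 2 = (((m + 1) / 2 : ℝ) : ℂ) := by
      push_cast
      ring
    rw [h3, Complex.norm_real, Real.norm_of_nonneg (by positivity)]
    push_cast
    ring
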